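/- Let $n\ge 2$, $N\ge 1$, let $\Omega\subset\mathbb R^n$ be open and bounded, $0<T<\infty$, $p\in(1,\infty)$, $q\in(0,\infty)$, and put $\Omega_\tau:=\Omega\times[0,\tau)$. Let $E\subset\Omega_T$ be relatively open, with time slices $E^t:=\{x:(x,t)\in E\}$, and nondecreasing: $E^s\subset E^t$ for all $0\le s\le t<T$. Let $f:\Omega\times\mathbb R^N\times\mathbb R^{Nn}\to[0,\infty)$ be such that $x\mapsto f(x,u,\xi)\in L^1(\Omega)$ for all $(u,\xi)$, that $(u,\xi)\mapsto f(x,u,\xi)$ is convex for a.e. $x\in\Omega$, and that $$\nu|\xi|^p\le f(x,u,\xi)\le L\big(|\xi|^p+|u|^p+G(x)\big)\quad\text{for a.e. }x\in\Omega\text{ and all }(u,\xi)\in\mathbb R^N\times\mathbb R^{Nn},$$ where $0<\nu\le L$ and $G\in L^1(\Omega)$. Let $u_o\in L^{q+1}(E^0,\mathbb R^N)$ and $u_*\in W^{1,p}(\Omega,\mathbb R^N)\cap L^{q+1}(\Omega,\mathbb R^N)$. Let $V^p(E)$ be the set of all $v\in L^p(0,T;W^{1,p}(\Omega,\mathbb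 R^N))$ such that, for a.e. $t$, $v(t)\in u_*+W^{1,p}_0(\Omega,\mathbb R^N)$ and $v(t)=u_*$ a.e. in $\Omega\setminus E^t$, and let $V^p_q(E):=V^p(E)\cap L^{q+1}(\Omega_T,\mathbb R^N)$. For vectors $a,b\in\mathbb R^N$ write $a^{q}:=|a|^{q-1}a$ (with $0^{q}:=0$) and $\mathfrak b[a,b]:=\tfrac1{q+1}|b|^{q+1}-\tfrac1{q+1}|a|^{q+1}-a^{q}\cdot(b-a)$. A map $u\in L^\infty(0,T;L^{q+1}(\Omega,\mathbb R^N))\cap V^p_q(E)$ is called a variational solution if for every $v\in V^p_q(E)$ with weak time derivative $\partial_tv\in L^{q+1}(\Omega_T,\mathbb R^N)$ (so that $v$ is, after modification on a null set, continuous in time with values in $L^{q+1}(\Omega,\mathbb R^N)$) and for a.e. $\tau\in(0,T)$ $$\iint_{E\cap\Omega_\tau}f(x,u,Du)\,dx\,dt\le\iint_{E\cap\Omega_\tau}f(x,v,Dv)\,dx\,dt+\iint_{E\cap\Omega_\tau}\partial_tv\cdot(v^{q}-u^{q})\,dx\,dt-\int_{E^\tau}\mathfrak b[u(\tau),v(\tau)]\,dx+\int_{E^0}\mathfrak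 b[u_o,v(0)]\,dx .$$ Then every variational solution $u$ is a parabolic minimizer: $u\in V^p(E)$, $u^{q}=|u|^{q-1}u\in L^1(E,\mathbb R^N)$, and $$\iint_E u^{q}\cdot\partial_t\varphi+f(x,u,Du)\,dx\,dt\le\iint_E f(x,u+\varphi,Du+D\varphi)\,dx\,dt$$ for all $\varphi\in C_0^\infty(E,\mathbb R^N)$, i.e. for all $\varphi\in C^\infty(\mathbb R^n\times\mathbb R,\mathbb R^N)$ whose support is a compact subset of $E$ (in particular $\varphi(\cdot,0)=0$). -/

import Mathlib

open MeasureTheory Set Filter Topology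
open scoped ContDiff ENNReal NNReal

noncomputable section

namespace DoublyNonlinear

/-- `ℝᵏ` with its Euclidean norm. -/
abbrev Vec (k : ℕ) : Type := EuclideanSpace ℝ (Fin k)

/-- `ℝ^{N n}`, the space of `N × n` matrices, with its Euclidean (Frobenius) norm. -/
abbrev Mat (N n : ℕ) : Type := EuclideanSpace ℝ (Fin N × Fin n)

variable {n N : ℕ}

/-- `η ∈ C₀^∞(S)`: `η` is smooth on the whole space and its support is a compact subset of `S`. -/
structure IsTestFun {X F : Type*} [NormedAddCommGroup X] [NormedSpace ℝ X]
    [NormedAddCommGroup F] [NormedSpace ℝ F] (S : Set X) (η : X → F) : Prop where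
  smooth : ContDiff ℝ ∞ η
  compact : HasCompactSupport η
  support : tsupport η ⊆ S

/-- The Jacobian matrix `(∂ⱼ φᵢ(x))ᵢⱼ`. -/
def jac (φ : Vec n → Vec N) (x : Vec n) : Mat N n :=
  WithLp.toLp 2 fun ij => fderiv ℝ φ x (EuclideanSpace.single ij.2 1) ij.1

/-- The spatial gradient `Dφ(x,t)` of a map on space-time. -/
def spaceGrad (φ : Vec n × ℝ → Vec N) (z : Vec n × ℝ) : Mat N n :=
  jac (fun x => φ (x, z.2)) z.1

/-- The time derivative `∂ₜφ(x,t)` of a map on space-time. -/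
def timeDeriv {F : Type*} [NormedAddCommGroup F] [NormedSpace ℝ F]
    (φ : Vec n × ℝ → F) (z : Vec n × ℝ) : F :=
  deriv (fun t => φ (z.1, t)) z.2

/-! ### Domains -/

/-- The space-time cylinder `Ω × [0,τ)`. -/
def cyl (Ω : Set (Vec n)) (τ : ℝ) : Set (Vec n × ℝ) := Ω ×ˢ Ico 0 τ

/-- The time slice `Eᵗ = {x : (x,t) ∈ E}`. -/
def slice (E : Set (Vec n × ℝ)) (t : ℝ) : Set (Vec n) := {x | (x, t) ∈ E}

/-- `E` is a relatively open subset of `Ω × [0,T)`. -/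
def IsRelOpen (Ω : Set (Vec n)) (T : ℝ) (E : Set (Vec n × ℝ)) : Prop :=
  ∃ U : Set (Vec n × ℝ), IsOpen U ∧ E = U ∩ cyl Ω T

/-- The time slices satisfy `Eˢ ⊆ Eᵗ` for `0 ≤ s ≤ t < T`. -/
def IsNondecreasing (T : ℝ) (E : Set (Vec n × ℝ)) : Prop :=
  ∀ s t : ℝ, 0 ≤ s → s ≤ t → t < T → slice E s ⊆ slice E t

/-! ### Sobolev spaces -/

/-- `D` is the weak gradient of `v` in `Ω`: `∫_Ω vᵢ ∂ⱼη = - ∫_Ω Dᵢⱼ η` for all `η ∈ C₀^∞(Ω)`. -/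
def HasWeakGrad (Ω : Set (Vec n)) (v : Vec n → Vec N) (D : Vec n → Mat N n) : Prop :=
  ∀ η : Vec n → ℝ, IsTestFun Ω η → ∀ (i : Fin N) (j : Fin n),
    ∫ x in Ω, v x i * fderiv ℝ η x (EuclideanSpace.single j 1) = - ∫ x in Ω, D x (i, j) * η x

/-- `v ∈ W^{1,p}(Ω, ℝᴺ)` with weak gradient `D`. -/
structure MemW1p (p : ℝ) (Ω : Set (Vec n)) (v : Vec n → Vec N) (D : Vec n → Mat N n) :
    Prop where
  memLp : MemLp v (ENNReal.ofReal p) (volume.restrict Ω)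
  grad_memLp : MemLp D (ENNReal.ofReal p) (volume.restrict Ω)
  weakGrad : HasWeakGrad Ω v D

/-- `v ∈ W₀^{1,p}(Ω, ℝᴺ)` with weak gradient `D`: `v` belongs to the closure of `C₀^∞(Ω, ℝᴺ)`
in `W^{1,p}(Ω, ℝᴺ)`. -/
structure MemW1pZero (p : ℝ) (Ω : Set (Vec n)) (v : Vec n → Vec N) (D : Vec n → Mat N n) :
    Prop where
  memW1p : MemW1p p Ω v D
  approx : ∀ ε : ℝ≥0∞, 0 < ε → ∃ φ : Vec n → Vec N, IsTestFun Ω φ ∧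
    eLpNorm (fun x => v x - φ x) (ENNReal.ofReal p) (volume.restrict Ω) ≤ ε ∧
    eLpNorm (fun x => D x - jac φ x) (ENNReal.ofReal p) (volume.restrict Ω) ≤ ε

/-- `v ∈ V_t`, where `A` is the time slice `Eᵗ`: `v ∈ u_* + W₀^{1,p}(Ω, ℝᴺ)`, with weak
gradient `D`, and `v = u_*` a.e. in `Ω \ A`. Here `Dus` is the weak gradient of `us = u_*`. -/
structure MemVt (p : ℝ) (Ω A : Set (Vec n)) (us : Vec n → Vec N) (Dus : Vec n → Mat N n)
    (v : Vec n → Vec N) (D : Vec n → Mat N n) : Prop where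
  memW1p : MemW1p p Ω v D
  sub_memW1pZero : MemW1pZero p Ω (fun x => v x - us x) (fun x => D x - Dus x)
  eq_boundary : ∀ᵐ x ∂(volume.restrict (Ω \ A)), v x = us x

/-- `v ∈ V^p(E)` with weak spatial gradient `Dv`. The space `L^p(0,T; W^{1,p}(Ω, ℝᴺ))` is
described by maps on `Ω × [0,T)`: `v` and `Dv` lie in `L^p(Ω × [0,T))`, and `Dv(t)` is the
weak gradient of `v(t)` for a.e. `t`. -/
structure MemVp (p : ℝ) (Ω : Set (Vec n)) (T : ℝ) (E : Set (Vec n × ℝ))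
    (us : Vec n → Vec N) (Dus : Vec n → Mat N n)
    (v : Vec n × ℝ → Vec N) (Dv : Vec n × ℝ → Mat N n) : Prop where
  memLp : MemLp v (ENNReal.ofReal p) (volume.restrict (cyl Ω T))
  grad_memLp : MemLp Dv (ENNReal.ofReal p) (volume.restrict (cyl Ω T))
  slice_mem : ∀ᵐ t ∂(volume.restrict (Ico 0 T)),
    MemVt p Ω (slice E t) us Dus (fun x => v (x, t)) (fun x => Dv (x, t))

/-- `v ∈ V^p_q(E) = V^p(E) ∩ L^{q+1}(Ω_T, ℝᴺ)`. -/
structure MemVpq (p q : ℝ) (Ω : Set (Vec n)) (T : ℝ) (E : Set (Vec n × ℝ))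
    (us : Vec n → Vec N) (Dus : Vec n → Mat N n)
    (v : Vec n × ℝ → Vec N) (Dv : Vec n × ℝ → Mat N n) : Prop where
  memVp : MemVp p Ω T E us Dus v Dv
  memLq : MemLp v (ENNReal.ofReal (q + 1)) (volume.restrict (cyl Ω T))

/-- `w` is the weak time derivative of `v` in `Ω × (0,T)`. -/
def HasWeakTimeDeriv (Ω : Set (Vec n)) (T : ℝ) (v w : Vec n × ℝ → Vec N) : Prop :=
  ∀ η : Vec n × ℝ → ℝ, IsTestFun (Ω ×ˢ Ioo 0 T) η →
    ∫ z in cyl Ω T, timeDeriv η z • v z = - ∫ z in cyl Ω T, η z • w z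

/-! ### The integrand -/

/-- Integrability in `x`, convexity and coercivity of `f : Ω × ℝᴺ × ℝ^{Nn} → [0,∞)`. -/
structure IsIntegrand (p ν : ℝ) (Ω : Set (Vec n)) (f : Vec n → Vec N → Mat N n → ℝ) :
    Prop where
  nonneg : ∀ x ∈ Ω, ∀ (u : Vec N) (ξ : Mat N n), 0 ≤ f x u ξ
  integrable : ∀ (u : Vec N) (ξ : Mat N n), IntegrableOn (fun x => f x u ξ) Ω
  convex : ∀ᵐ x ∂(volume.restrict Ω),
    ConvexOn ℝ univ (fun y : Vec N × Mat N n => f x y.1 y.2)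
  coercive : ∀ᵐ x ∂(volume.restrict Ω), ∀ (u : Vec N) (ξ : Mat N n), ν * ‖ξ‖ ^ p ≤ f x u ξ

/-- The growth condition `f(x,u,ξ) ≤ L (|ξ|^p + |u|^p + G(x))`. -/
def HasPGrowth (p L : ℝ) (G : Vec n → ℝ) (Ω : Set (Vec n))
    (f : Vec n → Vec N → Mat N n → ℝ) : Prop :=
  ∀ᵐ x ∂(volume.restrict Ω), ∀ (u : Vec N) (ξ : Mat N n),
    f x u ξ ≤ L * (‖ξ‖ ^ p + ‖u‖ ^ p + G x)

/-- `∬_S f(x,v,Dv) dx dt ∈ [0,∞]`. -/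
def energy (f : Vec n → Vec N → Mat N n → ℝ) (S : Set (Vec n × ℝ))
    (v : Vec n × ℝ → Vec N) (Dv : Vec n × ℝ → Mat N n) : ℝ≥0∞ :=
  ∫⁻ z in S, ENNReal.ofReal (f z.1 (v z) (Dv z))

/-! ### Variational solutions and parabolic minimizers -/

/-- The signed power `|u|^{q-1} u` (which is `0` for `u = 0`). -/
def spow (q : ℝ) (u : Vec N) : Vec N := ‖u‖ ^ (q - 1) • u

/-- The boundary term `𝔟[u,v] = |v|^{q+1}/(q+1) - |u|^{q+1}/(q+1) - |u|^{q-1}u · (v-u)`. -/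
def bterm (q : ℝ) (u v : Vec N) : ℝ :=
  1 / (q + 1) * ‖v‖ ^ (q + 1) - 1 / (q + 1) * ‖u‖ ^ (q + 1) - inner ℝ (spow q u) (v - u)

/-- `v ∈ V^p_q(E)` is a comparison map, with weak spatial gradient `Dv` and weak time
derivative `dv ∈ L^{q+1}(Ω_T, ℝᴺ)`. Such a map has a representative that is continuous in time
with values in `L^{q+1}(Ω, ℝᴺ)`; `v` denotes such a representative, so that the values
`v(τ)` and `v(0)` are meaningful. -/
structure IsComparisonMap (p q : ℝ) (Ω : Set (Vec n)) (T : ℝ) (E : Set (Vec n × ℝ))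
    (us : Vec n → Vec N) (Dus : Vec n → Mat N n)
    (v : Vec n × ℝ → Vec N) (Dv : Vec n × ℝ → Mat N n) (dv : Vec n × ℝ → Vec N) : Prop where
  memVpq : MemVpq p q Ω T E us Dus v Dv
  timeDeriv_memLq : MemLp dv (ENNReal.ofReal (q + 1)) (volume.restrict (cyl Ω T))
  weakTimeDeriv : HasWeakTimeDeriv Ω T v dv
  slice_memLq : ∀ t ∈ Ico 0 T,
    MemLp (fun x => v (x, t)) (ENNReal.ofReal (q + 1)) (volume.restrict Ω)
  continuous_time : ∀ t₀ ∈ Ico 0 T,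
    Tendsto (fun t => eLpNorm (fun x => v (x, t) - v (x, t₀)) (ENNReal.ofReal (q + 1))
      (volume.restrict Ω)) (𝓝[Ico 0 T] t₀) (𝓝 0)

/-- `u`, with weak spatial gradient `Du`, is a variational solution with initial datum `uo` and
lateral boundary values `us = u_*`. The variational inequality is read in `(-∞,∞]`, since the
integral of `f(x,v,Dv)` may be infinite. -/
structure IsVariationalSolution (p q : ℝ) (Ω : Set (Vec n)) (T : ℝ) (E : Set (Vec n × ℝ))
    (f : Vec n → Vec N → Mat N n → ℝ) (uo us : Vec n → Vec N) (Dus : Vec n → Mat N n)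
    (u : Vec n × ℝ → Vec N) (Du : Vec n × ℝ → Mat N n) : Prop where
  memVpq : MemVpq p q Ω T E us Dus u Du
  /- `u ∈ L^∞(0,T; L^{q+1}(Ω, ℝᴺ))` -/
  memLinfty : ∃ C : ℝ≥0, ∀ᵐ t ∂(volume.restrict (Ico 0 T)),
    eLpNorm (fun x => u (x, t)) (ENNReal.ofReal (q + 1)) (volume.restrict Ω) ≤ C
  variational : ∀ (v : Vec n × ℝ → Vec N) (Dv : Vec n × ℝ → Mat N n) (dv : Vec n × ℝ → Vec N),
    IsComparisonMap p q Ω T E us Dus v Dv dv →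
    ∀ᵐ τ ∂(volume.restrict (Ioo 0 T)),
      (energy f (E ∩ cyl Ω τ) u Du : EReal) ≤
        (energy f (E ∩ cyl Ω τ) v Dv : EReal) +
        (((∫ z in E ∩ cyl Ω τ, inner ℝ (dv z) (spow q (v z) - spow q (u z)))
          - (∫ x in slice E τ, bterm q (u (x, τ)) (v (x, τ)))
          + (∫ x in slice E 0, bterm q (uo x) (v (x, 0))) : ℝ) : EReal)

/-- `u ∈ V^p(E)`, with weak spatial gradient `Du` and `|u|^{q-1}u ∈ L¹(E, ℝᴺ)`, is a parabolic
minimizer. The integrals of `f` are read in `[0,∞]`. -/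
structure IsParabolicMinimizer (p q : ℝ) (Ω : Set (Vec n)) (T : ℝ) (E : Set (Vec n × ℝ))
    (f : Vec n → Vec N → Mat N n → ℝ) (us : Vec n → Vec N) (Dus : Vec n → Mat N n)
    (u : Vec n × ℝ → Vec N) (Du : Vec n × ℝ → Mat N n) : Prop where
  memVp : MemVp p Ω T E us Dus u Du
  spow_integrable : IntegrableOn (fun z => spow q (u z)) E
  minimality : ∀ φ : Vec n × ℝ → Vec N, IsTestFun E φ →
    ((∫ z in E, inner ℝ (spow q (u z)) (timeDeriv φ z) : ℝ) : EReal) + (energy f E u Du : EReal)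
      ≤ (energy f E (fun z => u z + φ z) (fun z => Du z + spaceGrad φ z) : EReal)

end DoublyNonlinear

end

open DoublyNonlinear

/-!
The comparison map in the variational inequality would be `u + φ`, but `u` has no time derivative.
It is replaced by the exponential time mean `[u - u_*]_h(t) = ∫₀^∞ e^{-r} (u - u_*)(t - hr) dr`,
where `u - u_*` is extended by zero to negative times; the map
`v = a + φ` with `a = u_* + [u - u_*]_h + e^{-t/h} χ` is used, where `χ` is a test function on the
initial slice `E⁰` (`mollified`, `isComparisonMap_mollified`). It is admissible for three reasons:
the mean only looks into the past, where the slices of `E` are smaller, so `a = u_*` off `E`; means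
of curves in the closed subspace `W₀^{1,p}` stay in this subspace (`exists_toLp_integral_mem`); and
`a` is a primitive in time of `∂ₜa = (u - a)/h ∈ L^{q+1}`.

For the term with the time derivative, write
`∂ₜv·(v^q - u^q) = [∂ₜa·(v^q - a^q) + ∂ₜφ·v^q] + ∂ₜa·(a^q - u^q) - ∂ₜφ·u^q`.
The bracket is the time derivative of `(|v|^{q+1} - |a|^{q+1})/(q+1)`, and `v = a` at both ends of
the time interval, so it integrates to zero on every line in the time direction
(`integral_inner_spow_add_eq_zero`; only the absolute continuity of `a` on lines is needed). The
second term is nonpositive, since `∂ₜa` is a positive multiple of `u - a` and signed powers are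
monotone (`inner_spow_sub_nonneg`). This leaves `-∬ u^q·∂ₜφ`
(`setIntegral_inner_mollifiedDeriv_le`). The boundary term at the final time has the right sign.
The one at time zero is `∫ 𝔟[u_o, u_* + χ]`, which is arbitrarily small for a suitable `χ`, because
`u_o - u_*` is a limit of test functions on `E⁰` in `L^{q+1}`
(`exists_isTestFun_integral_bterm_le`); the factor `e^{-t/h}` makes the contribution of `χ`
disappear as `h → 0`.

Finally `h → 0`. Then `(v, Dv) → (u + φ, Du + Dφ)` in `L^p` (`tendsto_lintegral_mollified_sub`),
and the convexity and the growth of `f` give that the energy is upper semicontinuous along this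
convergence (`exists_forall_energy_le`).
-/

noncomputable section

namespace DoublyNonlinear

/-! ### Chain rule along indefinite integrals -/

theorem intervalIntegrable_of_mem_Icc {G : Type*} [NormedAddCommGroup G] {g : ℝ → G} {a b s t : ℝ}
    (hg : IntervalIntegrable g volume a b) (hs : s ∈ Icc a b) (ht : t ∈ Icc a b) :
    IntervalIntegrable g volume s t :=
  hg.mono_set (by rw [uIcc_of_le (hs.1.trans hs.2)]; exact uIcc_subset_Icc hs ht)

/-- A function whose increments are dominated by those of the indefinite integral of an
integrable function is absolutely continuous. -/
theorem absolutelyContinuousOnInterval_of_dist_le {X : Type*} [PseudoMetricSpace X] {f : ℝ → X}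
    {m : ℝ → ℝ} {τ : ℝ} (hτ : 0 ≤ τ) (hm : IntervalIntegrable m volume 0 τ)
    (hf : ∀ s t, 0 ≤ s → s ≤ t → t ≤ τ → dist (f s) (f t) ≤ ∫ r in s..t, m r) :
    AbsolutelyContinuousOnInterval f 0 τ := by
  have hM := hm.absolutelyContinuousOnInterval_intervalIntegral (c := 0) (by simp)
  rw [absolutelyContinuousOnInterval_iff] at hM ⊢
  intro ε hε
  obtain ⟨δ, hδ, h⟩ := hM ε hε
  refine ⟨δ, hδ, fun A hA hAδ => lt_of_le_of_lt (Finset.sum_le_sum fun i hi => ?_) (h A hA hAδ)⟩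
  have hsub : ∀ s ∈ Icc 0 τ, IntervalIntegrable m volume 0 s := fun s hs =>
    intervalIntegrable_of_mem_Icc hm ⟨le_rfl, hτ⟩ hs
  obtain ⟨h1, h2⟩ := hA.1 i hi
  rw [uIcc_of_le hτ] at h1 h2
  have key : ∀ s t, s ∈ Icc 0 τ → t ∈ Icc 0 τ → s ≤ t →
      dist (f s) (f t) ≤ dist (∫ r in (0 : ℝ)..s, m r) (∫ r in (0 : ℝ)..t, m r) := by
    intro s t hs ht hst
    refine (hf s t hs.1 hst ht.2).trans ?_
    rw [dist_comm, Real.dist_eq,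
      intervalIntegral.integral_interval_sub_left (hsub t ht) (hsub s hs)]
    exact le_abs_self _
  rcases le_total (A.2 i).1 (A.2 i).2 with h12 | h12
  · exact key _ _ h1 h2 h12
  · rw [dist_comm, dist_comm (∫ r in (0 : ℝ)..(A.2 i).1, m r)]
    exact key _ _ h2 h1 h12

theorem continuousOn_of_eq_add_integral {F : Type*} [NormedAddCommGroup F] [NormedSpace ℝ F]
    {a α : ℝ → F} {τ : ℝ} (hτ : 0 ≤ τ)
    (hα : IntervalIntegrable α volume 0 τ)
    (ha : ∀ t ∈ Icc 0 τ, a t = a 0 + ∫ s in (0 : ℝ)..t, α s) : ContinuousOn a (Icc 0 τ) := by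
  have h := intervalIntegral.continuousOn_primitive_interval'
    (μ := volume) (f := α) (b₁ := 0) (b₂ := τ) hα (a := 0) (by simp)
  rw [uIcc_of_le hτ] at h
  exact (continuousOn_const.add h).congr ha

/-- The integrand is the time derivative of `Ψ(s, a(s))`. -/
theorem intervalIntegrable_fderiv_comp {F F' : Type*} [NormedAddCommGroup F] [NormedSpace ℝ F]
    [NormedAddCommGroup F'] [NormedSpace ℝ F']
    {a α : ℝ → F} {τ : ℝ} (hτ : 0 ≤ τ)
    (hα : IntervalIntegrable α volume 0 τ) (hac : ContinuousOn a (Icc 0 τ))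
    {Ψ : ℝ × F → F'} (hΨ : ContDiff ℝ 1 Ψ) :
    IntervalIntegrable (fun s => fderiv ℝ Ψ (s, a s) (1, α s)) volume 0 τ := by
  have hD : ContinuousOn (fun s => fderiv ℝ Ψ (s, a s)) (Icc 0 τ) :=
    (hΨ.continuous_fderiv one_ne_zero).comp_continuousOn (continuousOn_id.prodMk hac)
  have h1 : IntervalIntegrable (fun s => fderiv ℝ Ψ (s, a s) (1, 0)) volume 0 τ := by
    apply ContinuousOn.intervalIntegrable
    rw [uIcc_of_le hτ]
    exact hD.clm_apply continuousOn_const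
  have h2 : IntervalIntegrable (fun s => fderiv ℝ Ψ (s, a s) (0, α s)) volume 0 τ := by
    rw [intervalIntegrable_iff_integrableOn_Ioc_of_le hτ] at hα ⊢
    obtain ⟨C, hC⟩ := isCompact_Icc.exists_bound_of_continuousOn hD
    refine Integrable.mono' (hα.norm.const_mul C) ?_ ?_
    · have hDm : AEStronglyMeasurable (fun s => fderiv ℝ Ψ (s, a s))
          (volume.restrict (Ioc 0 τ)) :=
        (hD.mono Ioc_subset_Icc_self).aestronglyMeasurable measurableSet_Ioc
      have hpair : AEStronglyMeasurable (fun s => ((0 : ℝ), α s)) (volume.restrict (Ioc 0 τ)) :=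
        aestronglyMeasurable_const.prodMk hα.aestronglyMeasurable
      exact isBoundedBilinearMap_apply.continuous.comp_aestronglyMeasurable (hDm.prodMk hpair)
    · filter_upwards [ae_restrict_mem measurableSet_Ioc] with s hs
      refine ((fderiv ℝ Ψ (s, a s)).le_opNorm _).trans ?_
      have : ‖((0 : ℝ), α s)‖ = ‖α s‖ := by simp [Prod.norm_def]
      rw [this]
      exact mul_le_mul_of_nonneg_right (hC s (Ioc_subset_Icc_self hs)) (norm_nonneg _)
  refine (h1.add h2).congr fun s _ => ?_
  simp [← map_add]

/-- Chain rule for a `C¹` function of time and of an indefinite integral `a = a(0) + ∫ α`, in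
integrated form. -/
theorem integral_fderiv_comp_eq_sub {F F' : Type*} [NormedAddCommGroup F] [NormedSpace ℝ F]
    [FiniteDimensional ℝ F] [NormedAddCommGroup F'] [NormedSpace ℝ F'] [CompleteSpace F']
    {a α : ℝ → F} {τ : ℝ} (hτ : 0 ≤ τ)
    (hα : IntervalIntegrable α volume 0 τ)
    (ha : ∀ t ∈ Icc 0 τ, a t = a 0 + ∫ s in (0 : ℝ)..t, α s)
    {Ψ : ℝ × F → F'} (hΨ : ContDiff ℝ 1 Ψ) :
    ∫ s in (0 : ℝ)..τ, fderiv ℝ Ψ (s, a s) (1, α s) = Ψ (τ, a τ) - Ψ (0, a 0) := by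
  have hac := continuousOn_of_eq_add_integral hτ hα ha
  have hβ := intervalIntegrable_fderiv_comp hτ hα hac hΨ
  set β : ℝ → F' := fun s => fderiv ℝ Ψ (s, a s) (1, α s) with hβdef
  obtain ⟨R, hR⟩ := isCompact_Icc.exists_bound_of_continuousOn hac
  obtain ⟨K, hK⟩ : ∃ K, LipschitzOnWith K Ψ (Icc 0 τ ×ˢ Metric.closedBall (0 : F) R) :=
    hΨ.contDiffOn.exists_lipschitzOnWith one_ne_zero
      ((convex_Icc _ _).prod (convex_closedBall _ _))
      (isCompact_Icc.prod (isCompact_closedBall _ _))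
  have hmem : ∀ s ∈ Icc 0 τ, (s, a s) ∈ Icc 0 τ ×ˢ Metric.closedBall (0 : F) R := fun s hs =>
    ⟨hs, by simpa using hR s hs⟩
  have h0 : (0 : ℝ) ∈ Icc 0 τ := ⟨le_rfl, hτ⟩
  -- the difference of the two sides is absolutely continuous with vanishing derivative
  let H : ℝ → F' := fun t => Ψ (t, a t) - ∫ s in (0 : ℝ)..t, β s
  have hm : IntervalIntegrable (fun s => K * (1 + ‖α s‖) + ‖β s‖) volume 0 τ :=
    (((intervalIntegrable_const (c := (1 : ℝ))).add hα.norm).const_mul (K : ℝ)).add hβ.norm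
  have hAC : AbsolutelyContinuousOnInterval H 0 τ := by
    refine absolutelyContinuousOnInterval_of_dist_le hτ hm fun s t hs hst ht => ?_
    have hs' : s ∈ Icc 0 τ := ⟨hs, hst.trans ht⟩
    have ht' : t ∈ Icc 0 τ := ⟨hs.trans hst, ht⟩
    have hαst := intervalIntegrable_of_mem_Icc hα hs' ht'
    have hβst := intervalIntegrable_of_mem_Icc hβ hs' ht'
    have e1 : dist (Ψ (s, a s)) (Ψ (t, a t)) ≤ K * ∫ r in s..t, (1 + ‖α r‖) := by
      refine (hK.dist_le_mul _ (hmem s hs') _ (hmem t ht')).trans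
        (mul_le_mul_of_nonneg_left ?_ K.2)
      rw [intervalIntegral.integral_add (intervalIntegrable_const) hαst.norm]
      have hd : dist (a s) (a t) ≤ ∫ r in s..t, ‖α r‖ := by
        rw [dist_comm, dist_eq_norm, ha t ht', ha s hs', add_sub_add_left_eq_sub,
          intervalIntegral.integral_interval_sub_left (intervalIntegrable_of_mem_Icc hα h0 ht')
            (intervalIntegrable_of_mem_Icc hα h0 hs')]
        exact intervalIntegral.norm_integral_le_integral_norm hst
      have hd' : dist s t = ∫ r in s..t, (1 : ℝ) := by
        rw [dist_comm, Real.dist_eq, intervalIntegral.integral_const, abs_of_nonneg (by linarith)]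
        simp
      rw [Prod.dist_eq, max_le_iff]
      simp only
      rw [← hd']
      constructor <;> linarith [dist_nonneg (x := s) (y := t), dist_nonneg (x := a s) (y := a t)]
    have e2 : dist (∫ r in (0 : ℝ)..s, β r) (∫ r in (0 : ℝ)..t, β r) ≤ ∫ r in s..t, ‖β r‖ := by
      rw [dist_comm, dist_eq_norm,
        intervalIntegral.integral_interval_sub_left (intervalIntegrable_of_mem_Icc hβ h0 ht')
          (intervalIntegrable_of_mem_Icc hβ h0 hs')]
      exact intervalIntegral.norm_integral_le_integral_norm hst
    have e3 : ∫ r in s..t, (K * (1 + ‖α r‖) + ‖β r‖)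
        = K * (∫ r in s..t, (1 + ‖α r‖)) + ∫ r in s..t, ‖β r‖ := by
      rw [intervalIntegral.integral_add
        (((intervalIntegrable_const (c := (1 : ℝ))).add hαst.norm).const_mul (K : ℝ)) hβst.norm,
        intervalIntegral.integral_const_mul]
    rw [e3]
    exact (dist_sub_sub_le _ _ _ _).trans (add_le_add e1 e2)
  have hderiv : ∀ᵐ t, t ∈ uIcc 0 τ → HasDerivAt H 0 t := by
    have n0 : ∀ᵐ t : ℝ, t ≠ 0 := by simp [ae_iff]
    have nτ : ∀ᵐ t : ℝ, t ≠ τ := by simp [ae_iff]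
    filter_upwards [hα.ae_hasDerivAt_integral, hβ.ae_hasDerivAt_integral, n0, nτ]
      with t h1 h2 ht0 htτ ht
    have h1 := h1 ht 0 (by simp)
    have h2 := h2 ht 0 (by simp)
    rw [uIcc_of_le hτ] at ht
    have hnhds : Icc 0 τ ∈ 𝓝 t :=
      Icc_mem_nhds (lt_of_le_of_ne ht.1 (Ne.symm ht0)) (lt_of_le_of_ne ht.2 htτ)
    have hat : HasDerivAt a (α t) t := by
      refine (h1.const_add (a 0)).congr_of_eventuallyEq ?_
      filter_upwards [hnhds] with s hs using ha s hs
    have hΨt := ((hΨ.differentiable one_ne_zero) (t, a t)).hasFDerivAt.comp_hasDerivAt t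
      ((hasDerivAt_id t).prodMk hat)
    have hH := hΨt.sub h2
    have e : fderiv ℝ Ψ (t, a t) (1, α t) - β t = 0 := sub_self _
    simp only [id_eq] at hH
    rw [e] at hH
    exact hH
  obtain ⟨C, hC⟩ := hAC.const_of_ae_hasDerivAt_zero hderiv
  have hC0 := hC 0 (by simp)
  have hCτ := hC τ (by simp)
  simp only [H, intervalIntegral.integral_same, sub_zero] at hC0 hCτ
  rw [hC0, ← hCτ]
  abel

/-! ### `L^p` norms with real exponents -/

theorem eLpNorm_ofReal_eq {X F : Type*} [MeasurableSpace X] [NormedAddCommGroup F] {μ : Measure X}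
    {p : ℝ} (hp : 0 < p) (f : X → F) :
    eLpNorm f (ENNReal.ofReal p) μ = (∫⁻ x, ‖f x‖ₑ ^ p ∂μ) ^ (1 / p) := by
  rw [eLpNorm_eq_lintegral_rpow_enorm_toReal (by simpa using hp) ENNReal.ofReal_ne_top,
    ENNReal.toReal_ofReal hp.le]

theorem eLpNorm_ofReal_rpow {X F : Type*} [MeasurableSpace X] [NormedAddCommGroup F]
    {μ : Measure X} {p : ℝ} (hp : 0 < p) (f : X → F) :
    eLpNorm f (ENNReal.ofReal p) μ ^ p = ∫⁻ x, ‖f x‖ₑ ^ p ∂μ := by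
  rw [eLpNorm_ofReal_eq hp, ← ENNReal.rpow_mul, one_div_mul_cancel hp.ne', ENNReal.rpow_one]

theorem memLp_ofReal_iff {X F : Type*} [MeasurableSpace X] [NormedAddCommGroup F] {μ : Measure X}
    {p : ℝ} (hp : 0 < p) {f : X → F} (hf : AEStronglyMeasurable f μ) :
    MemLp f (ENNReal.ofReal p) μ ↔ ∫⁻ x, ‖f x‖ₑ ^ p ∂μ < ⊤ := by
  rw [MemLp, and_iff_right hf, eLpNorm_ofReal_eq hp, ENNReal.rpow_lt_top_iff_of_pos (by positivity)]

/-- Jensen's inequality for powers of the norm of a mean value. -/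
theorem enorm_integral_rpow_le {X F : Type*} [MeasurableSpace X] [NormedAddCommGroup F]
    [NormedSpace ℝ F] {ρ : Measure X} [IsProbabilityMeasure ρ] {p : ℝ} (hp : 1 ≤ p) {f : X → F}
    (hf : AEStronglyMeasurable f ρ) : ‖∫ x, f x ∂ρ‖ₑ ^ p ≤ ∫⁻ x, ‖f x‖ₑ ^ p ∂ρ := by
  have hp0 : 0 < p := by linarith
  rw [← eLpNorm_ofReal_rpow hp0]
  refine ENNReal.rpow_le_rpow ?_ hp0.le
  refine (enorm_integral_le_lintegral_enorm _).trans ?_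
  rw [← eLpNorm_one_eq_lintegral_enorm]
  exact eLpNorm_le_eLpNorm_of_exponent_le (by simpa using hp) hf

/-! ### Exponential averages in time -/

/-- The exponential distribution `e^{-r} dr` on `(0,∞)`. -/
def expWeight : Measure ℝ :=
  (volume.restrict (Ioi 0)).withDensity fun r => ENNReal.ofReal (Real.exp (-r))

instance : IsProbabilityMeasure expWeight where
  measure_univ := by
    rw [expWeight, withDensity_apply _ MeasurableSet.univ, Measure.restrict_univ,
      ← ofReal_integral_eq_lintegral_ofReal (integrableOn_exp_neg_Ioi 0)
        (ae_of_all _ fun r => (Real.exp_pos _).le), integral_exp_neg_Ioi_zero, ENNReal.ofReal_one]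

theorem expWeight_absolutelyContinuous : expWeight ≪ volume.restrict (Ioi 0) :=
  withDensity_absolutelyContinuous _ _

theorem ae_expWeight_pos : ∀ᵐ r ∂expWeight, 0 < r :=
  expWeight_absolutelyContinuous.ae_le (ae_restrict_mem measurableSet_Ioi)

/-- The average `∫₀^∞ e^{-r} g(t - hr) dr` of the past values of `g`. It solves the differential
equation `h y' = g - y`. -/
def expMean {F : Type*} [NormedAddCommGroup F] [NormedSpace ℝ F] (h : ℝ) (g : ℝ → F) (t : ℝ) : F :=
  ∫ r, g (t - h * r) ∂expWeight

section

variable {F : Type*} [NormedAddCommGroup F] [NormedSpace ℝ F] {h : ℝ} {g : ℝ → F}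

theorem expMean_eq_setIntegral (h : ℝ) (g : ℝ → F) (t : ℝ) :
    expMean h g t = ∫ r in Ioi 0, Real.exp (-r) • g (t - h * r) := by
  rw [expMean, expWeight, integral_withDensity_eq_integral_toReal_smul (by fun_prop)
    (ae_of_all _ fun _ => ENNReal.ofReal_lt_top)]
  simp only [ENNReal.toReal_ofReal (Real.exp_pos _).le]

/-- The variation of constants formula for `h y' = g - y`, `y(0) = 0`. -/
theorem expMean_eq_intervalIntegral (hh : 0 < h) (hg : ∀ s < 0, g s = 0) {t : ℝ} (ht : 0 ≤ t) :
    expMean h g t = Real.exp (-t / h) • ∫ s in (0 : ℝ)..t, (Real.exp (s / h) / h) • g s := by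
  let k : ℝ → F := (Iio t).indicator fun s => Real.exp ((s - t) / h) • g s
  have e1 : expMean h g t = ∫ r, k (t - h * r) := by
    rw [expMean_eq_setIntegral, ← integral_indicator measurableSet_Ioi]
    congr 1
    ext r
    by_cases hr : 0 < r
    · have : t - h * r < t := by nlinarith
      simp only [indicator, mem_Ioi, hr, if_true, k, mem_Iio, this]
      congr 2
      field_simp
      ring
    · have : ¬ t - h * r < t := by nlinarith
      simp [indicator, hr, k, this]
  have e2 : ∫ r, k (t - h * r) = h⁻¹ • ∫ s, k s := by
    rw [Measure.integral_comp_mul_left (fun y => k (t - y)) h,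
      integral_sub_left_eq_self k volume t, abs_of_pos (inv_pos.2 hh)]
  have e3 : ∫ s, k s = ∫ s in (0 : ℝ)..t, Real.exp ((s - t) / h) • g s := by
    rw [integral_indicator measurableSet_Iio, intervalIntegral.integral_of_le ht,
      integral_Ioc_eq_integral_Ioo, ← integral_Ico_eq_integral_Ioo]
    refine setIntegral_eq_of_subset_of_forall_sdiff_eq_zero measurableSet_Iio Ico_subset_Iio_self ?_
    intro s hs
    have hs0 : s < 0 := by
      by_contra h0
      exact hs.2 ⟨not_lt.1 h0, hs.1⟩
    rw [hg s hs0, smul_zero]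
  rw [e1, e2, e3, ← intervalIntegral.integral_smul, ← intervalIntegral.integral_smul]
  congr 1
  ext s
  rw [smul_smul, smul_smul]
  congr 1
  rw [show (s - t) / h = -t / h + s / h by ring, Real.exp_add]
  field_simp

theorem expMean_eq_zero_of_forall_lt {t : ℝ} (hh : 0 < h) (hg : ∀ s < t, g s = 0) :
    expMean h g t = 0 := by
  refine integral_eq_zero_of_ae ?_
  filter_upwards [ae_expWeight_pos] with r hr
  exact hg _ (by nlinarith)

theorem intervalIntegrable_exp_smul (h : ℝ) {τ : ℝ} (hgi : IntervalIntegrable g volume 0 τ) :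
    IntervalIntegrable (fun s => (Real.exp (s / h) / h) • g s) volume 0 τ :=
  hgi.continuousOn_smul (by fun_prop)

theorem continuousOn_expMean (hh : 0 < h) (hg : ∀ s < 0, g s = 0) {τ : ℝ} (hτ : 0 ≤ τ)
    (hgi : IntervalIntegrable g volume 0 τ) : ContinuousOn (expMean h g) (Icc 0 τ) := by
  have h1 := intervalIntegral.continuousOn_primitive_interval' (μ := volume)
    (intervalIntegrable_exp_smul h hgi) (a := 0) (by simp)
  rw [uIcc_of_le hτ] at h1
  have h2 : ContinuousOn (fun t : ℝ => Real.exp (-t / h)) (Icc 0 τ) := by fun_prop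
  exact (h2.smul h1).congr fun t ht => expMean_eq_intervalIntegral hh hg ht.1

/-- The exponential average solves `h y' = g - y`, `y(0) = 0`, in integrated form. -/
theorem expMean_eq_integral [FiniteDimensional ℝ F] (hh : 0 < h) (hg : ∀ s < 0, g s = 0) {t : ℝ}
    (ht : 0 ≤ t) (hgi : IntervalIntegrable g volume 0 t) :
    expMean h g t = ∫ s in (0 : ℝ)..t, h⁻¹ • (g s - expMean h g s) := by
  have : CompleteSpace F := FiniteDimensional.complete ℝ F
  let α : ℝ → F := fun s => (Real.exp (s / h) / h) • g s
  let Ψ : ℝ × F → F := fun z => Real.exp (-z.1 / h) • z.2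
  have hΨ : ContDiff ℝ 1 Ψ := by fun_prop
  have hα : IntervalIntegrable α volume 0 t := intervalIntegrable_exp_smul h hgi
  have key := integral_fderiv_comp_eq_sub (a := fun t => ∫ s in (0 : ℝ)..t, α s) (α := α) ht hα
    (by simp) hΨ
  have hfd : ∀ (s : ℝ) (b β : F), fderiv ℝ Ψ (s, b) (1, β)
      = Real.exp (-s / h) • β - (h⁻¹ * Real.exp (-s / h)) • b := by
    intro s b β
    have h1 : HasFDerivAt (fun z : ℝ × F => Real.exp (-z.1 / h))
        (Real.exp (-s / h) • (-(h⁻¹) • ContinuousLinearMap.fst ℝ ℝ F)) (s, b) := by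
      have h0 : HasFDerivAt (fun z : ℝ × F => -z.1 / h)
          (-(h⁻¹) • ContinuousLinearMap.fst ℝ ℝ F) (s, b) := by
        have := (hasFDerivAt_fst (𝕜 := ℝ) (p := (s, b))).const_mul (-(h⁻¹))
        refine this.congr_of_eventuallyEq (Eventually.of_forall fun z => ?_)
        simp only
        ring
      exact h0.exp
    have h2 := h1.smul (hasFDerivAt_snd (𝕜 := ℝ) (p := (s, b)))
    have h3 : fderiv ℝ Ψ (s, b) = _ := h2.fderiv
    rw [h3]
    simp
    module
  simp only [hfd] at key
  rw [expMean_eq_intervalIntegral hh hg ht]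
  have : Ψ (t, ∫ s in (0 : ℝ)..t, α s) - Ψ (0, ∫ s in (0 : ℝ)..0, α s)
      = Real.exp (-t / h) • ∫ s in (0 : ℝ)..t, α s := by simp [Ψ]
  rw [this] at key
  rw [← key]
  refine intervalIntegral.integral_congr fun s hs => ?_
  rw [uIcc_of_le ht] at hs
  simp only [expMean_eq_intervalIntegral hh hg hs.1, α]
  rw [smul_smul, smul_sub, smul_smul]
  congr 2
  rw [show -s / h = -(s / h) by ring, Real.exp_neg]
  field_simp

end

instance {n : ℕ} : (volume : Measure (Vec n × ℝ)).IsAddRightInvariant := by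
  rw [Measure.volume_eq_prod]; infer_instance

instance {n : ℕ} : (volume : Measure (Vec n × ℝ)).InnerRegularCompactLTTop := by
  infer_instance

/-- The exponential average in time of a map on space-time. -/
def timeMean {n : ℕ} {F : Type*} [NormedAddCommGroup F] [NormedSpace ℝ F] (h : ℝ)
    (G : Vec n × ℝ → F) (z : Vec n × ℝ) : F :=
  expMean h (fun t => G (z.1, t)) z.2

section

variable {n : ℕ} {F : Type*} [NormedAddCommGroup F] {G : Vec n × ℝ → F}

theorem StronglyMeasurable.comp_translate (h : ℝ) (hG : StronglyMeasurable G) :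
    StronglyMeasurable fun w : (Vec n × ℝ) × ℝ => G (w.1 - (0, h * w.2)) :=
  hG.comp_measurable (by fun_prop)

theorem lintegral_lintegral_translate_eq (h : ℝ) {p : ℝ} (hG : StronglyMeasurable G) :
    ∫⁻ z, (∫⁻ r, ‖G (z - (0, h * r))‖ₑ ^ p ∂expWeight) = ∫⁻ z, ‖G z‖ₑ ^ p := by
  rw [lintegral_lintegral_swap]
  · have : ∀ r : ℝ, ∫⁻ z, ‖G (z - (0, h * r))‖ₑ ^ p = ∫⁻ z, ‖G z‖ₑ ^ p := fun r =>
      lintegral_sub_right_eq_self (fun z => ‖G z‖ₑ ^ p) (0, h * r)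
    simp only [this, lintegral_const, measure_univ, mul_one]
  · exact ((StronglyMeasurable.comp_translate h hG).enorm.pow_const p).aemeasurable

/-- Translations in time are continuous in `L^p`. -/
theorem tendsto_lintegral_translate_sub {p : ℝ} (hp : 1 ≤ p)
    (hGp : MemLp G (ENNReal.ofReal p) volume) :
    Tendsto (fun c : ℝ => ∫⁻ z, ‖G (z - (0, c)) - G z‖ₑ ^ p) (𝓝 0) (𝓝 0) := by
  have hp0 : 0 < p := by linarith
  have : Fact (1 ≤ ENNReal.ofReal p) := ⟨by simpa using hp⟩
  let g : ℝ → C(Vec n × ℝ, Vec n × ℝ) := fun c => ⟨fun z => z - (0, c), by fun_prop⟩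
  have hgc : Continuous g :=
    ContinuousMap.continuous_of_continuous_uncurry _
      (by simp only [Function.uncurry_def, g, ContinuousMap.coe_mk]; fun_prop)
  have hmp : ∀ c, MeasurePreserving (g c) (volume : Measure (Vec n × ℝ)) volume := fun c =>
    measurePreserving_sub_right volume ((0 : Vec n), c)
  have key := Filter.Tendsto.compMeasurePreservingLp (tendsto_const_nhds (x := hGp.toLp G))
    (hgc.tendsto 0) hmp (hmp 0) ENNReal.ofReal_ne_top
  simp only [Lp.toLp_compMeasurePreserving] at key
  rw [Lp.tendsto_Lp_iff_tendsto_eLpNorm''] at key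
  have h2 := (ENNReal.continuous_rpow_const (y := p)).tendsto 0 |>.comp key
  rw [ENNReal.zero_rpow_of_pos hp0] at h2
  refine h2.congr fun c => ?_
  rw [Function.comp, eLpNorm_ofReal_rpow hp0]
  refine lintegral_congr fun z => ?_
  simp [g, show ((0 : Vec n), (0 : ℝ)) = 0 from rfl]

theorem ae_integrable_translate (h : ℝ) {p : ℝ} (hp : 1 ≤ p) (hG : StronglyMeasurable G)
    (hGp : MemLp G (ENNReal.ofReal p) volume) :
    ∀ᵐ z : Vec n × ℝ, Integrable (fun r => G (z - (0, h * r))) expWeight := by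
  have hp0 : 0 < p := by linarith
  have hfin : ∫⁻ z, (∫⁻ r, ‖G (z - (0, h * r))‖ₑ ^ p ∂expWeight) ≠ ⊤ := by
    rw [lintegral_lintegral_translate_eq h hG]
    exact ((memLp_ofReal_iff hp0 hGp.1).1 hGp).ne
  have hm : Measurable fun z => ∫⁻ r, ‖G (z - (0, h * r))‖ₑ ^ p ∂expWeight :=
    ((StronglyMeasurable.comp_translate h hG).enorm.pow_const p).lintegral_prod_right'
  filter_upwards [ae_lt_top hm hfin] with z hz
  have : MemLp (fun r => G (z - (0, h * r))) (ENNReal.ofReal p) expWeight :=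
    (memLp_ofReal_iff hp0 (hG.comp_measurable (by fun_prop)).aestronglyMeasurable).2 hz
  exact this.integrable (by simpa using hp)

variable [NormedSpace ℝ F]

theorem timeMean_eq_integral_translate (h : ℝ) (G : Vec n × ℝ → F) (z : Vec n × ℝ) :
    timeMean h G z = ∫ r, G (z - (0, h * r)) ∂expWeight := by
  simp only [timeMean, expMean]
  congr 1
  ext r
  congr 1
  ext <;> simp

theorem StronglyMeasurable.timeMean (h : ℝ) (hG : StronglyMeasurable G) :
    StronglyMeasurable (timeMean h G) := by
  have : DoublyNonlinear.timeMean h G = fun z => ∫ r, G (z - (0, h * r)) ∂expWeight :=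
    funext (timeMean_eq_integral_translate h G)
  rw [this]
  exact StronglyMeasurable.integral_prod_right (StronglyMeasurable.comp_translate h hG)

/-- The exponential average is a contraction on `L^p`. -/
theorem lintegral_timeMean_rpow_le (h : ℝ) {p : ℝ} (hp : 1 ≤ p) (hG : StronglyMeasurable G) :
    ∫⁻ z, ‖timeMean h G z‖ₑ ^ p ≤ ∫⁻ z, ‖G z‖ₑ ^ p := by
  rw [← lintegral_lintegral_translate_eq h hG]
  refine lintegral_mono fun z => ?_
  rw [timeMean_eq_integral_translate]
  exact enorm_integral_rpow_le hp (hG.comp_measurable (by fun_prop)).aestronglyMeasurable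

theorem memLp_timeMean (h : ℝ) {p : ℝ} (hp : 1 ≤ p) (hG : StronglyMeasurable G)
    (hGp : MemLp G (ENNReal.ofReal p) volume) :
    MemLp (timeMean h G) (ENNReal.ofReal p) volume := by
  have hp0 : 0 < p := by linarith
  rw [memLp_ofReal_iff hp0 (StronglyMeasurable.timeMean h hG).aestronglyMeasurable]
  exact (lintegral_timeMean_rpow_le h hp hG).trans_lt ((memLp_ofReal_iff hp0 hGp.1).1 hGp)

/-- The exponential averages converge to the map itself in `L^p`. -/
theorem tendsto_lintegral_timeMean_sub [CompleteSpace F] {p : ℝ} (hp : 1 ≤ p)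
    (hG : StronglyMeasurable G) (hGp : MemLp G (ENNReal.ofReal p) volume) :
    Tendsto (fun h : ℝ => ∫⁻ z, ‖timeMean h G z - G z‖ₑ ^ p) (𝓝 0) (𝓝 0) := by
  have hp0 : 0 < p := by linarith
  let osc : ℝ → ℝ≥0∞ := fun c => ∫⁻ z, ‖G (z - (0, c)) - G z‖ₑ ^ p
  have hmeas : Measurable fun w : (Vec n × ℝ) × ℝ => ‖G (w.1 - (0, w.2)) - G w.1‖ₑ ^ p :=
    (((hG.comp_measurable
      (by fun_prop : Measurable fun w : (Vec n × ℝ) × ℝ => w.1 - (0, w.2))).sub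
      (hG.comp_measurable measurable_fst)).enorm.pow_const p)
  have hoscm : Measurable osc := hmeas.lintegral_prod_left'
  have hosc0 : Tendsto osc (𝓝 0) (𝓝 0) := tendsto_lintegral_translate_sub hp hGp
  have hM : ∫⁻ z, ‖G z‖ₑ ^ p ≠ ⊤ := ((memLp_ofReal_iff hp0 hGp.1).1 hGp).ne
  have hoscb : ∀ c, osc c ≤ 2 ^ (p - 1) * (2 * ∫⁻ z, ‖G z‖ₑ ^ p) := by
    intro c
    calc osc c ≤ ∫⁻ z, 2 ^ (p - 1) * (‖G (z - (0, c))‖ₑ ^ p + ‖G z‖ₑ ^ p) := by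
          refine lintegral_mono fun z => ?_
          exact (ENNReal.rpow_le_rpow (enorm_sub_le) hp0.le).trans
            (ENNReal.rpow_add_le_mul_rpow_add_rpow _ _ hp)
      _ = 2 ^ (p - 1) * (2 * ∫⁻ z, ‖G z‖ₑ ^ p) := by
          rw [lintegral_const_mul' _ _ (by simp), lintegral_add_right _ (hG.enorm.pow_const p),
            lintegral_sub_right_eq_self (fun z => ‖G z‖ₑ ^ p) ((0 : Vec n), c), two_mul]
  have hbound : ∀ h : ℝ, ∫⁻ z, ‖timeMean h G z - G z‖ₑ ^ p ≤ ∫⁻ r, osc (h * r) ∂expWeight := by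
    intro h
    have e : ∫⁻ r, osc (h * r) ∂expWeight
        = ∫⁻ z, ∫⁻ r, ‖G (z - (0, h * r)) - G z‖ₑ ^ p ∂expWeight := by
      rw [lintegral_lintegral_swap]
      exact (hmeas.comp
        (by fun_prop : Measurable fun w : ℝ × (Vec n × ℝ) => (w.2, h * w.1))).aemeasurable
    rw [e]
    refine lintegral_mono_ae ?_
    filter_upwards [ae_integrable_translate h hp hG hGp] with z hz
    have : timeMean h G z - G z = ∫ r, (G (z - (0, h * r)) - G z) ∂expWeight := by
      rw [integral_sub hz (integrable_const _), timeMean_eq_integral_translate]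
      simp
    rw [this]
    exact enorm_integral_rpow_le hp (hz.sub (integrable_const _)).aestronglyMeasurable
  refine tendsto_of_tendsto_of_tendsto_of_le_of_le tendsto_const_nhds ?_ (fun _ => zero_le) hbound
  have h0 : (0 : ℝ≥0∞) = ∫⁻ _ : ℝ, 0 ∂expWeight := by simp
  rw [h0]
  refine tendsto_lintegral_filter_of_dominated_convergence
    (fun _ => 2 ^ (p - 1) * (2 * ∫⁻ z, ‖G z‖ₑ ^ p))
    (Eventually.of_forall fun h => hoscm.comp (by fun_prop))
    (Eventually.of_forall fun h => ae_of_all _ fun r => hoscb _) ?_ (ae_of_all _ fun r => ?_)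
  · simp only [lintegral_const, measure_univ, mul_one]
    exact ENNReal.mul_ne_top (by simp) (ENNReal.mul_ne_top (by simp) hM)
  · refine hosc0.comp ?_
    have : Tendsto (fun h : ℝ => h * r) (𝓝 0) (𝓝 (0 * r)) := tendsto_id.mul_const r
    simpa using this

end

/-! ### Averages of maps with values in a Lebesgue space -/

/-- A map into a second countable space is measurable if its distance to every point is. -/
theorem measurable_of_measurable_edist {S Y : Type*} [MeasurableSpace S] [PseudoEMetricSpace Y]
    [SecondCountableTopology Y] [MeasurableSpace Y] [BorelSpace Y] {f : S → Y}
    (hf : ∀ y, Measurable fun s => edist (f s) y) : Measurable f := by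
  refine measurable_of_isOpen fun O hO => ?_
  choose! r hr hrO using fun y (hy : y ∈ O) => EMetric.isOpen_iff.1 hO y hy
  obtain ⟨D, hDO, hD, hDU⟩ := TopologicalSpace.isOpen_biUnion_countable O
    (fun y => Metric.eball y (r y)) (fun y _ => Metric.isOpen_eball)
  have hOD : O = ⋃ y ∈ D, Metric.eball y (r y) := by
    rw [hDU]
    refine subset_antisymm (fun y hy => ?_) (iUnion₂_subset hrO)
    exact mem_biUnion hy (Metric.mem_eball_self (hr y hy))
  rw [hOD, preimage_iUnion₂]
  exact MeasurableSet.biUnion hD fun y _ => measurableSet_lt (hf y) measurable_const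

/-- Integration against a bounded measurable field of linear maps is a continuous linear map on
`L^p` of a finite measure space. -/
theorem exists_continuousLinearMap_integral {X W V : Type*} [MeasurableSpace X]
    [NormedAddCommGroup W] [NormedSpace ℝ W] [NormedAddCommGroup V] [NormedSpace ℝ V]
    {μ : Measure X} [IsFiniteMeasure μ] {p : ℝ≥0∞} [Fact (1 ≤ p)]
    {Λ : X → W →L[ℝ] V} (hΛ : AEStronglyMeasurable Λ μ) {C : ℝ} (hC : ∀ x, ‖Λ x‖ ≤ C) :
    ∃ ℓ : Lp W p μ →L[ℝ] V, (∀ F : Lp W p μ, ℓ F = ∫ x, Λ x (F x) ∂μ) ∧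
      ∀ F : Lp W p μ, Integrable (fun x => Λ x (F x)) μ := by
  have hint : ∀ F : Lp W p μ, Integrable F μ := fun F => (Lp.memLp F).integrable Fact.out
  have hΛint : ∀ F : Lp W p μ, Integrable (fun x => Λ x (F x)) μ := fun F => by
    refine Integrable.mono' ((hint F).norm.const_mul C) ?_ (ae_of_all _ fun x => ?_)
    · exact isBoundedBilinearMap_apply.continuous.comp_aestronglyMeasurable
        (hΛ.prodMk (hint F).aestronglyMeasurable)
    · exact (Λ x).le_of_opNorm_le (hC x) _
  set K : ℝ≥0∞ := μ univ ^ (1 / (1 : ℝ≥0∞).toReal - 1 / p.toReal) with hK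
  have hKtop : K ≠ ⊤ := by
    refine ENNReal.rpow_ne_top_of_nonneg ?_ (measure_ne_top _ _)
    have h1 : (1 : ℝ≥0∞) ≤ p := Fact.out
    rcases eq_or_ne p ⊤ with rfl | hp
    · simp
    · have : 1 ≤ p.toReal := by
        rw [← ENNReal.toReal_one]; exact ENNReal.toReal_mono hp h1
      simp only [ENNReal.toReal_one, div_one, one_div, sub_nonneg]
      exact inv_le_one_of_one_le₀ this
  have hbound : ∀ F : Lp W p μ, ∫ x, ‖F x‖ ∂μ ≤ K.toReal * ‖F‖ := fun F => by
    rw [integral_norm_eq_lintegral_enorm (hint F).aestronglyMeasurable,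
      ← eLpNorm_one_eq_lintegral_enorm, Lp.norm_def, ← ENNReal.toReal_mul, mul_comm]
    refine ENNReal.toReal_mono (ENNReal.mul_ne_top (Lp.memLp F).eLpNorm_ne_top hKtop) ?_
    exact eLpNorm_le_eLpNorm_mul_rpow_measure_univ Fact.out (Lp.aestronglyMeasurable F)
  let L : Lp W p μ →ₗ[ℝ] V :=
    { toFun := fun F => ∫ x, Λ x (F x) ∂μ
      map_add' := fun F F' => by
        rw [← integral_add (hΛint F) (hΛint F')]
        refine integral_congr_ae ?_
        filter_upwards [Lp.coeFn_add F F'] with x hx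
        rw [hx, Pi.add_apply, map_add]
      map_smul' := fun c F => by
        simp only [RingHom.id_apply]
        rw [← integral_smul]
        refine integral_congr_ae ?_
        filter_upwards [Lp.coeFn_smul c F] with x hx
        rw [hx, Pi.smul_apply, map_smul] }
  refine ⟨L.mkContinuous (|C| * K.toReal) fun F => ?_, fun F => rfl, hΛint⟩
  calc ‖L F‖ ≤ ∫ x, |C| * ‖F x‖ ∂μ := by
        refine norm_integral_le_of_norm_le ((hint F).norm.const_mul _) (ae_of_all _ fun x => ?_)
        exact (Λ x).le_of_opNorm_le ((hC x).trans (le_abs_self C)) _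
    _ = |C| * ∫ x, ‖F x‖ ∂μ := integral_const_mul _ _
    _ ≤ |C| * K.toReal * ‖F‖ := by
        rw [mul_assoc]
        exact mul_le_mul_of_nonneg_left (hbound F) (abs_nonneg _)

/-- The mean value of a family of `L^p` functions which lie in a closed subspace of `L^p`, computed
pointwise, lies in that subspace. -/
theorem exists_toLp_integral_mem {X S W : Type*} [MeasurableSpace X]
    [MeasurableSpace.CountablyGenerated X] [MeasurableSpace S] [NormedAddCommGroup W]
    [NormedSpace ℝ W] [FiniteDimensional ℝ W] {μ : Measure X} [IsFiniteMeasure μ] {κ : Measure S}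
    [IsProbabilityMeasure κ] {p : ℝ} [Fact (1 ≤ ENNReal.ofReal p)] {H : X × S → W}
    (hH : StronglyMeasurable H)
    (hHp : ∫⁻ s, ∫⁻ x, ‖H (x, s)‖ₑ ^ p ∂μ ∂κ < ⊤) {K : Submodule ℝ (Lp W (ENNReal.ofReal p) μ)}
    (hK : IsClosed (K : Set (Lp W (ENNReal.ofReal p) μ)))
    (hHK : ∀ᵐ s ∂κ, ∃ hs : MemLp (fun x => H (x, s)) (ENNReal.ofReal p) μ, hs.toLp ∈ K) :
    ∃ hB : MemLp (fun x => ∫ s, H (x, s) ∂κ) (ENNReal.ofReal p) μ, hB.toLp ∈ K := by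
  classical
  have hp : 1 ≤ p := by simpa using (Fact.out : 1 ≤ ENNReal.ofReal p)
  have hp0 : 0 < p := by linarith
  have : Fact (ENNReal.ofReal p ≠ ⊤) := ⟨ENNReal.ofReal_ne_top⟩
  have : CompleteSpace W := FiniteDimensional.complete ℝ W
  have hslice : ∀ s, AEStronglyMeasurable (fun x => H (x, s)) μ := fun s =>
    (hH.comp_measurable measurable_prodMk_right).aestronglyMeasurable
  let Γ : S → Lp W (ENNReal.ofReal p) μ := fun s =>
    if hs : MemLp (fun x => H (x, s)) (ENNReal.ofReal p) μ then hs.toLp else 0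
  -- measurability of the family, by way of its distance to a given element
  borelize ↥(Lp W (ENNReal.ofReal p) μ)
  have hHm : Measurable fun s => ∫⁻ x, ‖H (x, s)‖ₑ ^ p ∂μ :=
    (hH.enorm.pow_const p).lintegral_prod_left'
  have hmem : MeasurableSet {s | MemLp (fun x => H (x, s)) (ENNReal.ofReal p) μ} := by
    have : {s | MemLp (fun x => H (x, s)) (ENNReal.ofReal p) μ}
        = {s | ∫⁻ x, ‖H (x, s)‖ₑ ^ p ∂μ < ⊤} := by
      ext s; exact memLp_ofReal_iff hp0 (hslice s)
    rw [this]
    exact measurableSet_lt hHm measurable_const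
  have hΓm : Measurable Γ := by
    refine measurable_of_measurable_edist fun g => ?_
    obtain ⟨g', hg'm, hg'⟩ := Lp.aestronglyMeasurable g
    have e : (fun s => edist (Γ s) g) = fun s =>
        if MemLp (fun x => H (x, s)) (ENNReal.ofReal p) μ
        then (∫⁻ x, ‖H (x, s) - g' x‖ₑ ^ p ∂μ) ^ (1 / p) else edist 0 g := by
      ext s
      by_cases hs : MemLp (fun x => H (x, s)) (ENNReal.ofReal p) μ
      · simp only [Γ, hs, dif_pos, if_true]
        rw [Lp.edist_def, eLpNorm_ofReal_eq hp0]
        congr 1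
        refine lintegral_congr_ae ?_
        filter_upwards [hs.coeFn_toLp, hg'] with x h1 h2
        simp [h1, h2]
      · simp only [Γ, hs, dif_neg, if_false, not_false_eq_true]
    rw [e]
    refine Measurable.ite hmem ?_ measurable_const
    exact (((hH.sub (hg'm.comp_measurable measurable_fst)).enorm.pow_const
      p).lintegral_prod_left').pow_const _
  have hΓint : Integrable Γ κ := by
    have : MemLp Γ (ENNReal.ofReal p) κ := by
      rw [memLp_ofReal_iff hp0 hΓm.aestronglyMeasurable]
      refine lt_of_le_of_lt (lintegral_mono fun s => ?_) hHp
      by_cases hs : MemLp (fun x => H (x, s)) (ENNReal.ofReal p) μ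
      · simp only [Γ, hs, dif_pos]
        rw [Lp.enorm_toLp, eLpNorm_ofReal_rpow hp0]
      · simp [Γ, hs, hp0]
    exact this.integrable Fact.out
  have hBK : ∫ s, Γ s ∂κ ∈ K := by
    refine Convex.integral_mem K.convex hK ?_ hΓint
    filter_upwards [hHK] with s hs
    obtain ⟨hs, hsK⟩ := hs
    rw [SetLike.mem_coe]
    simpa only [Γ, hs, dif_pos] using hsK
  -- the vector valued integral agrees with the pointwise integral
  have hprod : Integrable H (μ.prod κ) := by
    have : MemLp H (ENNReal.ofReal p) (μ.prod κ) := by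
      rw [memLp_ofReal_iff hp0 hH.aestronglyMeasurable,
        lintegral_prod_symm' _ (hH.enorm.pow_const p)]
      exact hHp
    exact this.integrable Fact.out
  have hae : (∫ s, Γ s ∂κ : Lp W (ENNReal.ofReal p) μ) =ᵐ[μ] fun x => ∫ s, H (x, s) ∂κ := by
    refine Integrable.ae_eq_of_forall_setIntegral_eq _ _ ((Lp.memLp _).integrable Fact.out)
      hprod.integral_prod_left fun A hA _ => ?_
    obtain ⟨ℓ, hℓ, -⟩ := exists_continuousLinearMap_integral (μ := μ) (p := ENNReal.ofReal p)
      (Λ := A.indicator fun _ => ContinuousLinearMap.id ℝ W) (C := 1)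
      ((stronglyMeasurable_const.indicator hA).aestronglyMeasurable) (fun x => by
        by_cases hx : x ∈ A
        · simpa [hx] using ContinuousLinearMap.norm_id_le
        · simp [hx])
    have hℓ' : ∀ F : Lp W (ENNReal.ofReal p) μ, ℓ F = ∫ x in A, F x ∂μ := fun F => by
      rw [hℓ, ← integral_indicator hA]
      congr 1
      ext x
      by_cases hx : x ∈ A <;> simp [hx]
    rw [← hℓ', ← ℓ.integral_comp_comm hΓint]
    have e1 : ∫ s, ℓ (Γ s) ∂κ = ∫ s, ∫ x in A, H (x, s) ∂μ ∂κ := by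
      refine integral_congr_ae ?_
      filter_upwards [hHK] with s hs
      obtain ⟨hs, -⟩ := hs
      rw [hℓ']
      simp only [Γ, hs, dif_pos]
      exact integral_congr_ae (ae_restrict_of_ae hs.coeFn_toLp)
    rw [e1]
    refine (integral_integral_swap (f := fun x s => H (x, s)) ?_).symm
    refine hprod.mono_measure ?_
    exact Measure.prod_mono Measure.restrict_le_self le_rfl
  have hB : MemLp (fun x => ∫ s, H (x, s) ∂κ) (ENNReal.ofReal p) μ := (Lp.memLp _).ae_eq hae
  refine ⟨hB, ?_⟩
  have : hB.toLp = ∫ s, Γ s ∂κ := by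
    refine Lp.ext ?_
    exact hB.coeFn_toLp.trans hae.symm
  rwa [this]

/-! ### The Sobolev space `W₀^{1,p}` as a closed subspace of `L^p` -/

section

variable {n N : ℕ}

theorem jac_add {φ ψ : Vec n → Vec N} (hφ : Differentiable ℝ φ) (hψ : Differentiable ℝ ψ)
    (x : Vec n) : jac (fun y => φ y + ψ y) x = jac φ x + jac ψ x := by
  ext ij
  simp [jac, fderiv_fun_add (hφ x) (hψ x)]

theorem jac_const_smul (c : ℝ) {φ : Vec n → Vec N} (hφ : Differentiable ℝ φ) (x : Vec n) :
    jac (fun y => c • φ y) x = c • jac φ x := by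
  ext ij
  simp [jac, fderiv_fun_const_smul (hφ x)]

theorem continuous_jac {φ : Vec n → Vec N} (hφ : ContDiff ℝ 1 φ) : Continuous (jac φ) := by
  have h : Continuous (fderiv ℝ φ) := hφ.continuous_fderiv one_ne_zero
  refine (PiLp.continuous_toLp 2 _).comp (continuous_pi fun ij => ?_)
  have h2 : Continuous fun x => fderiv ℝ φ x (EuclideanSpace.single ij.2 1) :=
    h.clm_apply continuous_const
  exact (EuclideanSpace.proj (𝕜 := ℝ) ij.1).continuous.comp h2

theorem jac_eq_zero_of_notMem_tsupport {φ : Vec n → Vec N} {x : Vec n} (hx : x ∉ tsupport φ) :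
    jac φ x = 0 := by
  have h : fderiv ℝ φ x = 0 := by
    by_contra h0
    exact hx (support_fderiv_subset ℝ h0)
  ext ij
  simp [jac, h]

namespace IsTestFun

variable {X F : Type*} [NormedAddCommGroup X] [NormedSpace ℝ X] [NormedAddCommGroup F]
  [NormedSpace ℝ F] {S : Set X} {φ ψ : X → F}

theorem zero (S : Set X) : IsTestFun S (0 : X → F) where
  smooth := contDiff_const
  compact := HasCompactSupport.zero
  support := by simp [tsupport]

theorem add (hφ : IsTestFun S φ) (hψ : IsTestFun S ψ) : IsTestFun S fun x => φ x + ψ x where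
  smooth := hφ.smooth.add hψ.smooth
  compact := hφ.compact.add hψ.compact
  support := (tsupport_add _ _).trans (union_subset hφ.support hψ.support)

theorem const_smul (c : ℝ) (hφ : IsTestFun S φ) : IsTestFun S fun x => c • φ x where
  smooth := contDiff_const.smul hφ.smooth
  compact := hφ.compact.smul_left
  support := (closure_mono (Function.support_const_smul_subset c φ)).trans hφ.support

theorem differentiable (hφ : IsTestFun S φ) : Differentiable ℝ φ :=
  hφ.smooth.differentiable (by simp)

theorem contDiff_one (hφ : IsTestFun S φ) : ContDiff ℝ 1 φ := hφ.smooth.of_le (by simp)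

theorem eq_zero_of_notMem (hφ : IsTestFun S φ) {x : X} (hx : x ∉ S) : φ x = 0 :=
  image_eq_zero_of_notMem_tsupport fun h => hx (hφ.support h)

end IsTestFun

theorem IsTestFun.memLp_prodMk {Ω : Set (Vec n)} {φ : Vec n → Vec N} (hφ : IsTestFun Ω φ)
    (p : ℝ≥0∞) (μ : Measure (Vec n)) [IsFiniteMeasureOnCompacts μ] :
    MemLp (fun x => (φ x, jac φ x)) p μ := by
  refine (hφ.contDiff_one.continuous.prodMk
    (continuous_jac hφ.contDiff_one)).memLp_of_hasCompactSupport ?_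
  refine HasCompactSupport.intro hφ.compact fun x hx => ?_
  rw [image_eq_zero_of_notMem_tsupport hx, jac_eq_zero_of_notMem_tsupport hx]
  rfl

theorem IsTestFun.hasWeakGrad {Ω : Set (Vec n)} {φ : Vec n → Vec N} (hφ : IsTestFun Ω φ) :
    HasWeakGrad Ω φ (jac φ) := by
  intro η hη i j
  have hφi : ContDiff ℝ 1 fun x => φ x i :=
    (EuclideanSpace.proj (𝕜 := ℝ) i).contDiff.comp hφ.contDiff_one
  have hfd : ∀ x, fderiv ℝ (fun y => φ y i) x (EuclideanSpace.single j 1) = jac φ x (i, j) := by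
    intro x
    have h := (EuclideanSpace.proj (𝕜 := ℝ) i).hasFDerivAt.comp x (hφ.differentiable x).hasFDerivAt
    have h' : fderiv ℝ (fun y => φ y i) x = _ := h.fderiv
    rw [h']
    simp [jac]
  have hηd : Continuous fun x => fderiv ℝ η x (EuclideanSpace.single j (1 : ℝ)) :=
    (hη.contDiff_one.continuous_fderiv one_ne_zero).clm_apply continuous_const
  have hφd : Continuous fun x => fderiv ℝ (fun y => φ y i) x (EuclideanSpace.single j (1 : ℝ)) :=
    (hφi.continuous_fderiv one_ne_zero).clm_apply continuous_const
  have key := integral_mul_fderiv_eq_neg_fderiv_mul_of_integrable (μ := volume)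
    (f := fun x => φ x i) (g := η) (v := EuclideanSpace.single j (1 : ℝ))
    ((hφd.mul hη.contDiff_one.continuous).integrable_of_hasCompactSupport hη.compact.mul_left)
    ((hφi.continuous.mul hηd).integrable_of_hasCompactSupport
      (hη.compact.fderiv_apply ℝ _).mul_left)
    ((hφi.continuous.mul hη.contDiff_one.continuous).integrable_of_hasCompactSupport
      hη.compact.mul_left)
    (fun x _ => hφi.differentiable one_ne_zero x) (fun x _ => hη.differentiable x)
  rw [setIntegral_eq_integral_of_forall_compl_eq_zero, key,
    setIntegral_eq_integral_of_forall_compl_eq_zero]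
  · simp only [hfd]
  · intro x hx
    rw [hη.eq_zero_of_notMem hx, mul_zero]
  · intro x hx
    rw [hφ.eq_zero_of_notMem hx]
    simp

/-- The pairs `(φ, Dφ)` with `φ ∈ C₀^∞(Ω, ℝᴺ)`, as a subspace of `L^p`. The values lie in a product
with the maximum norm, which gives an equivalent norm on `W^{1,p}`. -/
def testPairs (p : ℝ) (N : ℕ) (Ω : Set (Vec n)) :
    Submodule ℝ (Lp (Vec N × Mat N n) (ENNReal.ofReal p) (volume.restrict Ω)) where
  carrier := {F | ∃ φ : Vec n → Vec N, IsTestFun Ω φ ∧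
    F =ᵐ[volume.restrict Ω] fun x => (φ x, jac φ x)}
  zero_mem' := ⟨0, IsTestFun.zero Ω, by
    filter_upwards [Lp.coeFn_zero (Vec N × Mat N n) (ENNReal.ofReal p) (volume.restrict Ω)]
      with x hx
    have : jac (0 : Vec n → Vec N) x = 0 := jac_eq_zero_of_notMem_tsupport (by simp [tsupport])
    rw [hx, this]
    rfl⟩
  add_mem' := by
    rintro F F' ⟨φ, hφ, hF⟩ ⟨ψ, hψ, hF'⟩
    refine ⟨_, hφ.add hψ, ?_⟩
    filter_upwards [Lp.coeFn_add F F', hF, hF'] with x h1 h2 h3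
    rw [h1, Pi.add_apply, h2, h3, jac_add hφ.differentiable hψ.differentiable]
    rfl
  smul_mem' := by
    rintro c F ⟨φ, hφ, hF⟩
    refine ⟨_, hφ.const_smul c, ?_⟩
    filter_upwards [Lp.coeFn_smul c F, hF] with x h1 h2
    rw [h1, Pi.smul_apply, h2, jac_const_smul c hφ.differentiable]
    rfl

/-- The pairs `(v, Dv)` with `v ∈ W₀^{1,p}(Ω, ℝᴺ)`, as a closed subspace of `L^p`. -/
def sobolevZero (p : ℝ) [Fact (1 ≤ ENNReal.ofReal p)] (N : ℕ) (Ω : Set (Vec n)) :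
    Submodule ℝ (Lp (Vec N × Mat N n) (ENNReal.ofReal p) (volume.restrict Ω)) :=
  (testPairs p N Ω).topologicalClosure

variable {p : ℝ} [Fact (1 ≤ ENNReal.ofReal p)] {Ω : Set (Vec n)}

theorem memLp_prodMk_iff {X A B : Type*} [MeasurableSpace X] [NormedAddCommGroup A]
    [NormedAddCommGroup B] {μ : Measure X} {q : ℝ≥0∞} {v : X → A} {D : X → B} :
    MemLp (fun x => (v x, D x)) q μ ↔ MemLp v q μ ∧ MemLp D q μ := by
  constructor
  · intro h
    exact ⟨h.mono (continuous_fst.comp_aestronglyMeasurable h.1)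
      (ae_of_all _ fun x => norm_fst_le (v x, D x)),
      h.mono (continuous_snd.comp_aestronglyMeasurable h.1)
      (ae_of_all _ fun x => norm_snd_le (v x, D x))⟩
  · rintro ⟨h1, h2⟩
    refine (h1.norm.add h2.norm).mono (h1.1.prodMk h2.1) (ae_of_all _ fun x => ?_)
    rw [Prod.norm_def, Pi.add_apply, Real.norm_of_nonneg (by positivity)]
    exact max_le_add_of_nonneg (norm_nonneg _) (norm_nonneg _)

/-- The embedding of `W₀^{1,p}` into `L^p` by `v ↦ (v, Dv)` maps into `sobolevZero`; see
`memW1pZero_of_toLp_mem` for the converse. -/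
theorem MemW1pZero.toLp_mem {v : Vec n → Vec N} {D : Vec n → Mat N n} (h : MemW1pZero p Ω v D) :
    ∃ hs : MemLp (fun x => (v x, D x)) (ENNReal.ofReal p) (volume.restrict Ω),
      hs.toLp ∈ sobolevZero p N Ω := by
  have hs := memLp_prodMk_iff.2 ⟨h.memW1p.memLp, h.memW1p.grad_memLp⟩
  refine ⟨hs, ?_⟩
  rw [sobolevZero, ← SetLike.mem_coe, Submodule.topologicalClosure_coe, EMetric.mem_closure_iff]
  intro ε hε
  have hε3 : 0 < ε / 3 := by simpa using hε.ne'
  obtain ⟨φ, hφ, h1, h2⟩ := h.approx (min (ε / 3) 1) (lt_min hε3 one_pos)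
  have hφL := hφ.memLp_prodMk (ENNReal.ofReal p) (volume.restrict Ω)
  refine ⟨hφL.toLp, ⟨φ, hφ, hφL.coeFn_toLp⟩, ?_⟩
  rw [Lp.edist_toLp_toLp]
  have hm1 := h.memW1p.memLp.1.sub hφ.contDiff_one.continuous.aestronglyMeasurable
  have hm2 := h.memW1p.grad_memLp.1.sub (continuous_jac hφ.contDiff_one).aestronglyMeasurable
  calc eLpNorm ((fun x => (v x, D x)) - fun x => (φ x, jac φ x)) (ENNReal.ofReal p)
        (volume.restrict Ω)
      ≤ eLpNorm ((fun x => ‖v x - φ x‖) + fun x => ‖D x - jac φ x‖) (ENNReal.ofReal p)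
        (volume.restrict Ω) := by
        refine eLpNorm_mono fun x => ?_
        rw [Pi.add_apply, Real.norm_of_nonneg (by positivity)]
        exact max_le_add_of_nonneg (norm_nonneg (v x - φ x)) (norm_nonneg (D x - jac φ x))
    _ ≤ eLpNorm (fun x => v x - φ x) (ENNReal.ofReal p) (volume.restrict Ω)
        + eLpNorm (fun x => D x - jac φ x) (ENNReal.ofReal p) (volume.restrict Ω) := by
        refine (eLpNorm_add_le hm1.norm hm2.norm Fact.out).trans (add_le_add ?_ ?_)
        · exact (eLpNorm_norm _).le
        · exact (eLpNorm_norm _).le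
    _ ≤ min (ε / 3) 1 + min (ε / 3) 1 := add_le_add h1 h2
    _ < ε := by
        rcases eq_or_ne ε ⊤ with rfl | hεt
        · exact lt_of_le_of_lt (add_le_add (min_le_right _ _) (min_le_right _ _)) (by norm_num)
        · refine lt_of_le_of_lt (add_le_add (min_le_left _ _) (min_le_left _ _)) ?_
          have h3 : ε / 3 + ε / 3 + ε / 3 = ε := ENNReal.add_thirds ε
          have hfin : ε / 3 + ε / 3 ≠ ⊤ := by
            have := (ENNReal.div_lt_top hεt (by norm_num : (3 : ℝ≥0∞) ≠ 0)).ne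
            exact ENNReal.add_ne_top.2 ⟨this, this⟩
          conv_rhs => rw [← h3]
          exact ENNReal.lt_add_right hfin hε3.ne'

/-- Weak gradients survive in the closure, because both sides of the defining identity are
continuous in `L^p`. -/
theorem hasWeakGrad_of_toLp_mem [IsFiniteMeasure (volume.restrict Ω)] {v : Vec n → Vec N}
    {D : Vec n → Mat N n}
    (hs : MemLp (fun x => (v x, D x)) (ENNReal.ofReal p) (volume.restrict Ω))
    (hmem : hs.toLp ∈ sobolevZero p N Ω) : HasWeakGrad Ω v D := by
  intro η hη i j
  have hηd : Continuous fun x => fderiv ℝ η x (EuclideanSpace.single j (1 : ℝ)) :=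
    (hη.contDiff_one.continuous_fderiv one_ne_zero).clm_apply continuous_const
  obtain ⟨C₁, hC₁⟩ := hη.contDiff_one.continuous.bounded_above_of_compact_support hη.compact
  obtain ⟨C₂, hC₂⟩ := hηd.bounded_above_of_compact_support (hη.compact.fderiv_apply ℝ _)
  -- the two integrals are continuous functionals of the pair `(v, D)`
  let P₁ : Vec N × Mat N n →L[ℝ] ℝ :=
    (EuclideanSpace.proj (𝕜 := ℝ) i).comp (ContinuousLinearMap.fst ℝ _ _)
  let P₂ : Vec N × Mat N n →L[ℝ] ℝ :=
    (EuclideanSpace.proj (𝕜 := ℝ) (i, j)).comp (ContinuousLinearMap.snd ℝ _ _)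
  obtain ⟨ℓ₁, hℓ₁, -⟩ := exists_continuousLinearMap_integral (μ := volume.restrict Ω)
    (p := ENNReal.ofReal p) (C := C₂ * ‖P₁‖)
    (Λ := fun x => fderiv ℝ η x (EuclideanSpace.single j (1 : ℝ)) • P₁)
    (hηd.smul continuous_const).aestronglyMeasurable
    (fun x => by
      rw [norm_smul]; exact mul_le_mul_of_nonneg_right (hC₂ x) (norm_nonneg _))
  obtain ⟨ℓ₂, hℓ₂, -⟩ := exists_continuousLinearMap_integral (μ := volume.restrict Ω)
    (p := ENNReal.ofReal p) (C := C₁ * ‖P₂‖) (Λ := fun x => η x • P₂)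
    (hη.contDiff_one.continuous.smul continuous_const).aestronglyMeasurable
    (fun x => by
      rw [norm_smul]; exact mul_le_mul_of_nonneg_right (hC₁ x) (norm_nonneg _))
  have hform : ∀ (F : Lp (Vec N × Mat N n) (ENNReal.ofReal p) (volume.restrict Ω))
      (w : Vec n → Vec N) (M : Vec n → Mat N n),
      (F =ᵐ[volume.restrict Ω] fun x => (w x, M x)) →
      ((ℓ₁ + ℓ₂) F = 0 ↔ ∫ x in Ω, w x i * fderiv ℝ η x (EuclideanSpace.single j 1)
        = - ∫ x in Ω, M x (i, j) * η x) := by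
    intro F w M hF
    have e1 : ℓ₁ F = ∫ x in Ω, w x i * fderiv ℝ η x (EuclideanSpace.single j 1) := by
      rw [hℓ₁]
      refine integral_congr_ae ?_
      filter_upwards [hF] with x hx
      simp [hx, P₁, mul_comm]
    have e2 : ℓ₂ F = ∫ x in Ω, M x (i, j) * η x := by
      rw [hℓ₂]
      refine integral_congr_ae ?_
      filter_upwards [hF] with x hx
      simp [hx, P₂, mul_comm]
    rw [add_apply, e1, e2, add_eq_zero_iff_eq_neg]
  have hker : sobolevZero p N Ω ≤ (ℓ₁ + ℓ₂).ker := by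
    refine Submodule.topologicalClosure_minimal _ ?_ (ContinuousLinearMap.isClosed_ker _)
    rintro F ⟨φ, hφ, hF⟩
    exact (hform F φ (jac φ) hF).2 (hφ.hasWeakGrad η hη i j)
  exact (hform _ v D hs.coeFn_toLp).1 (hker hmem)

/-- Together with `MemW1pZero.toLp_mem`, this identifies `W₀^{1,p}` with `sobolevZero`. -/
theorem memW1pZero_of_toLp_mem [IsFiniteMeasure (volume.restrict Ω)] {v : Vec n → Vec N}
    {D : Vec n → Mat N n}
    (hs : MemLp (fun x => (v x, D x)) (ENNReal.ofReal p) (volume.restrict Ω))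
    (hmem : hs.toLp ∈ sobolevZero p N Ω) : MemW1pZero p Ω v D := by
  obtain ⟨h1, h2⟩ := memLp_prodMk_iff.1 hs
  refine ⟨⟨h1, h2, hasWeakGrad_of_toLp_mem hs hmem⟩, fun ε hε => ?_⟩
  rw [sobolevZero, ← SetLike.mem_coe, Submodule.topologicalClosure_coe,
    EMetric.mem_closure_iff] at hmem
  obtain ⟨F, ⟨φ, hφ, hF⟩, hd⟩ := hmem ε hε
  have hd' : eLpNorm (fun x => (v x - φ x, D x - jac φ x)) (ENNReal.ofReal p) (volume.restrict Ω)
      ≤ ε := by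
    rw [Lp.edist_def] at hd
    refine (eLpNorm_congr_ae ?_).trans_le hd.le
    filter_upwards [hs.coeFn_toLp, hF] with x hx1 hx2
    rw [Pi.sub_apply, hx1, hx2]
    rfl
  refine ⟨φ, hφ, (eLpNorm_mono fun x => ?_).trans hd', (eLpNorm_mono fun x => ?_).trans hd'⟩
  · exact norm_fst_le (v x - φ x, D x - jac φ x)
  · exact norm_snd_le (v x - φ x, D x - jac φ x)

end

/-! ### Signed powers and the boundary term -/

section

variable {N : ℕ} {q : ℝ}

theorem norm_spow (hq : 0 < q) (u : Vec N) : ‖spow q u‖ = ‖u‖ ^ q := by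
  rw [spow, norm_smul, Real.norm_of_nonneg (by positivity)]
  rcases eq_or_ne u 0 with rfl | hu
  · simp [hq.ne']
  · rw [← Real.rpow_add_one (norm_ne_zero_iff.2 hu), sub_add_cancel]

theorem continuous_spow (hq : 0 < q) : Continuous (spow q : Vec N → Vec N) := by
  refine continuous_iff_continuousAt.2 fun u => ?_
  rcases eq_or_ne u 0 with rfl | hu
  · have h0 : spow q (0 : Vec N) = 0 := by simp [spow]
    rw [ContinuousAt, h0, tendsto_zero_iff_norm_tendsto_zero]
    simp only [norm_spow hq]
    have : Continuous fun u : Vec N => ‖u‖ ^ q := continuous_norm.rpow_const fun _ => Or.inr hq.le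
    simpa [hq.ne'] using this.tendsto 0
  · exact (continuousAt_id.norm.rpow_const (Or.inl (norm_ne_zero_iff.2 hu))).smul continuousAt_id

theorem inner_spow_self (hq : 0 < q) (u : Vec N) : inner ℝ (spow q u) u = ‖u‖ ^ (q + 1) := by
  rcases eq_or_ne u 0 with rfl | hu
  · simp [show q + 1 ≠ 0 by linarith]
  · rw [spow, real_inner_smul_left, real_inner_self_eq_norm_sq, ← Real.rpow_natCast,
      ← Real.rpow_add (norm_pos_iff.2 hu)]
    congr 1
    push_cast
    ring

theorem inner_spow_le (hq : 0 < q) (a b : Vec N) : inner ℝ (spow q a) b ≤ ‖a‖ ^ q * ‖b‖ := by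
  rw [← norm_spow hq]
  exact real_inner_le_norm _ _

/-- The graph of `|b|^{q+1}/(q+1)` lies above its tangent at `a`; this is Young's inequality. -/
theorem bterm_nonneg (hq : 0 < q) (a b : Vec N) : 0 ≤ bterm q a b := by
  have hq1 : 0 < q + 1 := by linarith
  have hconj : ((q + 1) / q).HolderConjugate (q + 1) := by
    rw [Real.holderConjugate_iff]
    constructor
    · rw [lt_div_iff₀ hq]; linarith
    · field_simp
  have hy := Real.young_inequality_of_nonneg (a := ‖a‖ ^ q) (b := ‖b‖) (by positivity)
    (norm_nonneg _) hconj
  rw [← Real.rpow_mul (norm_nonneg _), mul_div_cancel₀ _ hq.ne'] at hy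
  have h1 := inner_spow_le hq a b
  rw [bterm, inner_sub_right, inner_spow_self hq]
  have e : ‖a‖ ^ (q + 1) / ((q + 1) / q) = ‖a‖ ^ (q + 1) - 1 / (q + 1) * ‖a‖ ^ (q + 1) := by
    field_simp
    ring
  rw [e] at hy
  have e2 : ‖b‖ ^ (q + 1) / (q + 1) = 1 / (q + 1) * ‖b‖ ^ (q + 1) := by ring
  linarith

theorem bterm_add_bterm (q : ℝ) (a b : Vec N) :
    bterm q a b + bterm q b a = inner ℝ (spow q b - spow q a) (b - a) := by
  simp only [bterm, inner_sub_left, inner_sub_right]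
  ring

/-- Monotonicity of the signed power. -/
theorem inner_spow_sub_nonneg (hq : 0 < q) (a b : Vec N) :
    0 ≤ inner ℝ (spow q b - spow q a) (b - a) := by
  rw [← bterm_add_bterm]
  exact add_nonneg (bterm_nonneg hq a b) (bterm_nonneg hq b a)

theorem add_rpow_le_two_mul_rpow {x y r : ℝ} (hx : 0 ≤ x) (hy : 0 ≤ y) (hr : 0 ≤ r) :
    (x + y) ^ r ≤ (2 * x) ^ r + (2 * y) ^ r := by
  rcases le_total x y with h | h
  · exact (Real.rpow_le_rpow (by positivity) (by linarith : x + y ≤ 2 * y) hr).trans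
      (le_add_of_nonneg_left (by positivity))
  · exact (Real.rpow_le_rpow (by positivity) (by linarith : x + y ≤ 2 * x) hr).trans
      (le_add_of_nonneg_right (by positivity))

theorem rpow_mul_le_add {x y : ℝ} (hx : 0 ≤ x) (hy : 0 ≤ y) (hq : 0 < q) :
    x ^ q * y ≤ x ^ (q + 1) + y ^ (q + 1) := by
  have hq1 : q + 1 ≠ 0 := by linarith
  have key : ∀ z : ℝ, 0 ≤ z → z ^ q * z = z ^ (q + 1) := fun z hz => by
    rw [Real.rpow_add_one' hz hq1]
  rcases le_total x y with h | h
  · refine le_trans ?_ (le_add_of_nonneg_left (by positivity))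
    rw [← key y hy]
    gcongr
  · refine le_trans ?_ (le_add_of_nonneg_right (by positivity))
    rw [← key x hx]
    gcongr

/-- The boundary term is controlled by the distance of its arguments, up to a small multiple of
the power `|a|^{q+1}`. -/
theorem exists_bterm_le (hq : 0 < q) {δ : ℝ} (hδ : 0 < δ) :
    ∃ C : ℝ, 0 ≤ C ∧ ∀ a b : Vec N,
      bterm q a b ≤ δ * ‖a‖ ^ (q + 1) + C * ‖b - a‖ ^ (q + 1) := by
  have hq1 : 0 < q + 1 := by linarith
  -- with `m = 2|a| + |b - a|`, distinguish whether `|b - a|` is at most `ε m`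
  set ε : ℝ := δ / (2 * 4 ^ (q + 1)) with hε
  have hε0 : 0 < ε := by positivity
  refine ⟨2 * ε * 2 ^ (q + 1) + 2 * (1 / ε) ^ q, by positivity, fun a b => ?_⟩
  set d := ‖b - a‖ with hd
  have hd0 : 0 ≤ d := norm_nonneg _
  set m := 2 * ‖a‖ + d with hm
  have hm0 : 0 ≤ m := by positivity
  have ha : ‖a‖ ≤ m := by linarith [norm_nonneg a]
  have hb : ‖b‖ ≤ m := by
    have : ‖b‖ ≤ ‖b - a‖ + ‖a‖ := by simpa using norm_add_le (b - a) a
    linarith [norm_nonneg a]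
  have h1 : bterm q a b ≤ 2 * (m ^ q * d) := by
    have h2 := bterm_add_bterm q a b
    have h3 := bterm_nonneg hq b a
    have h4 : inner ℝ (spow q b - spow q a) (b - a) ≤ (‖b‖ ^ q + ‖a‖ ^ q) * d := by
      refine (real_inner_le_norm _ _).trans (mul_le_mul_of_nonneg_right ?_ hd0)
      refine (norm_sub_le _ _).trans ?_
      rw [norm_spow hq, norm_spow hq]
    have h5 : (‖b‖ ^ q + ‖a‖ ^ q) * d ≤ (m ^ q + m ^ q) * d := by gcongr
    linarith
  have key : ∀ z : ℝ, 0 ≤ z → z ^ q * z = z ^ (q + 1) := fun z hz => by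
    rw [Real.rpow_add_one' hz hq1.ne']
  have hda : 0 ≤ d ^ (q + 1) := by positivity
  have haa : 0 ≤ ‖a‖ ^ (q + 1) := by positivity
  rcases le_total d (ε * m) with hcase | hcase
  · have h2 : m ^ q * d ≤ ε * m ^ (q + 1) := by
      rw [← key m hm0]
      calc m ^ q * d ≤ m ^ q * (ε * m) := by gcongr
        _ = ε * (m ^ q * m) := by ring
    have h3 : m ^ (q + 1) ≤ 4 ^ (q + 1) * ‖a‖ ^ (q + 1) + 2 ^ (q + 1) * d ^ (q + 1) := by
      refine (add_rpow_le_two_mul_rpow (by positivity) hd0 hq1.le).trans (le_of_eq ?_)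
      rw [Real.mul_rpow (by norm_num) hd0, ← mul_assoc,
        Real.mul_rpow (by norm_num) (norm_nonneg a)]
      norm_num
    have h4 : 2 * ε * 4 ^ (q + 1) = δ := by
      rw [hε]
      field_simp
    calc bterm q a b ≤ 2 * (ε * (4 ^ (q + 1) * ‖a‖ ^ (q + 1) + 2 ^ (q + 1) * d ^ (q + 1))) := by
          refine h1.trans (mul_le_mul_of_nonneg_left ?_ zero_le_two)
          exact h2.trans (mul_le_mul_of_nonneg_left h3 hε0.le)
      _ = (2 * ε * 4 ^ (q + 1)) * ‖a‖ ^ (q + 1) + (2 * ε * 2 ^ (q + 1)) * d ^ (q + 1) := by ring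
      _ ≤ δ * ‖a‖ ^ (q + 1) + (2 * ε * 2 ^ (q + 1) + 2 * (1 / ε) ^ q) * d ^ (q + 1) := by
          rw [h4]
          gcongr
          exact le_add_of_nonneg_right (by positivity)
  · have h2 : m ≤ 1 / ε * d := by
      rw [one_div, ← div_eq_inv_mul, le_div_iff₀ hε0]
      linarith
    calc bterm q a b ≤ 2 * ((1 / ε * d) ^ q * d) := by
          refine h1.trans ?_
          gcongr
      _ = 2 * (1 / ε) ^ q * d ^ (q + 1) := by
          rw [Real.mul_rpow (by positivity) hd0, ← key d hd0]
          ring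
      _ ≤ δ * ‖a‖ ^ (q + 1) + (2 * ε * 2 ^ (q + 1) + 2 * (1 / ε) ^ q) * d ^ (q + 1) := by
          have : 0 ≤ δ * ‖a‖ ^ (q + 1) := by positivity
          have h6 : 0 ≤ 2 * ε * 2 ^ (q + 1) * d ^ (q + 1) := by positivity
          linarith

theorem hasFDerivAt_norm_rpow_div (hq : 0 < q) (u : Vec N) :
    HasFDerivAt (fun u : Vec N => 1 / (q + 1) * ‖u‖ ^ (q + 1)) (innerSL ℝ (spow q u)) u := by
  have h := (hasFDerivAt_norm_rpow u (p := q + 1) (by linarith)).const_mul (1 / (q + 1))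
  refine h.congr_fderiv ?_
  ext w
  have hq1 : q + 1 ≠ 0 := by linarith
  simp only [smul_apply, innerSL_apply_apply, spow, real_inner_smul_left, smul_eq_mul]
  rw [show q + 1 - 2 = q - 1 by ring]
  field_simp

theorem contDiff_norm_rpow_div (hq : 0 < q) :
    ContDiff ℝ 1 fun u : Vec N => 1 / (q + 1) * ‖u‖ ^ (q + 1) :=
  contDiff_const.mul (contDiff_norm_rpow (by linarith))

/-- Integrated chain rule for `|a + φ|^{q+1} - |a|^{q+1}`, where `φ` is smooth and vanishes at both
end points and `a` is merely an indefinite integral. -/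
theorem integral_inner_spow_add_eq_zero (hq : 0 < q) {a α φ φ' : ℝ → Vec N} {τ : ℝ} (hτ : 0 ≤ τ)
    (hα : IntervalIntegrable α volume 0 τ)
    (ha : ∀ t ∈ Icc 0 τ, a t = a 0 + ∫ s in (0 : ℝ)..t, α s)
    (hφ : ContDiff ℝ 1 φ) (hφ' : ∀ t, HasDerivAt φ (φ' t) t) (h0 : φ 0 = 0) (h1 : φ τ = 0) :
    ∫ s in (0 : ℝ)..τ, (inner ℝ (α s) (spow q (a s + φ s) - spow q (a s))
      + inner ℝ (φ' s) (spow q (a s + φ s))) = 0 := by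
  let Φ : Vec N → ℝ := fun u => 1 / (q + 1) * ‖u‖ ^ (q + 1)
  have hΦ : ContDiff ℝ 1 Φ := contDiff_norm_rpow_div hq
  let Ψ : ℝ × Vec N → ℝ := fun z => Φ (z.2 + φ z.1) - Φ z.2
  have hΨ : ContDiff ℝ 1 Ψ :=
    (hΦ.comp (contDiff_snd.add (hφ.comp contDiff_fst))).sub (hΦ.comp contDiff_snd)
  have key := integral_fderiv_comp_eq_sub hτ hα ha hΨ
  have hend : Ψ (τ, a τ) - Ψ (0, a 0) = 0 := by simp [Ψ, h0, h1]
  rw [hend] at key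
  rw [← key]
  congr 1
  ext s
  have hd1 : HasFDerivAt (fun z : ℝ × Vec N => z.2 + φ z.1)
      (ContinuousLinearMap.snd ℝ ℝ (Vec N) +
        (ContinuousLinearMap.toSpanSingleton ℝ (φ' s)).comp (ContinuousLinearMap.fst ℝ ℝ (Vec N)))
      (s, a s) :=
    hasFDerivAt_snd.add ((hφ' s).hasFDerivAt.comp (s, a s) hasFDerivAt_fst)
  have hd2 : HasFDerivAt Ψ _ (s, a s) :=
    ((hasFDerivAt_norm_rpow_div hq (a s + φ s)).comp (s, a s) hd1).sub
    ((hasFDerivAt_norm_rpow_div hq (a s)).comp (s, a s) hasFDerivAt_snd)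
  rw [hd2.fderiv]
  simp only [ContinuousLinearMap.coe_comp, sub_apply, add_apply, Function.comp_apply,
    ContinuousLinearMap.coe_snd', ContinuousLinearMap.coe_fst',
    ContinuousLinearMap.toSpanSingleton_apply, innerSL_apply_apply, one_smul, inner_add_right,
    inner_sub_right]
  rw [real_inner_comm (α s), real_inner_comm (α s), real_inner_comm (φ' s)]
  ring

theorem integrable_inner_spow {X : Type*} [MeasurableSpace X] {μ : Measure X} (hq : 0 < q)
    {f g : X → Vec N} (hf : MemLp f (ENNReal.ofReal (q + 1)) μ)
    (hg : MemLp g (ENNReal.ofReal (q + 1)) μ) :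
    Integrable (fun x => inner ℝ (f x) (spow q (g x))) μ := by
  have hq1 : 0 < q + 1 := by linarith
  have hi : ∀ {f : X → Vec N}, MemLp f (ENNReal.ofReal (q + 1)) μ →
      Integrable (fun x => ‖f x‖ ^ (q + 1)) μ := fun hf => by
    have := hf.integrable_norm_rpow (by simpa using hq1) ENNReal.ofReal_ne_top
    rwa [ENNReal.toReal_ofReal hq1.le] at this
  refine Integrable.mono' ((hi hg).add (hi hf))
    (hf.1.inner ((continuous_spow hq).comp_aestronglyMeasurable hg.1)) (ae_of_all _ fun x => ?_)
  refine (norm_inner_le_norm _ _).trans ?_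
  rw [norm_spow hq, mul_comm]
  exact rpow_mul_le_add (norm_nonneg _) (norm_nonneg _) hq

theorem integrable_spow {X : Type*} [MeasurableSpace X] {μ : Measure X} [IsFiniteMeasure μ]
    (hq : 0 < q) {g : X → Vec N} (hg : MemLp g (ENNReal.ofReal (q + 1)) μ) :
    Integrable (fun x => spow q (g x)) μ := by
  have hq1 : 0 < q + 1 := by linarith
  have hi : Integrable (fun x => ‖g x‖ ^ (q + 1)) μ := by
    have := hg.integrable_norm_rpow (by simpa using hq1) ENNReal.ofReal_ne_top
    rwa [ENNReal.toReal_ofReal hq1.le] at this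
  refine Integrable.mono' (hi.add (integrable_const (1 : ℝ)))
    ((continuous_spow hq).comp_aestronglyMeasurable hg.1) (ae_of_all _ fun x => ?_)
  rw [norm_spow hq]
  simpa using rpow_mul_le_add (norm_nonneg (g x)) zero_le_one hq

end

/-! ### Approximation of the initial datum -/

/-- A smooth cutoff function. -/
theorem exists_isTestFun_eq_one {n : ℕ} {K S : Set (Vec n)} (hK : IsCompact K) (hS : IsOpen S)
    (hKS : K ⊆ S) :
    ∃ ζ : Vec n → ℝ, IsTestFun S ζ ∧ (∀ x ∈ K, ζ x = 1) ∧ ∀ x, ‖ζ x‖ ≤ 1 := by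
  obtain ⟨K', hK', hKK', hK'S⟩ := exists_compact_between hK hS hKS
  obtain ⟨f, hf0, hf1, hf⟩ := exists_contMDiffMap_zero_one_of_isClosed (n := (⊤ : ℕ∞))
    (I := modelWithCornersSelf ℝ (Vec n)) (s := (interior K')ᶜ) (t := K)
    isOpen_interior.isClosed_compl hK.isClosed (disjoint_left.2 fun x hx hxK => hx (hKK' hxK))
  have hsupp : tsupport f ⊆ K' := by
    refine closure_minimal (fun x hx => ?_) hK'.isClosed
    by_contra h
    exact hx (hf0 fun h' => h (interior_subset h'))
  refine ⟨f, ⟨f.contMDiff.contDiff, hK'.of_isClosed_subset (isClosed_tsupport _) hsupp,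
    hsupp.trans hK'S⟩, fun x hx => hf1 hx, fun x => ?_⟩
  rw [Real.norm_of_nonneg (hf x).1]
  exact (hf x).2

/-- Test functions are dense in `L^r(S)`. -/
theorem exists_isTestFun_eLpNorm_sub_le {n N : ℕ} {S : Set (Vec n)} (hS : IsOpen S)
    (hSfin : volume S ≠ ⊤) {r : ℝ} (hr : 1 ≤ r) {f : Vec n → Vec N}
    (hf : MemLp f (ENNReal.ofReal r) (volume.restrict S)) {ε : ℝ} (hε : 0 < ε) :
    ∃ χ : Vec n → Vec N, IsTestFun S χ ∧
      eLpNorm (fun x => f x - χ x) (ENNReal.ofReal r) (volume.restrict S) ≤ ENNReal.ofReal ε := by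
  have hr1 : 1 ≤ ENNReal.ofReal r := by simpa using hr
  obtain ⟨f', hf'm, hff'⟩ := hf.1
  have hf' : MemLp f' (ENNReal.ofReal r) (volume.restrict S) := hf.ae_eq hff'
  obtain ⟨δ, hδ, hδf⟩ := hf'.eLpNorm_indicator_le_of_meas hr1 ENNReal.ofReal_ne_top hf'm
    (half_pos hε)
  obtain ⟨K, hKS, hK, hKδ⟩ := hS.measurableSet.exists_isCompact_sdiff_lt hSfin
    (ENNReal.ofReal_pos.2 hδ).ne'
  have hKm := hK.measurableSet
  obtain ⟨g, hgc, hg, hgf⟩ := (hf'.indicator hKm).exist_eLpNorm_sub_le ENNReal.ofReal_ne_top hr1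
    (half_pos hε)
  obtain ⟨ζ, hζ, hζ1, hζb⟩ := exists_isTestFun_eq_one hK hS hKS
  refine ⟨fun x => ζ x • g x, ⟨hζ.smooth.smul hg, hζ.compact.smul_right,
    (tsupport_smul_subset_left ζ g).trans hζ.support⟩, ?_⟩
  have hfar : eLpNorm (Kᶜ.indicator f') (ENNReal.ofReal r) (volume.restrict S)
      ≤ ENNReal.ofReal (ε / 2) := by
    refine hδf Kᶜ hKm.compl ?_
    rw [Measure.restrict_apply hKm.compl, inter_comm, ← sdiff_eq]
    exact hKδ.le
  have hsplit : ∀ x, f' x - ζ x • g x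
      = Kᶜ.indicator f' x + ζ x • (K.indicator f' x - g x) := by
    intro x
    by_cases hx : x ∈ K
    · simp [hx, hζ1 x hx]
    · simp [hx, sub_eq_add_neg]
  calc eLpNorm (fun x => f x - ζ x • g x) (ENNReal.ofReal r) (volume.restrict S)
      = eLpNorm (Kᶜ.indicator f' + fun x => ζ x • (K.indicator f' x - g x)) (ENNReal.ofReal r)
          (volume.restrict S) := by
        refine eLpNorm_congr_ae ?_
        filter_upwards [hff'] with x hx
        rw [hx, hsplit, Pi.add_apply]
    _ ≤ ENNReal.ofReal (ε / 2) + ENNReal.ofReal (ε / 2) := by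
        refine (eLpNorm_add_le (hf'm.indicator hKm.compl).aestronglyMeasurable
          ((hζ.contDiff_one.continuous.stronglyMeasurable.smul
            ((hf'm.indicator hKm).sub hg.continuous.stronglyMeasurable)).aestronglyMeasurable)
          hr1).trans (add_le_add hfar ?_)
        refine (eLpNorm_mono fun x => ?_).trans hgf
        rw [Pi.smul_apply', norm_smul]
        exact mul_le_of_le_one_left (norm_nonneg _) (hζb x)
    _ = ENNReal.ofReal ε := by
        rw [← ENNReal.ofReal_add (half_pos hε).le (half_pos hε).le, add_halves]

/-- The initial datum can be approximated by admissible data `u_* + χ` in such a way that the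
boundary term at time zero becomes arbitrarily small. -/
theorem exists_isTestFun_integral_bterm_le {n N : ℕ} {S : Set (Vec n)} (hS : IsOpen S)
    (hSfin : volume S ≠ ⊤) {q : ℝ} (hq : 0 < q) {uo us : Vec n → Vec N}
    (huo : MemLp uo (ENNReal.ofReal (q + 1)) (volume.restrict S))
    (hus : MemLp us (ENNReal.ofReal (q + 1)) (volume.restrict S)) {η : ℝ} (hη : 0 < η) :
    ∃ χ : Vec n → Vec N, IsTestFun S χ ∧ ∫ x in S, bterm q (uo x) (us x + χ x) ≤ η := by
  have hq1 : 0 < q + 1 := by linarith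
  have hint : ∀ {g : Vec n → Vec N}, MemLp g (ENNReal.ofReal (q + 1)) (volume.restrict S) →
      IntegrableOn (fun x => ‖g x‖ ^ (q + 1)) S := fun hg => by
    have := hg.integrable_norm_rpow (by simpa using hq1) ENNReal.ofReal_ne_top
    rwa [ENNReal.toReal_ofReal hq1.le] at this
  set A := ∫ x in S, ‖uo x‖ ^ (q + 1) with hA
  have hA0 : 0 ≤ A := integral_nonneg fun x => by positivity
  obtain ⟨C, hC0, hC⟩ := exists_bterm_le (N := N) hq (δ := η / 2 / (A + 1)) (by positivity)
  obtain ⟨ε, hε, hεC⟩ : ∃ ε : ℝ, 0 < ε ∧ C * ε ^ (q + 1) ≤ η / 2 := by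
    refine ⟨(η / 2 / (C + 1)) ^ (1 / (q + 1)), by positivity, ?_⟩
    rw [← Real.rpow_mul (by positivity), one_div_mul_cancel hq1.ne', Real.rpow_one]
    rw [mul_div_assoc', div_le_iff₀ (by positivity)]
    nlinarith
  obtain ⟨χ, hχ, hχε⟩ := exists_isTestFun_eLpNorm_sub_le hS hSfin (by linarith : 1 ≤ q + 1)
    (huo.sub hus) hε
  refine ⟨χ, hχ, ?_⟩
  have hχL : MemLp χ (ENNReal.ofReal (q + 1)) (volume.restrict S) :=
    hχ.contDiff_one.continuous.memLp_of_hasCompactSupport hχ.compact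
  have hdiff : MemLp (fun x => us x + χ x - uo x) (ENNReal.ofReal (q + 1)) (volume.restrict S) :=
    (hus.add hχL).sub huo
  have hsmall : ∫ x in S, ‖us x + χ x - uo x‖ ^ (q + 1) ≤ ε ^ (q + 1) := by
    have h1 : eLpNorm (fun x => us x + χ x - uo x) (ENNReal.ofReal (q + 1)) (volume.restrict S)
        ≤ ENNReal.ofReal ε := by
      refine le_trans (le_of_eq ?_) hχε
      refine eLpNorm_congr_norm_ae (ae_of_all _ fun x => ?_)
      rw [← norm_neg, Pi.sub_apply]
      congr 1
      abel
    have h2 := ENNReal.rpow_le_rpow h1 hq1.le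
    rw [eLpNorm_ofReal_rpow hq1, ENNReal.ofReal_rpow_of_nonneg hε.le hq1.le] at h2
    rw [integral_eq_lintegral_of_nonneg_ae (ae_of_all _ fun x => by positivity)
      (hint hdiff).aestronglyMeasurable]
    refine ENNReal.toReal_le_of_le_ofReal (by positivity) (le_trans (le_of_eq ?_) h2)
    refine lintegral_congr fun x => ?_
    rw [← ENNReal.ofReal_rpow_of_nonneg (norm_nonneg _) hq1.le, ofReal_norm]
  calc ∫ x in S, bterm q (uo x) (us x + χ x)
      ≤ ∫ x in S, (η / 2 / (A + 1) * ‖uo x‖ ^ (q + 1) + C * ‖us x + χ x - uo x‖ ^ (q + 1)) :=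
        integral_mono_of_nonneg (ae_of_all _ fun x => bterm_nonneg hq _ _)
          (((hint huo).const_mul _).add ((hint hdiff).const_mul _)) (ae_of_all _ fun x => hC _ _)
    _ = η / 2 / (A + 1) * A + C * ∫ x in S, ‖us x + χ x - uo x‖ ^ (q + 1) := by
        rw [integral_add ((hint huo).const_mul _) ((hint hdiff).const_mul _),
          integral_const_mul, integral_const_mul]
    _ ≤ η / 2 + η / 2 := by
        refine add_le_add ?_ ((mul_le_mul_of_nonneg_left hsmall hC0).trans hεC)
        rw [div_mul_eq_mul_div, div_le_iff₀ (by positivity)]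
        nlinarith
    _ = η := add_halves η

/-! ### Stability of the energy under perturbations -/

section

variable {n N : ℕ}

theorem volume_restrict_cyl (Ω : Set (Vec n)) (T : ℝ) :
    (volume : Measure (Vec n × ℝ)).restrict (cyl Ω T)
      = (volume.restrict Ω).prod (volume.restrict (Ico 0 T)) := by
  rw [cyl, Measure.volume_eq_prod, Measure.prod_restrict]

theorem ae_cyl_of_ae {Ω : Set (Vec n)} (T : ℝ) {P : Vec n → Prop}
    (h : ∀ᵐ x ∂(volume.restrict Ω), P x) :
    ∀ᵐ z ∂((volume : Measure (Vec n × ℝ)).restrict (cyl Ω T)), P z.1 := by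
  rw [volume_restrict_cyl]
  exact Measure.quasiMeasurePreserving_fst.ae h

/-- A convex function of `p`-growth increases little under small perturbations: write the perturbed
point `w + e` as a convex combination of `w` and `w + ε⁻¹ e` with a small weight `ε`. -/
theorem convex_perturbation_le {A B : Type*} [NormedAddCommGroup A] [NormedSpace ℝ A]
    [NormedAddCommGroup B] [NormedSpace ℝ B] {F : A × B → ℝ} (hF : ConvexOn ℝ univ F)
    {p L g : ℝ} (hp : 0 ≤ p) (hL : 0 ≤ L) (hF0 : ∀ y, 0 ≤ F y)
    (hFg : ∀ y : A × B, F y ≤ L * (‖y.2‖ ^ p + ‖y.1‖ ^ p + g)) {ε : ℝ} (hε : 0 < ε) (hε1 : ε ≤ 1)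
    (w e : A × B) :
    F (w + e) ≤ F w + (ε * (L * (2 * (2 * ‖w‖) ^ p + |g|))
      + ε * (L * 2 * (2 * ε⁻¹) ^ p) * ‖e‖ ^ p) := by
  have h1 : w + e = (1 - ε) • w + ε • (w + ε⁻¹ • e) := by
    rw [smul_add, smul_smul, mul_inv_cancel₀ hε.ne']
    module
  have h2 := hF.2 (mem_univ w) (mem_univ (w + ε⁻¹ • e)) (by linarith : 0 ≤ 1 - ε) hε.le (by ring)
  rw [← h1] at h2
  have h3 : F (w + ε⁻¹ • e) ≤ L * (2 * ((2 * ‖w‖) ^ p + (2 * (ε⁻¹ * ‖e‖)) ^ p) + |g|) := by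
    refine (hFg _).trans (mul_le_mul_of_nonneg_left ?_ hL)
    have hn : ‖w + ε⁻¹ • e‖ ^ p ≤ (2 * ‖w‖) ^ p + (2 * (ε⁻¹ * ‖e‖)) ^ p := by
      refine le_trans (Real.rpow_le_rpow (norm_nonneg _) ?_ hp)
        (add_rpow_le_two_mul_rpow (norm_nonneg _) (by positivity) hp)
      refine (norm_add_le _ _).trans ?_
      rw [norm_smul, Real.norm_of_nonneg (by positivity)]
    have hn1 := Real.rpow_le_rpow (norm_nonneg _) (norm_fst_le (w + ε⁻¹ • e)) hp
    have hn2 := Real.rpow_le_rpow (norm_nonneg _) (norm_snd_le (w + ε⁻¹ • e)) hp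
    linarith [le_abs_self g]
  have h4 : (2 * (ε⁻¹ * ‖e‖)) ^ p = (2 * ε⁻¹) ^ p * ‖e‖ ^ p := by
    rw [← mul_assoc, Real.mul_rpow (by positivity) (norm_nonneg _)]
  rw [h4] at h3
  simp only [smul_eq_mul] at h2
  have h5 := mul_le_mul_of_nonneg_left h3 hε.le
  have h6 := mul_nonneg hε.le (hF0 w)
  linarith

/-- Upper semicontinuity of the energy in `L^p`, at a fixed pair `(w, Dw)`. The measurability of
`f(x,w,Dw)` plays no role, because the other summands of the pointwise bound are measurable. -/
theorem exists_forall_energy_le {p ν L T : ℝ} (hp : 1 < p) (hL : 0 ≤ L) {Ω : Set (Vec n)}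
    {E : Set (Vec n × ℝ)} (hE : MeasurableSet E) (hEcyl : E ⊆ cyl Ω T)
    {f : Vec n → Vec N → Mat N n → ℝ} (hf : IsIntegrand p ν Ω f)
    {G : Vec n → ℝ} (hG : IntegrableOn G Ω) (hfG : HasPGrowth p L G Ω f)
    {w : Vec n × ℝ → Vec N} {Dw : Vec n × ℝ → Mat N n}
    (hw : MemLp (fun z => (w z, Dw z)) (ENNReal.ofReal p) (volume.restrict (cyl Ω T)))
    {η : ℝ} (hη : 0 < η) :
    ∃ δ : ℝ≥0∞, 0 < δ ∧ ∀ (v : Vec n × ℝ → Vec N) (Dv : Vec n × ℝ → Mat N n),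
      AEStronglyMeasurable (fun z => (v z, Dv z)) (volume.restrict (cyl Ω T)) →
      ∫⁻ z in cyl Ω T, ‖(v z - w z, Dv z - Dw z)‖ₑ ^ p ≤ δ →
      energy f E v Dv ≤ energy f E w Dw + ENNReal.ofReal η := by
  have hp0 : 0 < p := by linarith
  have hwi : Integrable (fun z => ‖(w z, Dw z)‖ ^ p) (volume.restrict (cyl Ω T)) := by
    have := hw.integrable_norm_rpow (by simpa using hp0) ENNReal.ofReal_ne_top
    rwa [ENNReal.toReal_ofReal hp0.le] at this
  let B : Vec n × ℝ → ℝ := fun z => L * (2 * (2 * ‖(w z, Dw z)‖) ^ p + |G z.1|)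
  have hBi : Integrable B (volume.restrict (cyl Ω T)) := by
    refine ((Integrable.const_mul ?_ 2).add ?_).const_mul L
    · refine (hwi.const_mul (2 ^ p)).congr (ae_of_all _ fun z => ?_)
      simp only
      rw [Real.mul_rpow (by norm_num) (norm_nonneg _)]
    · rw [volume_restrict_cyl]
      exact (hG.comp_fst _).norm
  have hB0 : ∀ z, 0 ≤ B z := fun z => by positivity
  set β := ∫ z in cyl Ω T, B z with hβ
  have hβ0 : 0 ≤ β := integral_nonneg hB0
  set ε : ℝ := min 1 (η / 2 / (β + 1)) with hε
  have hε0 : 0 < ε := lt_min one_pos (by positivity)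
  set c : ℝ := ε * (L * 2 * (2 * ε⁻¹) ^ p) with hc
  have hc0 : 0 ≤ c := by positivity
  refine ⟨ENNReal.ofReal (η / 2 / (c + 1)), ENNReal.ofReal_pos.2 (by positivity),
    fun v Dv hv hvδ => ?_⟩
  have hem : AEStronglyMeasurable (fun z => (v z - w z, Dv z - Dw z))
      (volume.restrict (cyl Ω T)) := hv.sub hw.1
  have hrestr : (volume : Measure (Vec n × ℝ)).restrict E ≤ volume.restrict (cyl Ω T) :=
    Measure.restrict_mono hEcyl le_rfl
  have hpt : ∀ᵐ z ∂(volume.restrict E), ENNReal.ofReal (f z.1 (v z) (Dv z))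
      ≤ ENNReal.ofReal (f z.1 (w z) (Dw z)) + (ENNReal.ofReal ε * ENNReal.ofReal (B z)
        + ENNReal.ofReal c * ‖(v z - w z, Dv z - Dw z)‖ₑ ^ p) := by
    have h1 := ae_mono hrestr (ae_cyl_of_ae T hf.convex)
    have h2 := ae_mono hrestr (ae_cyl_of_ae T hfG)
    filter_upwards [h1, h2, ae_restrict_mem hE] with z hz1 hz2 hzE
    have hzΩ : z.1 ∈ Ω := (hEcyl hzE).1
    have key := convex_perturbation_le hz1 hp0.le hL (fun y => hf.nonneg z.1 hzΩ y.1 y.2)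
      (fun y => hz2 y.1 y.2) hε0 (min_le_left _ _) (w z, Dw z) (v z - w z, Dv z - Dw z)
    simp only [Prod.mk_add_mk, add_sub_cancel] at key
    refine (ENNReal.ofReal_le_ofReal key).trans (le_of_eq ?_)
    have hn : ‖(v z - w z, Dv z - Dw z)‖ₑ ^ p
        = ENNReal.ofReal (‖(v z - w z, Dv z - Dw z)‖ ^ p) := by
      rw [← ENNReal.ofReal_rpow_of_nonneg (norm_nonneg _) hp0.le, ofReal_norm]
    rw [ENNReal.ofReal_add (hf.nonneg z.1 hzΩ _ _)
        (add_nonneg (mul_nonneg hε0.le (hB0 z)) (by positivity)),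
      ENNReal.ofReal_add (mul_nonneg hε0.le (hB0 z)) (by positivity), ENNReal.ofReal_mul hε0.le,
      ENNReal.ofReal_mul hc0, hn]
  have hm1 : AEMeasurable (fun z => ENNReal.ofReal ε * ENNReal.ofReal (B z))
      (volume.restrict E) :=
    (hBi.aestronglyMeasurable.mono_measure hrestr).aemeasurable.ennreal_ofReal.const_mul _
  have hm2 : AEMeasurable (fun z => ENNReal.ofReal c * ‖(v z - w z, Dv z - Dw z)‖ₑ ^ p)
      (volume.restrict E) :=
    ((hem.mono_measure hrestr).enorm.pow_const p).const_mul _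
  have hm12 : AEMeasurable (fun z => ENNReal.ofReal ε * ENNReal.ofReal (B z)
      + ENNReal.ofReal c * ‖(v z - w z, Dv z - Dw z)‖ₑ ^ p) (volume.restrict E) := hm1.add hm2
  have hi1 : ∫⁻ z in E, ENNReal.ofReal ε * ENNReal.ofReal (B z) ≤ ENNReal.ofReal (η / 2) := by
    calc ∫⁻ z in E, ENNReal.ofReal ε * ENNReal.ofReal (B z)
        ≤ ∫⁻ z in cyl Ω T, ENNReal.ofReal ε * ENNReal.ofReal (B z) := lintegral_mono' hrestr le_rfl
      _ = ENNReal.ofReal ε * ENNReal.ofReal β := by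
          rw [lintegral_const_mul' _ _ ENNReal.ofReal_ne_top, hβ,
            ofReal_integral_eq_lintegral_ofReal hBi (ae_of_all _ hB0)]
      _ ≤ ENNReal.ofReal (η / 2) := by
          rw [← ENNReal.ofReal_mul hε0.le]
          refine ENNReal.ofReal_le_ofReal ?_
          have h1 : ε * β ≤ η / 2 / (β + 1) * β :=
            mul_le_mul_of_nonneg_right (min_le_right _ _) hβ0
          refine h1.trans ?_
          rw [div_mul_eq_mul_div, div_le_iff₀ (by positivity)]
          nlinarith
  have hi2 : ∫⁻ z in E, ENNReal.ofReal c * ‖(v z - w z, Dv z - Dw z)‖ₑ ^ p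
      ≤ ENNReal.ofReal (η / 2) := by
    calc ∫⁻ z in E, ENNReal.ofReal c * ‖(v z - w z, Dv z - Dw z)‖ₑ ^ p
        ≤ ∫⁻ z in cyl Ω T, ENNReal.ofReal c * ‖(v z - w z, Dv z - Dw z)‖ₑ ^ p :=
          lintegral_mono' hrestr le_rfl
      _ ≤ ENNReal.ofReal c * ENNReal.ofReal (η / 2 / (c + 1)) := by
          rw [lintegral_const_mul' _ _ ENNReal.ofReal_ne_top]
          gcongr
      _ ≤ ENNReal.ofReal (η / 2) := by
          rw [← ENNReal.ofReal_mul hc0]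
          refine ENNReal.ofReal_le_ofReal ?_
          rw [mul_div_assoc', div_le_iff₀ (by positivity)]
          nlinarith
  calc energy f E v Dv
      ≤ ∫⁻ z in E, (ENNReal.ofReal (f z.1 (w z) (Dw z)) + (ENNReal.ofReal ε * ENNReal.ofReal (B z)
        + ENNReal.ofReal c * ‖(v z - w z, Dv z - Dw z)‖ₑ ^ p)) := lintegral_mono_ae hpt
    _ = energy f E w Dw + ((∫⁻ z in E, ENNReal.ofReal ε * ENNReal.ofReal (B z))
        + ∫⁻ z in E, ENNReal.ofReal c * ‖(v z - w z, Dv z - Dw z)‖ₑ ^ p) := by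
        rw [lintegral_add_right' _ hm12, lintegral_add_right' _ hm2, energy]
    _ ≤ energy f E w Dw + (ENNReal.ofReal (η / 2) + ENNReal.ofReal (η / 2)) := by gcongr
    _ = energy f E w Dw + ENNReal.ofReal η := by
        rw [← ENNReal.ofReal_add (half_pos hη).le (half_pos hη).le, add_halves]

end

/-! ### Maps with an integrable time derivative -/

section

variable {n N : ℕ}

theorem hasDerivAt_timeDeriv {F : Type*} [NormedAddCommGroup F] [NormedSpace ℝ F]
    {φ : Vec n × ℝ → F} (hφ : ContDiff ℝ 1 φ) (x : Vec n) (t : ℝ) :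
    HasDerivAt (fun t => φ (x, t)) (timeDeriv φ (x, t)) t := by
  have h : DifferentiableAt ℝ (fun t => φ (x, t)) t :=
    (hφ.differentiable one_ne_zero (x, t)).comp t
      ((differentiableAt_const x).prodMk differentiableAt_id)
  exact h.hasDerivAt

theorem timeDeriv_eq_fderiv {F : Type*} [NormedAddCommGroup F] [NormedSpace ℝ F]
    {φ : Vec n × ℝ → F} (hφ : ContDiff ℝ 1 φ) (z : Vec n × ℝ) :
    timeDeriv φ z = fderiv ℝ φ z (0, 1) := by
  have h := (hφ.differentiable one_ne_zero z).hasFDerivAt.comp_hasDerivAt z.2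
    ((hasDerivAt_const z.2 z.1).prodMk (hasDerivAt_id z.2))
  exact h.deriv

theorem continuous_timeDeriv {F : Type*} [NormedAddCommGroup F] [NormedSpace ℝ F]
    {φ : Vec n × ℝ → F} (hφ : ContDiff ℝ 1 φ) : Continuous (timeDeriv φ) := by
  have : timeDeriv φ = fun z => fderiv ℝ φ z (0, 1) := funext (timeDeriv_eq_fderiv hφ)
  rw [this]
  exact (hφ.continuous_fderiv one_ne_zero).clm_apply continuous_const

theorem spaceGrad_apply_eq_fderiv {φ : Vec n × ℝ → Vec N} (hφ : ContDiff ℝ 1 φ)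
    (z : Vec n × ℝ) (i : Fin N) (j : Fin n) :
    spaceGrad φ z (i, j) = fderiv ℝ φ z (EuclideanSpace.single j 1, 0) i := by
  have hin : HasFDerivAt (fun x : Vec n => (x, z.2))
      ((ContinuousLinearMap.id ℝ (Vec n)).prod 0) z.1 :=
    (hasFDerivAt_id z.1).prodMk (hasFDerivAt_const z.2 z.1)
  have h := (hφ.differentiable one_ne_zero z).hasFDerivAt.comp z.1 hin
  have h' : fderiv ℝ (fun x => φ (x, z.2)) z.1 = _ := h.fderiv
  simp only [spaceGrad, jac]
  rw [h']
  rfl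

theorem continuous_spaceGrad {φ : Vec n × ℝ → Vec N} (hφ : ContDiff ℝ 1 φ) :
    Continuous (spaceGrad φ) := by
  have : spaceGrad φ = fun z => WithLp.toLp 2 fun ij : Fin N × Fin n =>
      fderiv ℝ φ z (EuclideanSpace.single ij.2 1, 0) ij.1 := by
    ext z ij
    exact spaceGrad_apply_eq_fderiv hφ z ij.1 ij.2
  rw [this]
  refine (PiLp.continuous_toLp 2 _).comp (continuous_pi fun ij => ?_)
  have h2 : Continuous fun z => fderiv ℝ φ z (EuclideanSpace.single ij.2 1, 0) :=
    (hφ.continuous_fderiv one_ne_zero).clm_apply continuous_const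
  exact (EuclideanSpace.proj (𝕜 := ℝ) ij.1).continuous.comp h2

theorem enorm_integral_rpow_le_measure_univ {X F : Type*} [MeasurableSpace X]
    [NormedAddCommGroup F] [NormedSpace ℝ F] {μ : Measure X} {r : ℝ} (hr : 1 ≤ r) {f : X → F}
    (hf : AEStronglyMeasurable f μ) :
    ‖∫ x, f x ∂μ‖ₑ ^ r ≤ μ univ ^ (r - 1) * ∫⁻ x, ‖f x‖ₑ ^ r ∂μ := by
  have hr0 : 0 < r := by linarith
  have h1 : ‖∫ x, f x ∂μ‖ₑ ≤ eLpNorm f (ENNReal.ofReal r) μ * μ univ ^ (1 - 1 / r) := by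
    refine (enorm_integral_le_lintegral_enorm _).trans ?_
    rw [← eLpNorm_one_eq_lintegral_enorm]
    have := eLpNorm_le_eLpNorm_mul_rpow_measure_univ (p := 1) (q := ENNReal.ofReal r)
      (by simpa using hr) hf
    simpa [ENNReal.toReal_ofReal hr0.le] using this
  refine (ENNReal.rpow_le_rpow h1 hr0.le).trans (le_of_eq ?_)
  rw [ENNReal.mul_rpow_of_nonneg _ _ hr0.le, eLpNorm_ofReal_rpow hr0, ← ENNReal.rpow_mul, mul_comm]
  congr 2
  field_simp

theorem isFiniteMeasure_restrict_cyl {Ω : Set (Vec n)} [IsFiniteMeasure (volume.restrict Ω)]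
    (T : ℝ) : IsFiniteMeasure ((volume : Measure (Vec n × ℝ)).restrict (cyl Ω T)) := by
  rw [volume_restrict_cyl]
  infer_instance

variable {Ω : Set (Vec n)} {T : ℝ} {v dv : Vec n × ℝ → Vec N}

theorem sub_eq_integral_of_primitive
    (hint : ∀ x, IntervalIntegrable (fun t => dv (x, t)) volume 0 T)
    (hv : ∀ x, ∀ t ∈ Icc 0 T, v (x, t) = v (x, 0) + ∫ s in (0 : ℝ)..t, dv (x, s))
    {s t : ℝ} (hs : s ∈ Icc 0 T) (ht : t ∈ Icc 0 T) (x : Vec n) :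
    v (x, t) - v (x, s) = ∫ r in s..t, dv (x, r) := by
  have h0 : (0 : ℝ) ∈ Icc 0 T := ⟨le_rfl, hs.1.trans hs.2⟩
  rw [hv x t ht, hv x s hs, add_sub_add_left_eq_sub,
    intervalIntegral.integral_interval_sub_left (intervalIntegrable_of_mem_Icc (hint x) h0 ht)
      (intervalIntegrable_of_mem_Icc (hint x) h0 hs)]

theorem restrict_prod_Ioc_le {s t : ℝ} (hs : 0 ≤ s) (ht : t < T) :
    (volume.restrict Ω).prod (volume.restrict (Ioc s t))
      ≤ (volume : Measure (Vec n × ℝ)).restrict (cyl Ω T) := by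
  rw [volume_restrict_cyl]
  refine Measure.prod_mono le_rfl (Measure.restrict_mono (fun r hr => ?_) le_rfl)
  exact ⟨hs.trans hr.1.le, hr.2.trans_lt ht⟩

/-- Hölder continuity in time, in integrated form. -/
theorem lintegral_sub_rpow_le_of_primitive
    (hint : ∀ x, IntervalIntegrable (fun t => dv (x, t)) volume 0 T)
    (hv : ∀ x, ∀ t ∈ Icc 0 T, v (x, t) = v (x, 0) + ∫ s in (0 : ℝ)..t, dv (x, s))
    (hdv : AEStronglyMeasurable dv (volume.restrict (cyl Ω T))) {r : ℝ} (hr : 1 ≤ r)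
    {s t : ℝ} (hs : s ∈ Ico 0 T) (ht : t ∈ Ico 0 T) :
    ∫⁻ x in Ω, ‖v (x, t) - v (x, s)‖ₑ ^ r
      ≤ ENNReal.ofReal |t - s| ^ (r - 1) * ∫⁻ z in cyl Ω T, ‖dv z‖ₑ ^ r := by
  wlog hst : s ≤ t generalizing s t
  · have h := this ht hs (le_of_not_ge hst)
    rw [abs_sub_comm] at h
    refine le_trans (le_of_eq ?_) h
    refine lintegral_congr fun x => ?_
    rw [← enorm_neg, neg_sub]
  have hm := hdv.mono_measure (restrict_prod_Ioc_le (Ω := Ω) hs.1 ht.2)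
  calc ∫⁻ x in Ω, ‖v (x, t) - v (x, s)‖ₑ ^ r
      ≤ ∫⁻ x in Ω, ENNReal.ofReal |t - s| ^ (r - 1) * ∫⁻ y in Ioc s t, ‖dv (x, y)‖ₑ ^ r := by
        refine lintegral_mono fun x => ?_
        rw [sub_eq_integral_of_primitive hint hv (Ico_subset_Icc_self hs) (Ico_subset_Icc_self ht),
          intervalIntegral.integral_of_le hst]
        have hx : AEStronglyMeasurable (fun y => dv (x, y)) (volume.restrict (Ioc s t)) :=
          (intervalIntegrable_of_mem_Icc (hint x) (Ico_subset_Icc_self hs)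
            (Ico_subset_Icc_self ht)).1.aestronglyMeasurable
        refine (enorm_integral_rpow_le_measure_univ hr hx).trans (le_of_eq ?_)
        rw [Measure.restrict_apply_univ, Real.volume_Ioc, abs_of_nonneg (by linarith)]
    _ = ENNReal.ofReal |t - s| ^ (r - 1) * ∫⁻ x in Ω, ∫⁻ y in Ioc s t, ‖dv (x, y)‖ₑ ^ r := by
        rw [lintegral_const_mul' _ _
          (ENNReal.rpow_ne_top_of_nonneg (by linarith) ENNReal.ofReal_ne_top)]
    _ ≤ ENNReal.ofReal |t - s| ^ (r - 1) * ∫⁻ z in cyl Ω T, ‖dv z‖ₑ ^ r := by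
        gcongr
        rw [← lintegral_prod (μ := volume.restrict Ω) (ν := volume.restrict (Ioc s t))
          (fun z => ‖dv z‖ₑ ^ r) (hm.enorm.pow_const r)]
        exact lintegral_mono' (restrict_prod_Ioc_le hs.1 ht.2) le_rfl

/-- The slice at time zero is measurable by assumption, and the increments are integrals of `dv`. -/
theorem memLp_slice_of_primitive
    (hint : ∀ x, IntervalIntegrable (fun t => dv (x, t)) volume 0 T)
    (hv : ∀ x, ∀ t ∈ Icc 0 T, v (x, t) = v (x, 0) + ∫ s in (0 : ℝ)..t, dv (x, s))
    {r : ℝ} (hr : 1 ≤ r) (hdv : MemLp dv (ENNReal.ofReal r) (volume.restrict (cyl Ω T)))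
    (hv0 : MemLp (fun x => v (x, 0)) (ENNReal.ofReal r) (volume.restrict Ω))
    {t : ℝ} (ht : t ∈ Ico 0 T) :
    MemLp (fun x => v (x, t)) (ENNReal.ofReal r) (volume.restrict Ω) := by
  have hr0 : 0 < r := by linarith
  have h0 : (0 : ℝ) ∈ Ico 0 T := ⟨le_rfl, ht.1.trans_lt ht.2⟩
  have hm : AEStronglyMeasurable (fun x => v (x, t) - v (x, 0)) (volume.restrict Ω) := by
    have h1 := (hdv.1.mono_measure (restrict_prod_Ioc_le (Ω := Ω) le_rfl ht.2)).integral_prod_right'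
    refine h1.congr (ae_of_all _ fun x => ?_)
    simp only
    rw [sub_eq_integral_of_primitive hint hv (Ico_subset_Icc_self h0) (Ico_subset_Icc_self ht),
      intervalIntegral.integral_of_le ht.1]
  have hd : MemLp (fun x => v (x, t) - v (x, 0)) (ENNReal.ofReal r) (volume.restrict Ω) := by
    rw [memLp_ofReal_iff hr0 hm]
    refine (lintegral_sub_rpow_le_of_primitive hint hv hdv.1 hr h0 ht).trans_lt ?_
    refine ENNReal.mul_lt_top
      (ENNReal.rpow_lt_top_of_nonneg (by linarith) ENNReal.ofReal_ne_top) ?_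
    exact (memLp_ofReal_iff hr0 hdv.1).1 hdv
  refine (hd.add hv0).ae_eq (ae_of_all _ fun x => ?_)
  simp

theorem tendsto_eLpNorm_sub_of_primitive
    (hint : ∀ x, IntervalIntegrable (fun t => dv (x, t)) volume 0 T)
    (hv : ∀ x, ∀ t ∈ Icc 0 T, v (x, t) = v (x, 0) + ∫ s in (0 : ℝ)..t, dv (x, s))
    {r : ℝ} (hr : 1 < r) (hdv : MemLp dv (ENNReal.ofReal r) (volume.restrict (cyl Ω T)))
    {t₀ : ℝ} (ht₀ : t₀ ∈ Ico 0 T) :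
    Tendsto (fun t => eLpNorm (fun x => v (x, t) - v (x, t₀)) (ENNReal.ofReal r)
      (volume.restrict Ω)) (𝓝[Ico 0 T] t₀) (𝓝 0) := by
  have hr0 : 0 < r := by linarith
  set A := ∫⁻ z in cyl Ω T, ‖dv z‖ₑ ^ r with hA
  have hAt : A ≠ ⊤ := ((memLp_ofReal_iff hr0 hdv.1).1 hdv).ne
  have hlim : Tendsto (fun t : ℝ => (ENNReal.ofReal |t - t₀| ^ (r - 1) * A) ^ (1 / r))
      (𝓝[Ico 0 T] t₀) (𝓝 0) := by
    have h1 : Tendsto (fun t : ℝ => ENNReal.ofReal |t - t₀|) (𝓝[Ico 0 T] t₀) (𝓝 0) := by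
      have : Continuous fun t : ℝ => ENNReal.ofReal |t - t₀| :=
        ENNReal.continuous_ofReal.comp (by fun_prop)
      have h := (this.tendsto t₀).mono_left (nhdsWithin_le_nhds (s := Ico 0 T))
      simpa using h
    have h2 := ((ENNReal.continuous_rpow_const (y := r - 1)).tendsto 0).comp h1
    rw [ENNReal.zero_rpow_of_pos (by linarith)] at h2
    have h3 := ENNReal.Tendsto.mul_const h2 (Or.inr hAt)
    rw [zero_mul] at h3
    have h4 := ((ENNReal.continuous_rpow_const (y := 1 / r)).tendsto 0).comp h3
    rwa [ENNReal.zero_rpow_of_pos (by positivity)] at h4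
  refine tendsto_of_tendsto_of_tendsto_of_le_of_le' tendsto_const_nhds hlim
    (Eventually.of_forall fun _ => zero_le) ?_
  filter_upwards [self_mem_nhdsWithin] with t ht
  rw [eLpNorm_ofReal_eq hr0]
  exact ENNReal.rpow_le_rpow
    (lintegral_sub_rpow_le_of_primitive hint hv hdv.1 hr.le ht₀ ht) (by positivity)

/-- Integration by parts on every line in the time direction. -/
theorem hasWeakTimeDeriv_of_primitive [IsFiniteMeasure (volume.restrict Ω)] (hT : 0 < T)
    (hint : ∀ x, IntervalIntegrable (fun t => dv (x, t)) volume 0 T)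
    (hv : ∀ x, ∀ t ∈ Icc 0 T, v (x, t) = v (x, 0) + ∫ s in (0 : ℝ)..t, dv (x, s))
    (hvi : Integrable v (volume.restrict (cyl Ω T)))
    (hdvi : Integrable dv (volume.restrict (cyl Ω T))) : HasWeakTimeDeriv Ω T v dv := by
  intro η hη
  have hη1 := hη.contDiff_one
  have htd : Continuous (timeDeriv η) := continuous_timeDeriv hη1
  have htc : HasCompactSupport (timeDeriv η) := by
    have : timeDeriv η = fun z => fderiv ℝ η z (0, 1) := funext (timeDeriv_eq_fderiv hη1)
    rw [this]
    exact hη.compact.fderiv_apply ℝ _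
  obtain ⟨C₁, hC₁⟩ := htd.bounded_above_of_compact_support htc
  obtain ⟨C₂, hC₂⟩ := hη1.continuous.bounded_above_of_compact_support hη.compact
  have hi1 : Integrable (fun z => timeDeriv η z • v z) (volume.restrict (cyl Ω T)) :=
    hvi.bdd_smul C₁ htd.aestronglyMeasurable (ae_of_all _ hC₁)
  have hi2 : Integrable (fun z => η z • dv z) (volume.restrict (cyl Ω T)) :=
    hdvi.bdd_smul C₂ hη1.continuous.aestronglyMeasurable (ae_of_all _ hC₂)
  rw [← add_eq_zero_iff_eq_neg, ← integral_add hi1 hi2]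
  have hi : Integrable (fun z => timeDeriv η z • v z + η z • dv z)
      (volume.restrict (cyl Ω T)) := hi1.add hi2
  rw [volume_restrict_cyl] at hi ⊢
  rw [integral_prod _ hi]
  refine integral_eq_zero_of_ae (ae_of_all _ fun x => ?_)
  simp only [Pi.zero_apply]
  let Ψ : ℝ × Vec N → Vec N := fun z => η (x, z.1) • z.2
  have hηx : ContDiff ℝ 1 fun t => η (x, t) := hη1.comp (contDiff_const.prodMk contDiff_id)
  have hΨ : ContDiff ℝ 1 Ψ := (hηx.comp contDiff_fst).smul contDiff_snd
  have key := integral_fderiv_comp_eq_sub hT.le (hint x) (hv x) hΨ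
  have hend : ∀ t : ℝ, t ∉ Ioo 0 T → η (x, t) = 0 := fun t ht =>
    hη.eq_zero_of_notMem fun h => ht h.2
  simp only [Ψ, hend 0 (by simp), hend T (by simp), zero_smul, sub_zero] at key
  rw [integral_Ico_eq_integral_Ioo, ← integral_Ioc_eq_integral_Ioo,
    ← intervalIntegral.integral_of_le hT.le, ← key]
  congr 1
  ext1 s
  have h1 : HasFDerivAt (fun z : ℝ × Vec N => η (x, z.1))
      ((ContinuousLinearMap.toSpanSingleton ℝ (timeDeriv η (x, s))).comp
        (ContinuousLinearMap.fst ℝ ℝ (Vec N))) (s, v (x, s)) :=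
    HasFDerivAt.comp (f := Prod.fst) (g := fun t => η (x, t)) (s, v (x, s))
      (hasDerivAt_timeDeriv hη1 x s).hasFDerivAt hasFDerivAt_fst
  have h2 : HasFDerivAt (fun z : ℝ × Vec N => η (x, z.1) • z.2) _ (s, v (x, s)) :=
    h1.smul hasFDerivAt_snd
  rw [h2.fderiv]
  simp [add_comm]

end

/-! ### Operations on Sobolev functions -/

section

variable {n N : ℕ} {p : ℝ} {Ω : Set (Vec n)}

theorem MemW1p.add [IsFiniteMeasure (volume.restrict Ω)] (hp : 1 ≤ p) {v w : Vec n → Vec N}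
    {D M : Vec n → Mat N n} (hv : MemW1p p Ω v D) (hw : MemW1p p Ω w M) :
    MemW1p p Ω (fun x => v x + w x) (fun x => D x + M x) where
  memLp := hv.memLp.add hw.memLp
  grad_memLp := hv.grad_memLp.add hw.grad_memLp
  weakGrad := by
    intro η hη i j
    have hp1 : 1 ≤ ENNReal.ofReal p := by simpa using hp
    have hηd : Continuous fun x => fderiv ℝ η x (EuclideanSpace.single j (1 : ℝ)) :=
      (hη.contDiff_one.continuous_fderiv one_ne_zero).clm_apply continuous_const
    obtain ⟨C₁, hC₁⟩ := hη.contDiff_one.continuous.bounded_above_of_compact_support hη.compact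
    obtain ⟨C₂, hC₂⟩ := hηd.bounded_above_of_compact_support (hη.compact.fderiv_apply ℝ _)
    have hi1 : ∀ {v : Vec n → Vec N}, MemLp v (ENNReal.ofReal p) (volume.restrict Ω) →
        IntegrableOn (fun x => v x i * fderiv ℝ η x (EuclideanSpace.single j 1)) Ω := fun hv =>
      ((EuclideanSpace.proj (𝕜 := ℝ) i).integrable_comp (hv.integrable hp1)).mul_bdd
        (c := C₂) hηd.aestronglyMeasurable (ae_of_all _ hC₂)
    have hi2 : ∀ {D : Vec n → Mat N n}, MemLp D (ENNReal.ofReal p) (volume.restrict Ω) →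
        IntegrableOn (fun x => D x (i, j) * η x) Ω := fun hD =>
      ((EuclideanSpace.proj (𝕜 := ℝ) (i, j)).integrable_comp (hD.integrable hp1)).mul_bdd
        (c := C₁) hη.contDiff_one.continuous.aestronglyMeasurable (ae_of_all _ hC₁)
    simp only [PiLp.add_apply, add_mul]
    rw [integral_add (hi1 hv.memLp) (hi1 hw.memLp), integral_add (hi2 hv.grad_memLp)
      (hi2 hw.grad_memLp), hv.weakGrad η hη i j, hw.weakGrad η hη i j, neg_add]

variable [Fact (1 ≤ ENNReal.ofReal p)] [IsFiniteMeasure (volume.restrict Ω)]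

theorem MemW1pZero.congr {v w : Vec n → Vec N} {D M : Vec n → Mat N n} (hv : MemW1pZero p Ω v D)
    (h : ∀ᵐ x ∂(volume.restrict Ω), w x = v x ∧ M x = D x) : MemW1pZero p Ω w M := by
  obtain ⟨hs, hsK⟩ := hv.toLp_mem
  have hae : (fun x => (v x, D x)) =ᵐ[volume.restrict Ω] fun x => (w x, M x) := by
    filter_upwards [h] with x hx
    rw [hx.1, hx.2]
  have hs' := hs.ae_eq hae
  refine memW1pZero_of_toLp_mem hs' ?_
  rwa [← MemLp.toLp_congr hs hs' hae]

theorem MemW1pZero.add {v w : Vec n → Vec N} {D M : Vec n → Mat N n} (hv : MemW1pZero p Ω v D)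
    (hw : MemW1pZero p Ω w M) : MemW1pZero p Ω (fun x => v x + w x) (fun x => D x + M x) := by
  obtain ⟨hs, hsK⟩ := hv.toLp_mem
  obtain ⟨hr, hrK⟩ := hw.toLp_mem
  have h := (sobolevZero p N Ω).add_mem hsK hrK
  rw [← MemLp.toLp_add hs hr] at h
  exact memW1pZero_of_toLp_mem (hs.add hr) h

theorem IsTestFun.memW1pZero {φ : Vec n → Vec N} (hφ : IsTestFun Ω φ) :
    MemW1pZero p Ω φ (jac φ) := by
  have hs := hφ.memLp_prodMk (ENNReal.ofReal p) (volume.restrict Ω)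
  exact memW1pZero_of_toLp_mem hs
    (Submodule.le_topologicalClosure _ ⟨φ, hφ, hs.coeFn_toLp⟩)

end

/-! ### Differences to the lateral boundary values -/

section

variable {n N : ℕ} {p q T : ℝ} {Ω : Set (Vec n)} {E : Set (Vec n × ℝ)}

/-- A representative `G = (u - u_*, Du - Du_*)` on the whole of space-time, where `u ∈ V^p_q(E)`.
It is defined everywhere, so that it can be averaged along lines in the time direction: it vanishes
outside the cylinder, its first component vanishes outside `E`, and its restriction to every line in
the time direction is integrable. -/
structure IsBoundaryDifference (p q : ℝ) (Ω : Set (Vec n)) (T : ℝ) (E : Set (Vec n × ℝ))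
    (G : Vec n × ℝ → Vec N × Mat N n) : Prop where
  stronglyMeasurable : StronglyMeasurable G
  eq_zero : ∀ z ∉ cyl Ω T, G z = 0
  fst_eq_zero : ∀ z ∉ E, (G z).1 = 0
  integrable : ∀ x, Integrable fun t => G (x, t)
  memLp : MemLp G (ENNReal.ofReal p) volume
  fst_memLp : MemLp (fun z => (G z).1) (ENNReal.ofReal (q + 1)) volume
  slice_mem : ∀ᵐ t : ℝ, MemW1pZero p Ω (fun x => (G (x, t)).1) (fun x => (G (x, t)).2)

theorem measurableSet_cyl (hΩ : MeasurableSet Ω) (T : ℝ) : MeasurableSet (cyl Ω T) :=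
  hΩ.prod measurableSet_Ico

theorem ae_ae_slice {P : Vec n × ℝ → Prop}
    (h : ∀ᵐ z ∂((volume : Measure (Vec n × ℝ)).restrict (cyl Ω T)), P z) :
    ∀ᵐ t ∂(volume.restrict (Ico 0 T)), ∀ᵐ x ∂(volume.restrict Ω), P (x, t) := by
  rw [volume_restrict_cyl] at h
  exact Measure.ae_ae_of_ae_prod ((Measure.measurePreserving_swap (μ := volume.restrict (Ico 0 T))
    (ν := volume.restrict Ω)).quasiMeasurePreserving.ae h)

/-- Elements of `V^p(E)` agree with `u_*` almost everywhere in the cylinder off `E`: the slicewise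
condition is transferred to space-time by Fubini's theorem for a measurable representative. -/
theorem MemVp.ae_eq_boundary (hΩ : MeasurableSet Ω) (hE : MeasurableSet E)
    {us : Vec n → Vec N} {Dus : Vec n → Mat N n} {u : Vec n × ℝ → Vec N}
    {Du : Vec n × ℝ → Mat N n} (hu : MemVp p Ω T E us Dus u Du)
    (hus : AEStronglyMeasurable us (volume.restrict Ω)) :
    ∀ᵐ z ∂((volume : Measure (Vec n × ℝ)).restrict (cyl Ω T)), z ∉ E → u z = us z.1 := by
  have husc : AEStronglyMeasurable (fun z : Vec n × ℝ => us z.1) (volume.restrict (cyl Ω T)) := by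
    rw [volume_restrict_cyl]; exact hus.comp_fst
  obtain ⟨g, hgm, hg⟩ := hu.memLp.1.sub husc
  have hbad : MeasurableSet {z | z ∉ E ∧ g z ≠ 0} :=
    hE.compl.inter (hgm.measurableSet_eq_fun stronglyMeasurable_const).compl
  have hslice : ∀ᵐ t ∂(volume.restrict (Ico 0 T)), ∀ᵐ x ∂(volume.restrict Ω),
      ¬ ((x, t) ∉ E ∧ g (x, t) ≠ 0) := by
    filter_upwards [ae_ae_slice hg, hu.slice_mem] with t ht1 ht2
    have h3 := ht2.eq_boundary
    have hEt : MeasurableSet (slice E t) := measurable_prodMk_right hE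
    rw [ae_restrict_iff' (hΩ.diff hEt)] at h3
    filter_upwards [ht1, ae_restrict_of_ae h3, ae_restrict_mem hΩ] with x hx1 hx3 hxΩ
    rintro ⟨hxE, hx0⟩
    refine hx0 ?_
    rw [← hx1, Pi.sub_apply, hx3 ⟨hxΩ, hxE⟩, sub_self]
  have hall : ∀ᵐ z ∂((volume : Measure (Vec n × ℝ)).restrict (cyl Ω T)),
      ¬ (z ∉ E ∧ g z ≠ 0) := by
    rw [volume_restrict_cyl, ae_iff]
    simp only [not_not]
    rw [Measure.prod_apply_symm hbad]
    refine lintegral_eq_zero_of_ae_eq_zero ?_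
    filter_upwards [hslice] with t ht
    rw [ae_iff] at ht
    simp only [not_not] at ht
    exact ht
  filter_upwards [hall, hg] with z hz1 hz2 hzE
  have : g z = 0 := by
    by_contra h
    exact hz1 ⟨hzE, h⟩
  rw [this] at hz2
  exact sub_eq_zero.1 hz2

/-- The values of `u - u_*` and `Du - Du_*` are changed on a null set, in order to have `G` defined
and well behaved at every point. -/
theorem exists_isBoundaryDifference [Fact (1 ≤ ENNReal.ofReal p)]
    [IsFiniteMeasure (volume.restrict Ω)] (hΩ : MeasurableSet Ω) (hE : MeasurableSet E)
    {us : Vec n → Vec N} {Dus : Vec n → Mat N n} {u : Vec n × ℝ → Vec N}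
    {Du : Vec n × ℝ → Mat N n} (hu : MemVpq p q Ω T E us Dus u Du) (hus : MemW1p p Ω us Dus)
    (husq : MemLp us (ENNReal.ofReal (q + 1)) (volume.restrict Ω)) :
    ∃ G : Vec n × ℝ → Vec N × Mat N n, IsBoundaryDifference p q Ω T E G ∧
      ∀ᵐ z ∂((volume : Measure (Vec n × ℝ)).restrict (cyl Ω T)),
        G z = (u z - us z.1, Du z - Dus z.1) := by
  have hcylfin := isFiniteMeasure_restrict_cyl (Ω := Ω) T
  have hC : MeasurableSet (cyl Ω T) := measurableSet_cyl hΩ T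
  have husc : MemLp (fun z : Vec n × ℝ => us z.1) (ENNReal.ofReal p)
      (volume.restrict (cyl Ω T)) := by
    rw [volume_restrict_cyl]; exact hus.memLp.comp_fst _
  have hDusc : MemLp (fun z : Vec n × ℝ => Dus z.1) (ENNReal.ofReal p)
      (volume.restrict (cyl Ω T)) := by
    rw [volume_restrict_cyl]; exact hus.grad_memLp.comp_fst _
  have husqc : MemLp (fun z : Vec n × ℝ => us z.1) (ENNReal.ofReal (q + 1))
      (volume.restrict (cyl Ω T)) := by
    rw [volume_restrict_cyl]; exact husq.comp_fst _
  have hg0 : MemLp (fun z => (u z - us z.1, Du z - Dus z.1)) (ENNReal.ofReal p)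
      (volume.restrict (cyl Ω T)) :=
    memLp_prodMk_iff.2 ⟨hu.memVp.memLp.sub husc, hu.memVp.grad_memLp.sub hDusc⟩
  obtain ⟨g₁, hg₁m, hg₁⟩ := hg0.1
  let g₂ : Vec n × ℝ → Vec N × Mat N n :=
    (cyl Ω T).indicator fun z => (E.indicator (fun z => (g₁ z).1) z, (g₁ z).2)
  have hg₂m : StronglyMeasurable g₂ :=
    ((hg₁m.fst.indicator hE).prodMk hg₁m.snd).indicator hC
  have hg₂ : ∀ᵐ z ∂((volume : Measure (Vec n × ℝ)).restrict (cyl Ω T)),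
      g₂ z = (u z - us z.1, Du z - Dus z.1) := by
    filter_upwards [hg₁, hu.memVp.ae_eq_boundary hΩ hE hus.memLp.1, ae_restrict_mem hC]
      with z hz1 hz2 hzC
    simp only [g₂, indicator_of_mem hzC, ← hz1]
    by_cases hzE : z ∈ E
    · rw [indicator_of_mem hzE]
      simp only [← hz1]
    · rw [indicator_of_notMem hzE, hz2 hzE, sub_self]
  have hg₂p : MemLp g₂ (ENNReal.ofReal p) volume := by
    rw [memLp_indicator_iff_restrict hC]
    refine hg0.ae_eq ?_
    filter_upwards [hg₂, ae_restrict_mem hC] with z hz hzC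
    rw [← hz]
    simp only [g₂, indicator_of_mem hzC]
  have hg₂i : Integrable g₂ volume := by
    rw [integrable_indicator_iff hC]
    refine (hg0.integrable Fact.out).congr ?_
    filter_upwards [hg₂, ae_restrict_mem hC] with z hz hzC
    rw [← hz]
    simp only [g₂, indicator_of_mem hzC]
  -- discard the null set of the lines on which `g₂` is not integrable
  have hm : Measurable fun x => ∫⁻ t : ℝ, ‖g₂ (x, t)‖ₑ := hg₂m.enorm.lintegral_prod_right'
  let X₀ : Set (Vec n) := {x | ∫⁻ t : ℝ, ‖g₂ (x, t)‖ₑ < ⊤}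
  have hX₀ : MeasurableSet X₀ := measurableSet_lt hm measurable_const
  have hX₀ae : ∀ᵐ x, x ∈ X₀ := by
    refine ae_lt_top hm ?_
    rw [← lintegral_prod (μ := volume) (ν := volume) _ hg₂m.enorm.aemeasurable,
      ← Measure.volume_eq_prod]
    exact hg₂i.2.ne
  let G : Vec n × ℝ → Vec N × Mat N n := (Prod.fst ⁻¹' X₀).indicator g₂
  have hGm : StronglyMeasurable G := hg₂m.indicator (measurable_fst hX₀)
  have hGg : G =ᵐ[volume] g₂ := by
    rw [Measure.volume_eq_prod]
    filter_upwards [Measure.quasiMeasurePreserving_fst.ae hX₀ae] with z hz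
    exact indicator_of_mem (s := Prod.fst ⁻¹' X₀) hz g₂
  have hGu : ∀ᵐ z ∂((volume : Measure (Vec n × ℝ)).restrict (cyl Ω T)),
      G z = (u z - us z.1, Du z - Dus z.1) := by
    filter_upwards [ae_restrict_of_ae hGg, hg₂] with z h1 h2
    rw [h1, h2]
  have hGin : ∀ z, z.1 ∈ X₀ → G z = g₂ z := fun z hz =>
    indicator_of_mem (s := Prod.fst ⁻¹' X₀) hz g₂
  have hGout : ∀ z, z.1 ∉ X₀ → G z = 0 := fun z hz =>
    indicator_of_notMem (s := Prod.fst ⁻¹' X₀) hz g₂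
  have hG0 : ∀ z ∉ cyl Ω T, G z = 0 := fun z hz => by
    by_cases hx : z.1 ∈ X₀
    · rw [hGin z hx]
      exact indicator_of_notMem hz _
    · exact hGout z hx
  refine ⟨G, ⟨hGm, hG0, fun z hz => ?_, fun x => ?_, (memLp_congr_ae hGg).2 hg₂p, ?_, ?_⟩, hGu⟩
  · by_cases hx : z.1 ∈ X₀
    · rw [hGin z hx]
      by_cases hzC : z ∈ cyl Ω T
      · simp only [g₂, indicator_of_mem hzC, indicator_of_notMem hz]
      · simp only [g₂, indicator_of_notMem hzC, Prod.fst_zero]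
    · rw [hGout z hx, Prod.fst_zero]
  · by_cases hx : x ∈ X₀
    · have : (fun t => G (x, t)) = fun t => g₂ (x, t) :=
        funext fun t => hGin (x, t) hx
      rw [this]
      exact ⟨(hg₂m.comp_measurable measurable_prodMk_left).aestronglyMeasurable, hx⟩
    · have : (fun t => G (x, t)) = fun t => 0 :=
        funext fun t => hGout (x, t) hx
      rw [this]
      exact integrable_zero _ _ _
  · have e : (fun z => (G z).1) = (cyl Ω T).indicator fun z => (G z).1 := by
      ext1 z
      by_cases hz : z ∈ cyl Ω T
      · rw [indicator_of_mem hz]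
      · rw [indicator_of_notMem hz, hG0 z hz, Prod.fst_zero]
    rw [e, memLp_indicator_iff_restrict hC]
    refine (hu.memLq.sub husqc).ae_eq ?_
    filter_upwards [hGu] with z hz
    rw [hz, Pi.sub_apply]
  · have h1 : ∀ᵐ t ∂(volume.restrict (Ico 0 T)),
        MemW1pZero p Ω (fun x => (G (x, t)).1) (fun x => (G (x, t)).2) := by
      filter_upwards [ae_ae_slice hGu, hu.memVp.slice_mem] with t ht1 ht2
      refine ht2.sub_memW1pZero.congr ?_
      filter_upwards [ht1] with x hx
      rw [hx]
      exact ⟨rfl, rfl⟩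
    rw [ae_restrict_iff' measurableSet_Ico] at h1
    filter_upwards [h1] with t ht
    by_cases htT : t ∈ Ico 0 T
    · exact ht htT
    · refine (IsTestFun.zero (F := Vec N) Ω).memW1pZero.congr (ae_of_all _ fun x => ?_)
      rw [hG0 (x, t) fun h => htT h.2, jac_eq_zero_of_notMem_tsupport (by simp [tsupport])]
      exact ⟨rfl, rfl⟩

end

/-! ### Exponential means of differences to the boundary values -/

section

variable {F : Type*} [NormedAddCommGroup F] {g : ℝ → F} {h : ℝ}

theorem expWeight_le_volume : expWeight ≤ volume := by
  calc expWeight ≤ (volume.restrict (Ioi 0)).withDensity 1 := by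
        refine withDensity_mono ?_
        filter_upwards [ae_restrict_mem measurableSet_Ioi] with r hr
        have hr0 : (0 : ℝ) < r := hr
        simpa using hr0.le
    _ = volume.restrict (Ioi 0) := withDensity_one
    _ ≤ volume := Measure.restrict_le_self

theorem integrable_expWeight_comp (hh : h ≠ 0) (hg : Integrable g) (t : ℝ) :
    Integrable (fun r => g (t - h * r)) expWeight :=
  ((hg.comp_sub_left t).comp_mul_left' hh).mono_measure expWeight_le_volume

theorem ae_expWeight_comp (hh : h ≠ 0) {P : ℝ → Prop} (hP : ∀ᵐ s : ℝ, P s) (t : ℝ) :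
    ∀ᵐ r ∂expWeight, P (t - h * r) := by
  have h1 : ∀ᵐ s : ℝ, P (t - s) :=
    (Measure.measurePreserving_sub_left volume t).quasiMeasurePreserving.ae hP
  have h2 : Measure.QuasiMeasurePreserving (fun r : ℝ => h * r) volume volume :=
    ⟨by fun_prop, by
      rw [Real.map_volume_mul_left hh]; exact Measure.smul_absolutelyContinuous⟩
  exact (h2.ae h1).filter_mono (ae_mono expWeight_le_volume)

end

section

variable {n N : ℕ} {p q T h : ℝ} {Ω : Set (Vec n)} {E : Set (Vec n × ℝ)}
  {G : Vec n × ℝ → Vec N × Mat N n}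

theorem IsBoundaryDifference.timeMean_fst (hG : IsBoundaryDifference p q Ω T E G) (hh : h ≠ 0)
    (z : Vec n × ℝ) : (timeMean h G z).1 = timeMean h (fun z => (G z).1) z :=
  fst_integral (integrable_expWeight_comp hh (hG.integrable z.1) z.2)

/-- The averages only involve the past, where the slices of `E` are smaller. -/
theorem IsBoundaryDifference.timeMean_fst_eq_zero (hG : IsBoundaryDifference p q Ω T E G)
    (hh : 0 < h) (hE : IsNondecreasing T E) (hEcyl : E ⊆ cyl Ω T) {z : Vec n × ℝ}
    (hz : z ∈ cyl Ω T) (hzE : z ∉ E) : (timeMean h G z).1 = 0 := by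
  rw [hG.timeMean_fst hh.ne']
  refine integral_eq_zero_of_ae ?_
  filter_upwards [ae_expWeight_pos] with r hr
  refine hG.fst_eq_zero _ fun hmem => hzE ?_
  exact hE _ _ (hEcyl hmem).2.1 (by nlinarith) hz.2.2 hmem

theorem IsBoundaryDifference.eq_zero_of_neg (hG : IsBoundaryDifference p q Ω T E G) (x : Vec n)
    {s : ℝ} (hs : s < 0) : G (x, s) = 0 :=
  hG.eq_zero _ fun h => absurd h.2.1 (not_le.2 hs)

theorem IsBoundaryDifference.timeMean_zero (hG : IsBoundaryDifference p q Ω T E G) (hh : 0 < h)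
    (x : Vec n) : timeMean h G (x, 0) = 0 :=
  expMean_eq_zero_of_forall_lt hh fun _ hs => hG.eq_zero_of_neg x hs

/-- The time averages of a curve in the closed subspace `W₀^{1,p}` remain in this subspace. -/
theorem IsBoundaryDifference.ae_memW1pZero_timeMean [Fact (1 ≤ ENNReal.ofReal p)]
    [IsFiniteMeasure (volume.restrict Ω)] (hp : 0 < p) (hG : IsBoundaryDifference p q Ω T E G)
    (hh : h ≠ 0) :
    ∀ᵐ t : ℝ, MemW1pZero p Ω (fun x => (timeMean h G (x, t)).1)
      (fun x => (timeMean h G (x, t)).2) := by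
  let m : ℝ → ℝ≥0∞ := fun s => ∫⁻ x in Ω, ‖G (x, s)‖ₑ ^ p
  have hGm : Measurable fun z => ‖G z‖ₑ ^ p := hG.stronglyMeasurable.enorm.pow_const p
  have hm : Measurable m := hGm.lintegral_prod_left'
  have hmfin : ∫⁻ s, m s ≠ ⊤ := by
    have h1 := ((memLp_ofReal_iff hp hG.memLp.1).1 hG.memLp).ne
    rw [Measure.volume_eq_prod, lintegral_prod_symm _ hGm.aemeasurable] at h1
    exact ne_top_of_le_ne_top h1 (lintegral_mono fun s => setLIntegral_le_lintegral _ _)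
  have hm2 : Measurable fun w : ℝ × ℝ => m (w.1 - h * w.2) := hm.comp (by fun_prop)
  have hfin : ∀ᵐ t : ℝ, (∫⁻ r, m (t - h * r) ∂expWeight) < ⊤ := by
    refine ae_lt_top hm2.lintegral_prod_right' ?_
    rw [lintegral_lintegral_swap hm2.aemeasurable]
    have : ∀ r : ℝ, ∫⁻ t, m (t - h * r) = ∫⁻ s, m s := fun r =>
      lintegral_sub_right_eq_self m (h * r)
    simpa only [this, lintegral_const, measure_univ, mul_one] using hmfin
  filter_upwards [hfin] with t ht
  obtain ⟨hB, hBK⟩ := exists_toLp_integral_mem (μ := volume.restrict Ω) (κ := expWeight)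
    (H := fun w : Vec n × ℝ => G (w.1, t - h * w.2)) (K := sobolevZero p N Ω)
    (hG.stronglyMeasurable.comp_measurable (by fun_prop)) ht
    (Submodule.isClosed_topologicalClosure _)
    (by filter_upwards [ae_expWeight_comp hh hG.slice_mem t] with r hr using hr.toLp_mem)
  exact memW1pZero_of_toLp_mem hB hBK

end

/-! ### The mollified comparison maps -/

section

variable {n N : ℕ} {p q T h : ℝ} {Ω : Set (Vec n)} {E : Set (Vec n × ℝ)}
  {us : Vec n → Vec N} {Dus : Vec n → Mat N n} {G : Vec n × ℝ → Vec N × Mat N n}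
  {Ψ : Vec n × ℝ → Vec N}

/-- The map `u_* + [G]_h + Ψ`, where `[G]_h` is the exponential time mean of `G = u - u_*`. -/
def mollified (h : ℝ) (us : Vec n → Vec N) (G : Vec n × ℝ → Vec N × Mat N n)
    (Ψ : Vec n × ℝ → Vec N) (z : Vec n × ℝ) : Vec N :=
  us z.1 + (timeMean h G z).1 + Ψ z

/-- The spatial gradient of `mollified h us G Ψ`. -/
def mollifiedGrad (h : ℝ) (Dus : Vec n → Mat N n) (G : Vec n × ℝ → Vec N × Mat N n)
    (Ψ : Vec n × ℝ → Vec N) (z : Vec n × ℝ) : Mat N n :=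
  Dus z.1 + (timeMean h G z).2 + spaceGrad Ψ z

/-- The time derivative of `mollified h us G Ψ`. -/
def mollifiedDeriv (h : ℝ) (G : Vec n × ℝ → Vec N × Mat N n) (Ψ : Vec n × ℝ → Vec N)
    (z : Vec n × ℝ) : Vec N :=
  h⁻¹ • ((G z).1 - (timeMean h G z).1) + timeDeriv Ψ z

theorem memLp_restrict_cyl_of_continuous {F : Type*} [NormedAddCommGroup F]
    [SecondCountableTopologyEither (Vec n × ℝ) F] [IsFiniteMeasure (volume.restrict Ω)]
    (hΩ : MeasurableSet Ω) (hΩb : Bornology.IsBounded Ω) (T : ℝ) {g : Vec n × ℝ → F}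
    (hg : Continuous g) (r : ℝ≥0∞) : MemLp g r (volume.restrict (cyl Ω T)) := by
  have := isFiniteMeasure_restrict_cyl (Ω := Ω) T
  have hK : IsCompact (closure Ω ×ˢ Icc 0 T) := hΩb.isCompact_closure.prod isCompact_Icc
  obtain ⟨C, hC⟩ := hK.exists_bound_of_continuousOn hg.continuousOn
  refine MemLp.of_bound hg.aestronglyMeasurable C ?_
  filter_upwards [ae_restrict_mem (measurableSet_cyl hΩ T)] with z hz
  exact hC z ⟨subset_closure hz.1, Ico_subset_Icc_self hz.2⟩

theorem intervalIntegrable_timeMean (hG : IsBoundaryDifference p q Ω T E G) (hh : 0 < h)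
    {τ : ℝ} (hτ : 0 ≤ τ) (x : Vec n) :
    IntervalIntegrable (fun t => timeMean h G (x, t)) volume 0 τ := by
  refine ContinuousOn.intervalIntegrable ?_
  rw [uIcc_of_le hτ]
  exact continuousOn_expMean hh (fun s hs => hG.eq_zero_of_neg x hs) hτ
    (hG.integrable x).intervalIntegrable

theorem intervalIntegrable_mollifiedDeriv (hG : IsBoundaryDifference p q Ω T E G) (hh : 0 < h)
    {τ : ℝ} (hτ : 0 ≤ τ) (hΨ : ContDiff ℝ 1 Ψ) (x : Vec n) :
    IntervalIntegrable (fun t => mollifiedDeriv h G Ψ (x, t)) volume 0 τ := by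
  have h1 : IntervalIntegrable (fun t => G (x, t) - timeMean h G (x, t)) volume 0 τ :=
    (hG.integrable x).intervalIntegrable.sub (intervalIntegrable_timeMean hG hh hτ x)
  have h2 : IntervalIntegrable (fun t => (G (x, t) - timeMean h G (x, t)).1) volume 0 τ :=
    ⟨h1.1.fst, h1.2.fst⟩
  have h3 : Continuous fun t => timeDeriv Ψ (x, t) :=
    (continuous_timeDeriv hΨ).comp (by fun_prop)
  exact (h2.smul h⁻¹).add (h3.intervalIntegrable _ _)

/-- The mollified map is an indefinite integral on every line in the time direction. -/
theorem mollified_eq_add_integral (hG : IsBoundaryDifference p q Ω T E G) (hh : 0 < h)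
    (us : Vec n → Vec N) (hΨ : ContDiff ℝ 1 Ψ) (x : Vec n) {t : ℝ} (ht : 0 ≤ t) :
    mollified h us G Ψ (x, t)
      = mollified h us G Ψ (x, 0) + ∫ s in (0 : ℝ)..t, mollifiedDeriv h G Ψ (x, s) := by
  have h1 : IntervalIntegrable (fun t => G (x, t) - timeMean h G (x, t)) volume 0 t :=
    (hG.integrable x).intervalIntegrable.sub (intervalIntegrable_timeMean hG hh ht x)
  have h2 : IntervalIntegrable (fun t => h⁻¹ • (G (x, t) - timeMean h G (x, t)).1) volume 0 t :=
    IntervalIntegrable.smul ⟨h1.1.fst, h1.2.fst⟩ h⁻¹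
  have h3 : IntervalIntegrable (fun t => timeDeriv Ψ (x, t)) volume 0 t :=
    Continuous.intervalIntegrable ((continuous_timeDeriv hΨ).comp (by fun_prop)) _ _
  have h4 : ∫ s in (0 : ℝ)..t, timeDeriv Ψ (x, s) = Ψ (x, t) - Ψ (x, 0) :=
    intervalIntegral.integral_eq_sub_of_hasDerivAt
      (fun s _ => hasDerivAt_timeDeriv hΨ x s) h3
  have h5 : timeMean h G (x, t) = ∫ s in (0 : ℝ)..t, h⁻¹ • (G (x, s) - timeMean h G (x, s)) :=
    expMean_eq_integral hh (fun s hs => hG.eq_zero_of_neg x hs) ht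
      (hG.integrable x).intervalIntegrable
  have h6 : (timeMean h G (x, t)).1
      = ∫ s in (0 : ℝ)..t, h⁻¹ • (G (x, s) - timeMean h G (x, s)).1 := by
    rw [h5]
    exact ((ContinuousLinearMap.fst ℝ (Vec N) (Mat N n)).intervalIntegral_comp_comm
      (h1.smul h⁻¹)).symm
  have h7 : ∫ s in (0 : ℝ)..t, mollifiedDeriv h G Ψ (x, s)
      = (timeMean h G (x, t)).1 + (Ψ (x, t) - Ψ (x, 0)) := by
    rw [h6, ← h4, ← intervalIntegral.integral_add h2 h3]
    rfl
  rw [h7]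
  simp only [mollified, hG.timeMean_zero hh, Prod.fst_zero]
  abel

theorem memLp_mollified [IsFiniteMeasure (volume.restrict Ω)] (hq : 0 < q)
    (hΩ : MeasurableSet Ω) (hΩb : Bornology.IsBounded Ω)
    (husq : MemLp us (ENNReal.ofReal (q + 1)) (volume.restrict Ω))
    (hG : IsBoundaryDifference p q Ω T E G) (hh : h ≠ 0) (τ : ℝ) {Ψ : Vec n × ℝ → Vec N}
    (hΨ : Continuous Ψ) :
    MemLp (mollified h us G Ψ) (ENNReal.ofReal (q + 1)) (volume.restrict (cyl Ω τ)) := by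
  refine (MemLp.add ?_ ?_).add (memLp_restrict_cyl_of_continuous hΩ hΩb τ hΨ _)
  · rw [volume_restrict_cyl]; exact husq.comp_fst _
  · simp only [hG.timeMean_fst hh]
    exact (memLp_timeMean h (by linarith) hG.stronglyMeasurable.fst hG.fst_memLp).restrict _

theorem memLp_mollifiedDeriv [IsFiniteMeasure (volume.restrict Ω)] (hq : 0 < q)
    (hΩ : MeasurableSet Ω) (hΩb : Bornology.IsBounded Ω)
    (hG : IsBoundaryDifference p q Ω T E G) (hh : h ≠ 0) (τ : ℝ) {Ψ : Vec n × ℝ → Vec N}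
    (hΨ : ContDiff ℝ 1 Ψ) :
    MemLp (mollifiedDeriv h G Ψ) (ENNReal.ofReal (q + 1)) (volume.restrict (cyl Ω τ)) := by
  refine MemLp.add (MemLp.const_smul ((hG.fst_memLp.restrict _).sub ?_) h⁻¹)
    (memLp_restrict_cyl_of_continuous hΩ hΩb τ (continuous_timeDeriv hΨ) _)
  simp only [hG.timeMean_fst hh]
  exact (memLp_timeMean h (by linarith) hG.stronglyMeasurable.fst hG.fst_memLp).restrict _

variable [Fact (1 ≤ ENNReal.ofReal p)] [IsFiniteMeasure (volume.restrict Ω)]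

/-- The first component of the mean and `Ψ` vanish off `E`, so that the map equals `u_*` there, and
it is a primitive in time of a map in `L^{q+1}`. -/
theorem isComparisonMap_mollified (hp : 1 < p) (hq : 0 < q) (hT : 0 < T)
    (hΩ : MeasurableSet Ω) (hΩb : Bornology.IsBounded Ω) (hEm : MeasurableSet E)
    (hE : IsNondecreasing T E) (hEcyl : E ⊆ cyl Ω T) (hus : MemW1p p Ω us Dus)
    (husq : MemLp us (ENNReal.ofReal (q + 1)) (volume.restrict Ω))
    (hG : IsBoundaryDifference p q Ω T E G) (hh : 0 < h) (hΨ : ContDiff ℝ 1 Ψ)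
    (hΨΩ : ∀ t ∈ Ico 0 T, IsTestFun Ω fun x => Ψ (x, t))
    (hΨE : ∀ z ∈ cyl Ω T, z ∉ E → Ψ z = 0) :
    IsComparisonMap p q Ω T E us Dus (mollified h us G Ψ) (mollifiedGrad h Dus G Ψ)
      (mollifiedDeriv h G Ψ) := by
  have hcylfin := isFiniteMeasure_restrict_cyl (Ω := Ω) T
  have hJ : MemLp (timeMean h G) (ENNReal.ofReal p) (volume.restrict (cyl Ω T)) :=
    (memLp_timeMean h hp.le hG.stronglyMeasurable hG.memLp).restrict _
  obtain ⟨hJ1, hJ2⟩ := memLp_prodMk_iff.1 hJ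
  have hvq := memLp_mollified hq hΩ hΩb husq hG hh.ne' T hΨ.continuous
  have hdvq := memLp_mollifiedDeriv hq hΩ hΩb hG hh.ne' T hΨ
  have hint := intervalIntegrable_mollifiedDeriv hG hh hT.le hΨ
  have hprim : ∀ x, ∀ t ∈ Icc 0 T, mollified h us G Ψ (x, t)
      = mollified h us G Ψ (x, 0) + ∫ s in (0 : ℝ)..t, mollifiedDeriv h G Ψ (x, s) :=
    fun x t ht => mollified_eq_add_integral hG hh us hΨ x ht.1
  have hq1 : 1 ≤ ENNReal.ofReal (q + 1) := by
    rw [← ENNReal.ofReal_one]; exact ENNReal.ofReal_le_ofReal (by linarith)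
  refine ⟨⟨⟨?_, ?_, ?_⟩, hvq⟩, hdvq, ?_, fun t ht => ?_, fun t ht => ?_⟩
  · refine (MemLp.add ?_ hJ1).add
      (memLp_restrict_cyl_of_continuous hΩ hΩb T hΨ.continuous _)
    rw [volume_restrict_cyl]; exact hus.memLp.comp_fst _
  · refine (MemLp.add ?_ hJ2).add
      (memLp_restrict_cyl_of_continuous hΩ hΩb T (continuous_spaceGrad hΨ) _)
    rw [volume_restrict_cyl]; exact hus.grad_memLp.comp_fst _
  · filter_upwards [ae_restrict_of_ae
      (hG.ae_memW1pZero_timeMean (by linarith) hh.ne'), ae_restrict_mem measurableSet_Ico]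
      with t ht htT
    have hz := ht.add (hΨΩ t htT).memW1pZero
    refine ⟨?_, ?_, ?_⟩
    · have := hus.add hp.le hz.memW1p
      simp only [← add_assoc] at this
      exact this
    · refine hz.congr (ae_of_all _ fun x => ?_)
      simp only [mollified, mollifiedGrad, add_assoc, add_sub_cancel_left, true_and]
      rfl
    · refine ae_restrict_of_forall_mem (hΩ.diff (measurable_prodMk_right hEm)) fun x hx => ?_
      have hxC : (x, t) ∈ cyl Ω T := ⟨hx.1, htT⟩
      simp only [mollified, hG.timeMean_fst_eq_zero hh hE hEcyl hxC hx.2, hΨE _ hxC hx.2, add_zero]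
  · exact hasWeakTimeDeriv_of_primitive hT hint hprim (hvq.integrable hq1) (hdvq.integrable hq1)
  · refine memLp_slice_of_primitive hint hprim (by linarith) hdvq ?_ ht
    have h0 : (0 : ℝ) ∈ Ico 0 T := ⟨le_rfl, hT⟩
    have h1 : (fun x => mollified h us G Ψ (x, 0)) = fun x => us x + Ψ (x, 0) := by
      ext1 x
      simp only [mollified, hG.timeMean_zero hh, Prod.fst_zero, add_zero]
    rw [h1]
    have h2 := (hΨΩ 0 h0).memLp_prodMk (ENNReal.ofReal (q + 1)) (volume.restrict Ω)
    exact husq.add (memLp_prodMk_iff.1 h2).1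
  · exact tendsto_eLpNorm_sub_of_primitive hint hprim (by linarith) hdvq ht

end

/-! ### Test functions on space-time and decaying initial values -/

section

variable {n N : ℕ} {q T h : ℝ} {Ω : Set (Vec n)} {E : Set (Vec n × ℝ)}
  {φ : Vec n × ℝ → Vec N} {χ : Vec n → Vec N}

theorem IsTestFun.slice (hφ : IsTestFun E φ) (hEcyl : E ⊆ cyl Ω T) (t : ℝ) :
    IsTestFun Ω fun x => φ (x, t) := by
  have hcl : IsClosed {x : Vec n | (x, t) ∈ tsupport φ} :=
    (isClosed_tsupport φ).preimage (by fun_prop)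
  have hsub : tsupport (fun x => φ (x, t)) ⊆ {x | (x, t) ∈ tsupport φ} :=
    closure_minimal (fun x hx => subset_tsupport φ hx) hcl
  refine ⟨hφ.smooth.comp (by fun_prop), ?_, fun x hx => (hEcyl (hφ.support (hsub hx))).1⟩
  refine HasCompactSupport.intro (hφ.compact.isCompact.image continuous_fst) fun x hx => ?_
  exact image_eq_zero_of_notMem_tsupport fun hmem => hx ⟨(x, t), hmem, rfl⟩

/-- Although `E` contains its initial slice, a test function on `E` vanishes at time zero. -/
theorem IsTestFun.apply_zero (hφ : IsTestFun E φ) (hEcyl : E ⊆ cyl Ω T) (x : Vec n) :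
    φ (x, 0) = 0 := by
  have hc : Continuous fun t : ℝ => φ (x, t) := hφ.smooth.continuous.comp (by fun_prop)
  have h1 : Tendsto (fun t : ℝ => φ (x, t)) (𝓝[<] 0) (𝓝 (φ (x, 0))) :=
    hc.continuousAt.tendsto.mono_left inf_le_left
  refine tendsto_nhds_unique h1 (tendsto_const_nhds.congr' ?_)
  filter_upwards [self_mem_nhdsWithin] with t ht
  refine (image_eq_zero_of_notMem_tsupport fun hmem => ?_).symm
  exact absurd (hEcyl (hφ.support hmem)).2.1 (not_le.2 ht)

theorem IsTestFun.exists_time_bound (hφ : IsTestFun E φ) (hEcyl : E ⊆ cyl Ω T) (hT : 0 < T) :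
    ∃ T' < T, ∀ z ∈ tsupport φ, z.2 ≤ T' := by
  have hK : IsCompact (insert 0 (Prod.snd '' tsupport φ)) :=
    (hφ.compact.isCompact.image continuous_snd).insert 0
  obtain ⟨T', hT'm, hT'⟩ := hK.exists_isGreatest (insert_nonempty _ _)
  refine ⟨T', ?_, fun z hz => hT' (mem_insert_of_mem _ ⟨z, hz, rfl⟩)⟩
  rcases hT'm with rfl | ⟨z, hz, rfl⟩
  · exact hT
  · exact (hEcyl (hφ.support hz)).2.2

theorem timeDeriv_eq_zero_of_notMem_tsupport (hφ : ContDiff ℝ 1 φ) {z : Vec n × ℝ}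
    (hz : z ∉ tsupport φ) : timeDeriv φ z = 0 := by
  rw [timeDeriv_eq_fderiv hφ]
  have h : fderiv ℝ φ z = 0 := by
    by_contra h0
    exact hz (support_fderiv_subset ℝ h0)
  rw [h, _root_.zero_apply]

theorem timeDeriv_add {φ ψ : Vec n × ℝ → Vec N} (hφ : ContDiff ℝ 1 φ) (hψ : ContDiff ℝ 1 ψ)
    (z : Vec n × ℝ) : timeDeriv (fun z => φ z + ψ z) z = timeDeriv φ z + timeDeriv ψ z :=
  ((hasDerivAt_timeDeriv hφ z.1 z.2).add (hasDerivAt_timeDeriv hψ z.1 z.2)).deriv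

/-- The extension `e^{-t/h} χ(x)` of `χ` to positive times. -/
def decay (h : ℝ) (χ : Vec n → Vec N) (z : Vec n × ℝ) : Vec N :=
  Real.exp (-z.2 / h) • χ z.1

theorem contDiff_decay (h : ℝ) {m : WithTop ℕ∞} (hχ : ContDiff ℝ m χ) :
    ContDiff ℝ m (decay h χ) := by
  have : ContDiff ℝ m fun z : Vec n × ℝ => χ z.1 := hχ.comp contDiff_fst
  unfold decay
  fun_prop

theorem timeDeriv_decay (h : ℝ) (χ : Vec n → Vec N) (z : Vec n × ℝ) :
    timeDeriv (decay h χ) z = -(h⁻¹ • decay h χ z) := by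
  have h1 : HasDerivAt (fun t : ℝ => Real.exp (-t / h)) (Real.exp (-z.2 / h) * (-1 / h)) z.2 :=
    ((hasDerivAt_id z.2).neg.div_const h).exp
  have h2 := (h1.smul_const (χ z.1)).deriv
  refine h2.trans ?_
  rw [decay, smul_smul, ← neg_smul]
  congr 1
  ring

theorem spaceGrad_decay (h : ℝ) (hχ : Differentiable ℝ χ) (z : Vec n × ℝ) :
    spaceGrad (decay h χ) z = Real.exp (-z.2 / h) • jac χ z.1 :=
  jac_const_smul (Real.exp (-z.2 / h)) hχ z.1

theorem spaceGrad_add {φ ψ : Vec n × ℝ → Vec N} (hφ : ContDiff ℝ 1 φ) (hψ : ContDiff ℝ 1 ψ)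
    (z : Vec n × ℝ) : spaceGrad (fun z => φ z + ψ z) z = spaceGrad φ z + spaceGrad ψ z :=
  jac_add ((hφ.differentiable one_ne_zero).comp (by fun_prop))
    ((hψ.differentiable one_ne_zero).comp (by fun_prop)) z.1

end

/-! ### The contribution of the time derivative -/

section

variable {n N : ℕ} {p q T h : ℝ} {Ω : Set (Vec n)} {E : Set (Vec n × ℝ)}
  {us : Vec n → Vec N} {G : Vec n × ℝ → Vec N × Mat N n} {φ : Vec n × ℝ → Vec N}
  {χ : Vec n → Vec N}

/-- Without a test function, the mollified map `a` satisfies `∂ₜa = (u - a)/h`. The factor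
`e^{-t/h}` in front of `χ` is chosen for this purpose. -/
theorem mollifiedDeriv_decay (h : ℝ) (us : Vec n → Vec N)
    (G : Vec n × ℝ → Vec N × Mat N n) (χ : Vec n → Vec N) (z : Vec n × ℝ) :
    mollifiedDeriv h G (decay h χ) z
      = h⁻¹ • (us z.1 + (G z).1 - mollified h us G (decay h χ) z) := by
  rw [mollifiedDeriv, timeDeriv_decay, mollified, ← sub_eq_add_neg, ← smul_sub]
  congr 1
  abel

/-- The sum of the two integrands below is at most
`∂ₜa · ((a+φ)^q - a^q) + ∂ₜφ · (a+φ)^q`, where `a + φ` is the comparison map, since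
`∂ₜa = (u-a)/h` and signed powers are monotone. The latter expression is the time derivative of
`(|a+φ|^{q+1} - |a|^{q+1})/(q+1)`, which vanishes at both ends. -/
theorem setIntegral_cyl_inner_mollifiedDeriv_le [IsFiniteMeasure (volume.restrict Ω)] (hq : 0 < q)
    (hΩ : MeasurableSet Ω) (hΩb : Bornology.IsBounded Ω)
    (husq : MemLp us (ENNReal.ofReal (q + 1)) (volume.restrict Ω))
    (hG : IsBoundaryDifference p q Ω T E G) (hh : 0 < h) (hχ : ContDiff ℝ 1 χ)
    (hφ : ContDiff ℝ 1 φ) {τ : ℝ} (hτ : 0 ≤ τ) (hφ0 : ∀ x, φ (x, 0) = 0)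
    (hφτ : ∀ x, φ (x, τ) = 0) :
    ∫ z in cyl Ω τ, (inner ℝ (mollifiedDeriv h G (fun z => decay h χ z + φ z) z)
          (spow q (mollified h us G (fun z => decay h χ z + φ z) z) - spow q (us z.1 + (G z).1))
        + inner ℝ (timeDeriv φ z) (spow q (us z.1 + (G z).1))) ≤ 0 := by
  have hψ : ContDiff ℝ 1 (decay h χ) := contDiff_decay h hχ
  have hΨ : ContDiff ℝ 1 fun z => decay h χ z + φ z := hψ.add hφ
  set a := mollified h us G (decay h χ) with ha
  set α := mollifiedDeriv h G (decay h χ) with hα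
  have hva : ∀ z, mollified h us G (fun z => decay h χ z + φ z) z = a z + φ z := fun z => by
    simp only [ha, mollified, add_assoc]
  have hdv : ∀ z, mollifiedDeriv h G (fun z => decay h χ z + φ z) z = α z + timeDeriv φ z :=
    fun z => by simp only [hα, mollifiedDeriv, timeDeriv_add hψ hφ, add_assoc]
  have hdq := memLp_mollifiedDeriv hq hΩ hΩb hG hh.ne' τ hΨ
  have hvq := memLp_mollified hq hΩ hΩb husq hG hh.ne' τ hΨ.continuous
  have hαq := memLp_mollifiedDeriv hq hΩ hΩb hG hh.ne' τ hψ
  have haq := memLp_mollified hq hΩ hΩb husq hG hh.ne' τ hψ.continuous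
  have hφq := memLp_restrict_cyl_of_continuous hΩ hΩb τ (continuous_timeDeriv hφ)
    (ENNReal.ofReal (q + 1))
  have huq : MemLp (fun z => us z.1 + (G z).1) (ENNReal.ofReal (q + 1))
      (volume.restrict (cyl Ω τ)) := by
    refine MemLp.add ?_ (hG.fst_memLp.restrict _)
    rw [volume_restrict_cyl]; exact husq.comp_fst _
  have hvq' : MemLp (fun z => a z + φ z) (ENNReal.ofReal (q + 1))
      (volume.restrict (cyl Ω τ)) := by
    simpa only [← hva] using hvq
  have hF : IntegrableOn (fun z => inner ℝ (mollifiedDeriv h G (fun z => decay h χ z + φ z) z)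
          (spow q (mollified h us G (fun z => decay h χ z + φ z) z) - spow q (us z.1 + (G z).1))
        + inner ℝ (timeDeriv φ z) (spow q (us z.1 + (G z).1))) (cyl Ω τ) := by
    simp only [inner_sub_right]
    exact ((integrable_inner_spow hq hdq hvq).sub (integrable_inner_spow hq hdq huq)).add
      (integrable_inner_spow hq hφq huq)
  have hK : IntegrableOn (fun z => inner ℝ (α z) (spow q (a z + φ z) - spow q (a z))
        + inner ℝ (timeDeriv φ z) (spow q (a z + φ z))) (cyl Ω τ) := by
    simp only [inner_sub_right]
    exact ((integrable_inner_spow hq hαq hvq').sub (integrable_inner_spow hq hαq haq)).add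
      (integrable_inner_spow hq hφq hvq')
  refine (setIntegral_mono hF hK fun z => ?_).trans_eq ?_
  · have h1 : inner ℝ (α z) (spow q (a z) - spow q (us z.1 + (G z).1)) ≤ (0 : ℝ) := by
      have h2 := inner_spow_sub_nonneg hq (a z) (us z.1 + (G z).1)
      have h3 : α z = h⁻¹ • (us z.1 + (G z).1 - a z) := mollifiedDeriv_decay h us G χ z
      rw [real_inner_comm, ← neg_sub, inner_neg_left, h3, inner_smul_right]
      exact neg_nonpos.2 (mul_nonneg (inv_nonneg.2 hh.le) h2)
    simp only [hva, hdv, inner_add_left, inner_sub_right] at h1 ⊢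
    linarith
  · rw [IntegrableOn, volume_restrict_cyl] at hK
    rw [volume_restrict_cyl, integral_prod _ hK]
    refine integral_eq_zero_of_ae (ae_of_all _ fun x => ?_)
    have h4 := integral_inner_spow_add_eq_zero hq (a := fun t => a (x, t))
      (α := fun t => α (x, t)) (φ := fun t => φ (x, t)) (φ' := fun t => timeDeriv φ (x, t)) hτ
      (intervalIntegrable_mollifiedDeriv hG hh hτ hψ x)
      (fun t ht => mollified_eq_add_integral hG hh us hψ x ht.1)
      (hφ.comp (by fun_prop)) (fun t => hasDerivAt_timeDeriv hφ x t) (hφ0 x) (hφτ x)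
    rwa [intervalIntegral.integral_of_le hτ, ← integral_Ico_eq_integral_Ioc] at h4

/-- The contribution of the time derivative in the variational inequality is at most
`-∬_E u^q·∂ₜφ`, as soon as `φ` vanishes from time `τ` on. -/
theorem setIntegral_inner_mollifiedDeriv_le [IsFiniteMeasure (volume.restrict Ω)] (hq : 0 < q)
    (hΩ : MeasurableSet Ω) (hΩb : Bornology.IsBounded Ω) (hEm : MeasurableSet E)
    (hE : IsNondecreasing T E) (hEcyl : E ⊆ cyl Ω T)
    (husq : MemLp us (ENNReal.ofReal (q + 1)) (volume.restrict Ω))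
    (hG : IsBoundaryDifference p q Ω T E G) (hh : 0 < h) (hχ : IsTestFun (slice E 0) χ)
    (hφ : IsTestFun E φ) {u : Vec n × ℝ → Vec N}
    (hu : ∀ᵐ z ∂((volume : Measure (Vec n × ℝ)).restrict (cyl Ω T)), u z = us z.1 + (G z).1)
    {τ : ℝ} (hτ : 0 ≤ τ) (hτT : τ < T) (hφτ : ∀ z ∈ tsupport φ, z.2 < τ) :
    ∫ z in E ∩ cyl Ω τ, inner ℝ (mollifiedDeriv h G (fun z => decay h χ z + φ z) z)
        (spow q (mollified h us G (fun z => decay h χ z + φ z) z) - spow q (u z))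
      ≤ -∫ z in E, inner ℝ (spow q (u z)) (timeDeriv φ z) := by
  have hcyl : cyl Ω τ ⊆ cyl Ω T := fun z hz => ⟨hz.1, hz.2.1, hz.2.2.trans hτT⟩
  have hφ1 := hφ.contDiff_one
  have hψ : ContDiff ℝ 1 (decay h χ) := contDiff_decay h hχ.contDiff_one
  have hΨ : ContDiff ℝ 1 fun z => decay h χ z + φ z := hψ.add hφ1
  have hφzero : ∀ {z : Vec n × ℝ}, z ∉ tsupport φ → timeDeriv φ z = 0 := fun hz =>
    timeDeriv_eq_zero_of_notMem_tsupport hφ1 hz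
  set v := mollified h us G (fun z => decay h χ z + φ z) with hv
  set dv := mollifiedDeriv h G (fun z => decay h χ z + φ z) with hdv
  have hmain : ∫ z in cyl Ω τ, (inner ℝ (dv z) (spow q (v z) - spow q (us z.1 + (G z).1))
      + inner ℝ (timeDeriv φ z) (spow q (us z.1 + (G z).1))) ≤ 0 :=
    setIntegral_cyl_inner_mollifiedDeriv_le hq hΩ hΩb husq hG hh hχ.contDiff_one hφ1 hτ
      (hφ.apply_zero hEcyl) fun x => image_eq_zero_of_notMem_tsupport fun hm =>
        (hφτ _ hm).false
  -- outside `E` both integrands vanish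
  have hoff : ∀ z ∈ cyl Ω τ \ (E ∩ cyl Ω τ),
      inner ℝ (dv z) (spow q (v z) - spow q (us z.1 + (G z).1))
        + inner ℝ (timeDeriv φ z) (spow q (us z.1 + (G z).1)) = 0 := fun z hz => by
    have hzE : z ∉ E := fun h => hz.2 ⟨h, hz.1⟩
    have hzC := hcyl hz.1
    have hzs : z ∉ tsupport φ := fun h => hzE (hφ.support h)
    have h0 : χ z.1 = 0 := image_eq_zero_of_notMem_tsupport fun h =>
      hzE (hE 0 z.2 le_rfl hzC.2.1 hzC.2.2 (hχ.support h))
    have h1 : v z = us z.1 := by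
      simp only [hv, mollified, decay, hG.timeMean_fst_eq_zero hh hE hEcyl hzC hzE, h0,
        image_eq_zero_of_notMem_tsupport hzs, smul_zero, add_zero]
    rw [hφzero hzs, h1, hG.fst_eq_zero z hzE, add_zero, sub_self, inner_zero_right,
      inner_zero_left, add_zero]
  have hEτ : MeasurableSet (E ∩ cyl Ω τ) := hEm.inter (measurableSet_cyl hΩ τ)
  rw [setIntegral_eq_of_subset_of_forall_sdiff_eq_zero (measurableSet_cyl hΩ τ)
    inter_subset_right hoff] at hmain
  have hdq := memLp_mollifiedDeriv hq hΩ hΩb hG hh.ne' τ hΨ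
  have hvq := memLp_mollified hq hΩ hΩb husq hG hh.ne' τ hΨ.continuous
  have hφq := memLp_restrict_cyl_of_continuous hΩ hΩb τ (continuous_timeDeriv hφ1)
    (ENNReal.ofReal (q + 1))
  have huq : MemLp (fun z => us z.1 + (G z).1) (ENNReal.ofReal (q + 1))
      (volume.restrict (cyl Ω τ)) := by
    refine MemLp.add ?_ (hG.fst_memLp.restrict _)
    rw [volume_restrict_cyl]; exact husq.comp_fst _
  have hi1 : IntegrableOn (fun z => inner ℝ (dv z) (spow q (v z) - spow q (us z.1 + (G z).1)))
      (E ∩ cyl Ω τ) := by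
    simp only [inner_sub_right]
    exact ((integrable_inner_spow hq hdq hvq).sub (integrable_inner_spow hq hdq huq)).mono_measure
      (Measure.restrict_mono inter_subset_right le_rfl)
  have hi2 : IntegrableOn (fun z => inner ℝ (timeDeriv φ z) (spow q (us z.1 + (G z).1)))
      (E ∩ cyl Ω τ) :=
    IntegrableOn.mono_set (integrable_inner_spow hq hφq huq) inter_subset_right
  rw [integral_add hi1 hi2] at hmain
  have hae : ∀ᵐ z ∂(volume.restrict (E ∩ cyl Ω τ)), u z = us z.1 + (G z).1 :=
    ae_restrict_of_ae_restrict_of_subset (inter_subset_right.trans hcyl) hu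
  have e1 : ∫ z in E ∩ cyl Ω τ, inner ℝ (dv z) (spow q (v z) - spow q (u z))
      = ∫ z in E ∩ cyl Ω τ, inner ℝ (dv z) (spow q (v z) - spow q (us z.1 + (G z).1)) :=
    integral_congr_ae (by filter_upwards [hae] with z hz using by rw [hz])
  have e2 : ∫ z in E, inner ℝ (spow q (u z)) (timeDeriv φ z)
      = ∫ z in E ∩ cyl Ω τ, inner ℝ (timeDeriv φ z) (spow q (us z.1 + (G z).1)) := by
    rw [setIntegral_eq_of_subset_of_forall_sdiff_eq_zero hEm
      (inter_subset_left (t := cyl Ω τ)) fun z hz => ?_]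
    · exact integral_congr_ae
        (by filter_upwards [hae] with z hz using by rw [hz, real_inner_comm])
    · rw [hφzero fun hm => hz.2 ⟨hz.1, (hEcyl hz.1).1, (hEcyl hz.1).2.1, hφτ z hm⟩,
        inner_zero_right]
  rw [e1, e2]
  linarith

end

/-! ### Passage to the limit -/

section

variable {n N : ℕ} {p q T : ℝ} {Ω : Set (Vec n)} {E : Set (Vec n × ℝ)}
  {us : Vec n → Vec N} {Dus : Vec n → Mat N n} {G : Vec n × ℝ → Vec N × Mat N n}
  {φ : Vec n × ℝ → Vec N} {χ : Vec n → Vec N}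

/-- The extension of the initial correction disappears in the limit, together with its gradient. -/
theorem tendsto_lintegral_decay [IsFiniteMeasure (volume.restrict Ω)] (hp : 0 < p)
    (hχ : IsTestFun Ω χ) (T : ℝ) :
    Tendsto (fun h => ∫⁻ z in cyl Ω T, ‖(decay h χ z, spaceGrad (decay h χ) z)‖ₑ ^ p)
      (𝓝[>] 0) (𝓝 0) := by
  have hcylfin := isFiniteMeasure_restrict_cyl (Ω := Ω) T
  let g : Vec n × ℝ → Vec N × Mat N n := fun z => (χ z.1, jac χ z.1)
  have he : ∀ (h : ℝ) (z : Vec n × ℝ),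
      (decay h χ z, spaceGrad (decay h χ) z) = Real.exp (-z.2 / h) • g z := fun h z => by
    rw [spaceGrad_decay h hχ.differentiable]; rfl
  have hgc : Continuous g := by
    have h1 := hχ.contDiff_one.continuous
    have h2 := continuous_jac hχ.contDiff_one
    fun_prop
  have hg : MemLp g (ENNReal.ofReal p) (volume.restrict (cyl Ω T)) := by
    rw [volume_restrict_cyl]
    exact (hχ.memLp_prodMk (ENNReal.ofReal p) (volume.restrict Ω)).comp_fst _
  have hpos : ∀ᵐ z ∂((volume : Measure (Vec n × ℝ)).restrict (cyl Ω T)), 0 < z.2 := by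
    rw [volume_restrict_cyl]
    refine Measure.quasiMeasurePreserving_snd.ae (p := fun t : ℝ => 0 < t) ?_
    rw [← restrict_Ioo_eq_restrict_Ico]
    filter_upwards [ae_restrict_mem measurableSet_Ioo] with t ht using ht.1
  simp only [he]
  have h0 : ∫⁻ _ in cyl Ω T, (0 : ℝ≥0∞) = 0 := lintegral_zero
  rw [← h0]
  refine tendsto_lintegral_filter_of_dominated_convergence (fun z => ‖g z‖ₑ ^ p)
    (Eventually.of_forall fun h => ?_) ?_ ((memLp_ofReal_iff hp hg.1).1 hg).ne ?_
  · have : Continuous fun z : Vec n × ℝ => Real.exp (-z.2 / h) • g z := by fun_prop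
    exact this.enorm.measurable.pow_const p
  · filter_upwards [self_mem_nhdsWithin] with h hh
    filter_upwards [hpos] with z hz
    refine ENNReal.rpow_le_rpow ?_ hp.le
    rw [enorm_smul]
    refine mul_le_of_le_one_left' ?_
    rw [Real.enorm_eq_ofReal (Real.exp_pos _).le, ENNReal.ofReal_le_one, Real.exp_le_one_iff]
    exact div_nonpos_of_nonpos_of_nonneg (by linarith) (le_of_lt hh)
  · filter_upwards [hpos] with z hz
    have h1 : Tendsto (fun h : ℝ => Real.exp (-z.2 / h)) (𝓝[>] 0) (𝓝 0) := by
      have h4 : Tendsto (fun h : ℝ => -z.2 * h⁻¹) (𝓝[>] 0) atBot :=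
        tendsto_inv_nhdsGT_zero.const_mul_atTop_of_neg (by linarith)
      exact Real.tendsto_exp_atBot.comp h4
    have h2 : Tendsto (fun h : ℝ => ‖Real.exp (-z.2 / h) • g z‖ₑ ^ p) (𝓝[>] 0)
        (𝓝 (‖(0 : ℝ) • g z‖ₑ ^ p)) :=
      ((h1.smul_const (g z)).enorm).ennrpow_const p
    rwa [zero_smul, enorm_zero, ENNReal.zero_rpow_of_pos hp] at h2

/-- As `h → 0`, the mollified comparison maps converge to `u + φ` together with their
gradients. -/
theorem tendsto_lintegral_mollified_sub [IsFiniteMeasure (volume.restrict Ω)] (hp : 1 ≤ p)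
    (hG : IsBoundaryDifference p q Ω T E G) (hχ : IsTestFun Ω χ)
    (hφ : ContDiff ℝ 1 φ) {u : Vec n × ℝ → Vec N} {Du : Vec n × ℝ → Mat N n}
    (hu : ∀ᵐ z ∂((volume : Measure (Vec n × ℝ)).restrict (cyl Ω T)),
      G z = (u z - us z.1, Du z - Dus z.1)) :
    Tendsto (fun h => ∫⁻ z in cyl Ω T,
      ‖(mollified h us G (fun z => decay h χ z + φ z) z - (u z + φ z),
        mollifiedGrad h Dus G (fun z => decay h χ z + φ z) z - (Du z + spaceGrad φ z))‖ₑ ^ p)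
      (𝓝[>] 0) (𝓝 0) := by
  have hp0 : 0 < p := by linarith
  have h1 := (tendsto_lintegral_timeMean_sub hp hG.stronglyMeasurable hG.memLp).mono_left
    (nhdsWithin_le_nhds (s := Ioi 0))
  have h2 := tendsto_lintegral_decay hp0 hχ T
  have hc : (2 : ℝ≥0∞) ^ (p - 1) ≠ ⊤ :=
    ENNReal.rpow_ne_top_of_nonneg (by linarith) ENNReal.ofNat_ne_top
  have h3 := ENNReal.Tendsto.const_mul (h1.add h2) (Or.inr hc)
  rw [add_zero, mul_zero] at h3
  refine tendsto_of_tendsto_of_tendsto_of_le_of_le tendsto_const_nhds h3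
    (fun _ => zero_le) fun h => ?_
  have hm : Measurable fun z => ‖timeMean h G z - G z‖ₑ ^ p :=
    (((StronglyMeasurable.timeMean h hG.stronglyMeasurable).sub
      hG.stronglyMeasurable).enorm).pow_const p
  calc _ ≤ ∫⁻ z in cyl Ω T, 2 ^ (p - 1) * (‖timeMean h G z - G z‖ₑ ^ p
        + ‖(decay h χ z, spaceGrad (decay h χ) z)‖ₑ ^ p) := by
        refine lintegral_mono_ae ?_
        filter_upwards [hu] with z hz
        have e : (mollified h us G (fun z => decay h χ z + φ z) z - (u z + φ z),
            mollifiedGrad h Dus G (fun z => decay h χ z + φ z) z - (Du z + spaceGrad φ z))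
            = (timeMean h G z - G z) + (decay h χ z, spaceGrad (decay h χ) z) := by
          rw [hz]
          simp only [mollified, mollifiedGrad, spaceGrad_add (contDiff_decay h hχ.contDiff_one) hφ]
          ext1
          · simp only [Prod.fst_add, Prod.fst_sub]; abel
          · simp only [Prod.snd_add, Prod.snd_sub]; abel
        rw [e]
        exact (ENNReal.rpow_le_rpow (enorm_add_le _ _) hp0.le).trans
          (ENNReal.rpow_add_le_mul_rpow_add_rpow _ _ hp)
    _ = 2 ^ (p - 1) * ((∫⁻ z in cyl Ω T, ‖timeMean h G z - G z‖ₑ ^ p)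
        + ∫⁻ z in cyl Ω T, ‖(decay h χ z, spaceGrad (decay h χ) z)‖ₑ ^ p) := by
        rw [lintegral_const_mul' _ _ hc, lintegral_add_left hm]
    _ ≤ _ := by
        gcongr
        exact Measure.restrict_le_self

/-- A bound on `E ∩ Ω_τ` for almost every `τ` close to `T` extends to `E`. -/
theorem energy_le_of_ae_le (hT : 0 < T)
    (hEcyl : E ⊆ cyl Ω T) {f : Vec n → Vec N → Mat N n → ℝ} {u : Vec n × ℝ → Vec N}
    {Du : Vec n × ℝ → Mat N n} {T' : ℝ} (hT' : T' < T) {c : EReal}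
    (h : ∀ᵐ τ ∂(volume.restrict (Ioo 0 T)), T' < τ →
      (energy f (E ∩ cyl Ω τ) u Du : EReal) ≤ c) :
    (energy f E u Du : EReal) ≤ c := by
  -- times close to `T` at which the inequality holds
  have hex : ∀ k : ℕ, ∃ τ, T - 1 / (k + 1) < τ ∧ τ < T ∧
      (energy f (E ∩ cyl Ω τ) u Du : EReal) ≤ c := fun k => by
    have hk : (0 : ℝ) < 1 / (k + 1) := by positivity
    have hlt : max (max 0 T') (T - 1 / (k + 1)) < T :=
      max_lt (max_lt hT hT') (by linarith)
    rw [ae_restrict_iff' measurableSet_Ioo] at h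
    have hne : (volume (Ioo (max (max 0 T') (T - 1 / (k + 1))) T)) ≠ 0 := by
      rw [Real.volume_Ioo]
      simpa using hlt
    obtain ⟨τ, hτ, hP⟩ := (frequently_ae_mem_iff.2 hne).and_eventually h |>.exists
    exact ⟨τ, (le_max_right _ _).trans_lt hτ.1, hτ.2, hP
      ⟨((le_max_left _ _).trans (le_max_left _ _)).trans_lt hτ.1, hτ.2⟩
      (((le_max_right _ _).trans (le_max_left _ _)).trans_lt hτ.1)⟩
  choose τ hτ1 hτ2 hτ3 using hex
  have hmono : ∀ {s t : ℝ}, s ≤ t → E ∩ cyl Ω s ⊆ E ∩ cyl Ω t := fun hst z hz =>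
    ⟨hz.1, hz.2.1, hz.2.2.1, hz.2.2.2.trans_le hst⟩
  have hU : ⋃ k, E ∩ cyl Ω (τ k) = E := by
    refine subset_antisymm (iUnion_subset fun k => inter_subset_left) fun z hz => ?_
    have hzT : 0 < T - z.2 := sub_pos.2 (hEcyl hz).2.2
    obtain ⟨k, hk⟩ := exists_nat_one_div_lt hzT
    refine mem_iUnion.2 ⟨k, hz, (hEcyl hz).1, (hEcyl hz).2.1, ?_⟩
    have := hτ1 k
    linarith
  have hdir : Directed (· ⊆ ·) fun k => E ∩ cyl Ω (τ k) := fun i j => by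
    rcases le_total (τ i) (τ j) with hij | hij
    · exact ⟨j, hmono hij, subset_rfl⟩
    · exact ⟨i, subset_rfl, hmono hij⟩
  have hsup : energy f E u Du = ⨆ k, energy f (E ∩ cyl Ω (τ k)) u Du := by
    conv_lhs => rw [← hU]
    exact setLIntegral_iUnion_of_directed _ hdir
  refine le_of_forall_lt fun d hd => ?_
  rcases lt_or_ge d 0 with hd0 | hd0
  · exact hd0.trans_le ((EReal.coe_ennreal_nonneg _).trans (hτ3 0))
  · lift d to ℝ≥0∞ using hd0
    rw [EReal.coe_ennreal_lt_coe_ennreal_iff, hsup, lt_iSup_iff] at hd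
    obtain ⟨k, hk⟩ := hd
    exact (EReal.coe_ennreal_lt_coe_ennreal_iff.2 hk).trans_le (hτ3 k)

end

/-! ### Variational solutions are parabolic minimizers -/

section

variable {n N : ℕ} {p q T : ℝ} {Ω : Set (Vec n)} {E : Set (Vec n × ℝ)}
  {f : Vec n → Vec N → Mat N n → ℝ} {uo us : Vec n → Vec N} {Dus : Vec n → Mat N n}
  {u : Vec n × ℝ → Vec N} {Du : Vec n × ℝ → Mat N n} {G : Vec n × ℝ → Vec N × Mat N n}
  {φ : Vec n × ℝ → Vec N} {χ : Vec n → Vec N}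

theorem IsRelOpen.measurableSet (hE : IsRelOpen Ω T E) (hΩ : MeasurableSet Ω) :
    MeasurableSet E := by
  obtain ⟨U, hU, rfl⟩ := hE
  exact hU.measurableSet.inter (measurableSet_cyl hΩ T)

theorem IsRelOpen.subset_cyl (hE : IsRelOpen Ω T E) : E ⊆ cyl Ω T := by
  obtain ⟨U, hU, rfl⟩ := hE
  exact inter_subset_right

theorem IsRelOpen.isOpen_slice_zero (hE : IsRelOpen Ω T E) (hΩ : IsOpen Ω) (hT : 0 < T) :
    IsOpen (slice E 0) := by
  obtain ⟨U, hU, rfl⟩ := hE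
  have : slice (U ∩ cyl Ω T) 0 = (fun x : Vec n => (x, (0 : ℝ))) ⁻¹' U ∩ Ω := by
    ext x
    simp [slice, cyl, hT]
  rw [this]
  exact (hU.preimage (by fun_prop)).inter hΩ

theorem isComparisonMap_mollified_decay_add [Fact (1 ≤ ENNReal.ofReal p)]
    [IsFiniteMeasure (volume.restrict Ω)] (hp : 1 < p) (hq : 0 < q) (hT : 0 < T)
    (hΩ : MeasurableSet Ω) (hΩb : Bornology.IsBounded Ω) (hEm : MeasurableSet E)
    (hE : IsNondecreasing T E) (hEcyl : E ⊆ cyl Ω T) (hus : MemW1p p Ω us Dus)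
    (husq : MemLp us (ENNReal.ofReal (q + 1)) (volume.restrict Ω))
    (hG : IsBoundaryDifference p q Ω T E G) {h : ℝ} (hh : 0 < h) (hχ : IsTestFun (slice E 0) χ)
    (hφ : IsTestFun E φ) :
    IsComparisonMap p q Ω T E us Dus (mollified h us G fun z => decay h χ z + φ z)
      (mollifiedGrad h Dus G fun z => decay h χ z + φ z)
      (mollifiedDeriv h G fun z => decay h χ z + φ z) :=
  isComparisonMap_mollified hp hq hT hΩ hΩb hEm hE hEcyl hus husq hG hh
    ((contDiff_decay h hχ.contDiff_one).add hφ.contDiff_one)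
    (fun t _ => (IsTestFun.const_smul (Real.exp (-t / h))
      ⟨hχ.smooth, hχ.compact, fun x hx => (hEcyl (hχ.support hx)).1⟩).add (hφ.slice hEcyl t))
    (fun z hzC hzE => by
      have h0 : χ z.1 = 0 := hχ.eq_zero_of_notMem fun hm =>
        hzE (hE 0 z.2 le_rfl hzC.2.1 hzC.2.2 hm)
      rw [decay, h0, hφ.eq_zero_of_notMem hzE, smul_zero, add_zero])

/-- The variational inequality for the mollified comparison map. The contribution of the terminal
time has a favourable sign. -/
theorem IsVariationalSolution.energy_le_mollified [Fact (1 ≤ ENNReal.ofReal p)]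
    [IsFiniteMeasure (volume.restrict Ω)] (hp : 1 < p) (hq : 0 < q) (hT : 0 < T)
    (hΩ : MeasurableSet Ω) (hΩb : Bornology.IsBounded Ω) (hEm : MeasurableSet E)
    (hE : IsNondecreasing T E) (hEcyl : E ⊆ cyl Ω T) (hus : MemW1p p Ω us Dus)
    (husq : MemLp us (ENNReal.ofReal (q + 1)) (volume.restrict Ω))
    (hu : IsVariationalSolution p q Ω T E f uo us Dus u Du)
    (hG : IsBoundaryDifference p q Ω T E G)
    (hGu : ∀ᵐ z ∂((volume : Measure (Vec n × ℝ)).restrict (cyl Ω T)), u z = us z.1 + (G z).1)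
    {h : ℝ} (hh : 0 < h) (hχ : IsTestFun (slice E 0) χ) (hφ : IsTestFun E φ) {η : ℝ}
    (hη : ∫ x in slice E 0, bterm q (uo x) (us x + χ x) ≤ η) :
    (energy f E u Du : EReal)
      ≤ (energy f E (mollified h us G fun z => decay h χ z + φ z)
          (mollifiedGrad h Dus G fun z => decay h χ z + φ z) : EReal)
        + ((η - ∫ z in E, inner ℝ (spow q (u z)) (timeDeriv φ z) : ℝ) : EReal) := by
  have hcomp := isComparisonMap_mollified_decay_add hp hq hT hΩ hΩb hEm hE hEcyl hus husq hG hh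
    hχ hφ
  obtain ⟨T', hT'T, hT'⟩ := hφ.exists_time_bound hEcyl hT
  refine energy_le_of_ae_le hT hEcyl hT'T ?_
  filter_upwards [hu.variational _ _ _ hcomp, ae_restrict_mem measurableSet_Ioo]
    with τ hτ hτT hτT'
  refine hτ.trans ?_
  have hdt := setIntegral_inner_mollifiedDeriv_le hq hΩ hΩb hEm hE hEcyl husq hG hh hχ hφ hGu
    hτT.1.le hτT.2 fun z hz => (hT' z hz).trans_lt hτT'
  have hterm : 0 ≤ ∫ x in slice E τ, bterm q (u (x, τ))
      (mollified h us G (fun z => decay h χ z + φ z) (x, τ)) :=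
    integral_nonneg fun x => bterm_nonneg hq _ _
  have hinit : ∀ x, mollified h us G (fun z => decay h χ z + φ z) (x, 0) = us x + χ x :=
    fun x => by
      simp only [mollified, hG.timeMean_zero hh, Prod.fst_zero, decay, hφ.apply_zero hEcyl,
        neg_zero, zero_div, Real.exp_zero, one_smul, add_zero]
  have hen : energy f (E ∩ cyl Ω τ) (mollified h us G fun z => decay h χ z + φ z)
        (mollifiedGrad h Dus G fun z => decay h χ z + φ z)
      ≤ energy f E (mollified h us G fun z => decay h χ z + φ z)
        (mollifiedGrad h Dus G fun z => decay h χ z + φ z) :=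
    lintegral_mono_set inter_subset_left
  simp only [hinit]
  refine add_le_add (EReal.coe_ennreal_le_coe_ennreal_iff.2 hen) (EReal.coe_le_coe_iff.2 ?_)
  linarith

end

end DoublyNonlinear

end

open DoublyNonlinear
theorem lemma5p2 {n N : ℕ} (hn : 2 ≤ n) (hN : 1 ≤ N)
    (p q ν L T : ℝ) (hp : 1 < p) (hq : 0 < q) (hν : 0 < ν) (hνL : ν ≤ L) (hT : 0 < T)
    (Ω : Set (Vec n)) (hΩo : IsOpen Ω) (hΩb : Bornology.IsBounded Ω)
    (E : Set (Vec n × ℝ)) (hEo : IsRelOpen Ω T E) (hE : IsNondecreasing T E)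
    (f : Vec n → Vec N → Mat N n → ℝ) (hf : IsIntegrand p ν Ω f)
    (G : Vec n → ℝ) (hG : IntegrableOn G Ω) (hfG : HasPGrowth p L G Ω f)
    (uo : Vec n → Vec N)
    (huo : MemLp uo (ENNReal.ofReal (q + 1)) (volume.restrict (slice E 0)))
    (us : Vec n → Vec N) (Dus : Vec n → Mat N n) (hus : MemW1p p Ω us Dus)
    (husq : MemLp us (ENNReal.ofReal (q + 1)) (volume.restrict Ω))
    (u : Vec n × ℝ → Vec N) (Du : Vec n × ℝ → Mat N n)
    (hu : IsVariationalSolution p q Ω T E f uo us Dus u Du) :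
    IsParabolicMinimizer p q Ω T E f us Dus u Du := by
  have : Fact (1 ≤ ENNReal.ofReal p) := ⟨by simpa using hp.le⟩
  have : IsFiniteMeasure (volume.restrict Ω) := ⟨by
    rw [Measure.restrict_apply_univ]; exact hΩb.measure_lt_top⟩
  have hcylfin := isFiniteMeasure_restrict_cyl (Ω := Ω) T
  have hΩ := hΩo.measurableSet
  have hEm := hEo.measurableSet hΩ
  have hEcyl := hEo.subset_cyl
  refine ⟨hu.memVpq.memVp, IntegrableOn.mono_set (integrable_spow hq hu.memVpq.memLq) hEcyl,
    fun φ hφ => ?_⟩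
  obtain ⟨H, hH, hHu⟩ := exists_isBoundaryDifference hΩ hEm hu.memVpq hus husq
  have hHu' : ∀ᵐ z ∂((volume : Measure (Vec n × ℝ)).restrict (cyl Ω T)),
      u z = us z.1 + (H z).1 := by
    filter_upwards [hHu] with z hz
    rw [hz, add_sub_cancel]
  have hslice : slice E 0 ⊆ Ω := fun x hx => (hEcyl hx).1
  have hw : MemLp (fun z => (u z + φ z, Du z + spaceGrad φ z)) (ENNReal.ofReal p)
      (volume.restrict (cyl Ω T)) :=
    memLp_prodMk_iff.2
      ⟨hu.memVpq.memVp.memLp.add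
        (memLp_restrict_cyl_of_continuous hΩ hΩb T hφ.contDiff_one.continuous _),
      hu.memVpq.memVp.grad_memLp.add
        (memLp_restrict_cyl_of_continuous hΩ hΩb T (continuous_spaceGrad hφ.contDiff_one) _)⟩
  set I := ∫ z in E, inner ℝ (spow q (u z)) (timeDeriv φ z)
  set W := energy f E (fun z => u z + φ z) (fun z => Du z + spaceGrad φ z)
  have hkey : ∀ η : ℝ, 0 < η →
      (energy f E u Du : EReal)
        ≤ ((W + ENNReal.ofReal η : ℝ≥0∞) : EReal) + ((η - I : ℝ) : EReal) := by
    intro η hη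
    obtain ⟨χ, hχ, hχη⟩ := exists_isTestFun_integral_bterm_le (hEo.isOpen_slice_zero hΩo hT)
      ((measure_mono hslice).trans_lt hΩb.measure_lt_top).ne hq huo
      (husq.mono_measure (Measure.restrict_mono hslice le_rfl)) hη
    obtain ⟨δ, hδ, hδE⟩ := exists_forall_energy_le hp (hν.le.trans hνL) hEm hEcyl hf hG hfG hw hη
    have hlim := tendsto_lintegral_mollified_sub hp.le hH
      (⟨hχ.smooth, hχ.compact, hχ.support.trans hslice⟩ : IsTestFun Ω χ) hφ.contDiff_one hHu
    obtain ⟨h, hhδ, hh⟩ := ((hlim.eventually (gt_mem_nhds hδ)).and self_mem_nhdsWithin).exists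
    have hv := (isComparisonMap_mollified_decay_add hp hq hT hΩ hΩb hEm hE hEcyl hus husq hH hh
      hχ hφ).memVpq.memVp
    have hvE := hδE _ _ (hv.memLp.1.prodMk hv.grad_memLp.1) hhδ.le
    refine (hu.energy_le_mollified hp hq hT hΩ hΩb hEm hE hEcyl hus husq hH hHu' hh hχ hφ
      hχη).trans ?_
    exact add_le_add_left (EReal.coe_ennreal_le_coe_ennreal_iff.2 hvE) _
  -- if the right hand side is finite, so is the left, and `η → 0` can be taken in `ℝ`
  rcases eq_or_ne W ⊤ with hWtop | hWtop
  · rw [hWtop, EReal.coe_ennreal_top]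
    exact le_top
  generalize energy f E u Du = U at hkey ⊢
  clear_value W
  lift W to ℝ≥0 using hWtop
  have hkey' : ∀ η : ℝ, 0 < η → (U : EReal) ≤ ((W + η + (η - I) : ℝ) : EReal) := fun η hη => by
    refine (hkey η hη).trans_eq ?_
    rw [EReal.coe_ennreal_add, EReal.coe_ennreal_ofReal, max_eq_left hη.le]
    rfl
  have hU : U ≠ ⊤ := fun htop => by
    have := hkey' 1 one_pos
    rw [htop, EReal.coe_ennreal_top, top_le_iff] at this
    exact EReal.coe_ne_top _ this
  lift U to ℝ≥0 using hU
  have hreal : I + (U : ℝ) ≤ W := by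
    refine le_of_forall_pos_le_add fun η hη => ?_
    have h1 : (U : ℝ) ≤ W + η / 2 + (η / 2 - I) := EReal.coe_le_coe_iff.1 (hkey' _ (half_pos hη))
    linarith
  exact EReal.coe_le_coe_iff.2 hreal
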